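/- Let $p$ be a prime, let $\mathbb F$ be a field of characteristic $p$, and let $L$ and $H$ be restricted Lie algebras over $\mathbb F$ (of arbitrary dimension) with $[p]$-map $x\mapsto x^{[p]}$. Let $u(L)$ be the restricted enveloping algebra of $L$, that is, the quotient of the universal enveloping algebra $U(L)$ by the ideal generated by all $x^{[p]}-x^p$ with $x\in L$; let $\omega(L)$ be its augmentation ideal (the kernel of the algebra homomorphism $u(L)\to\mathbb F$ with $x\mapsto 0$ for $x\in L$), and let $D_n(L)=L\cap\omega(L)^n$ (the elements of $L$ whose image in $u(L)$ lies in $\omega(L)^n$) be the $n$-th dimension subalgebra of $L$. Write $L'_p$ for the restricted subalgebra of $L$ generated by $L'=[L,L]$. Call $L$ $p$-nilpotent if there is $k\ge 1$ such that the $k$-fold iterate of the $[p]$-map sends every element of $L$ to $0$. For a nilpotent Lie algebra $L$ let $\mathrm{cl}(L)$ be the least integer $c\ge 0$ with $\gamma_{c+1}(L)=0$, where $\gamma_1(L)=L$ and $\gamma_{n+1}(L)=[\gamma_n(L),L]$. Suppose that $u(L)\cong u(H)$ as associative $\mathbb F$-algebras. Then: 1. For every $i\ge 1$, $D_i(L)/D_{i+1}(L)\cong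 D_i(H)/D_{i+1}(H)$ as restricted Lie algebras (equivalently, as vector spaces, since the bracket and the $[p]$-map of these quotients are zero). 2. If $L$ is finite-dimensional and $p$-nilpotent, then $L$ and $H$ are nilpotent and $|\mathrm{cl}(L)-\mathrm{cl}(H)|\le 1$. 3. If $L$ and $H$ are finite-dimensional, then $D_n(L'_p)/D_{n+1}(L'_p)\cong D_n(H'_p)/D_{n+1}(H'_p)$ as restricted Lie algebras (equivalently, as vector spaces) for every $n\ge 1$. -/

import Mathlib

noncomputable section

/-! ### Restricted Lie algebras -/

/-- `s_i(x, y)`: the element of `L` such that `i • s_i(x, y)` is the coefficient of `λ ^ (i - 1)`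
in `ad (λ x + y) ^ (p - 1) (x)`. The operator `ad (λ x + y)` is a polynomial in the central
variable `λ` over the (non-commutative) ring of endomorphisms of `L`.
(Replacing `ad x = [x, ·]` by `[·, x]` changes the sign of `ad` and hence nothing here, because
`(-1) ^ (p - 1) = 1` in a field of prime characteristic `p`.) -/
def jacobsonS (p : ℕ) (F : Type*) {L : Type*} [Field F] [LieRing L] [LieAlgebra F L]
    (i : ℕ) (x y : L) : L :=
  (i : F)⁻¹ • ((((Polynomial.C (LieAlgebra.ad F L x : Module.End F L) * Polynomial.X
    + Polynomial.C (LieAlgebra.ad F L y : Module.End F L)) ^ (p - 1)).coeff (i - 1)) x)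

/-- A restricted Lie algebra over a field `F` (of prime characteristic `p`): a Lie algebra with a
`[p]`-mapping. -/
class RestrictedLieAlgebra (p : ℕ) (F : Type*) (L : Type*) [Field F] [LieRing L]
    [LieAlgebra F L] where
  /-- the `[p]`-mapping `x ↦ x ^ [p]` -/
  pmap : L → L
  ad_pmap : ∀ x : L, LieAlgebra.ad F L (pmap x) = (LieAlgebra.ad F L x : Module.End F L) ^ p
  pmap_smul : ∀ (a : F) (x : L), pmap (a • x) = a ^ p • pmap x
  pmap_add : ∀ x y : L,
    pmap (x + y) = pmap x + pmap y + ∑ i ∈ Finset.Icc 1 (p - 1), jacobsonS p F i x y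

/-- Isomorphisms of restricted Lie algebras. -/
structure RestrictedLieEquiv (p : ℕ) (F : Type*) (L H : Type*) [Field F]
    [LieRing L] [LieAlgebra F L] [RestrictedLieAlgebra p F L]
    [LieRing H] [LieAlgebra F H] [RestrictedLieAlgebra p F H] extends L ≃ₗ⁅F⁆ H where
  map_pmap' : ∀ x : L, toFun (RestrictedLieAlgebra.pmap p F x) =
    RestrictedLieAlgebra.pmap p F (toFun x)

namespace RestrictedLieAlgebra

section Constructions

variable (p : ℕ) (F : Type*) {L M : Type*} [Field F] [LieRing L] [LieAlgebra F L]
  [LieRing M] [LieAlgebra F M]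

theorem map_ad_coeff (f : L →ₗ⁅F⁆ M) (x y z : L) (n i : ℕ) :
    f ((((Polynomial.C (LieAlgebra.ad F L x : Module.End F L) * Polynomial.X
      + Polynomial.C (LieAlgebra.ad F L y : Module.End F L)) ^ n).coeff i) z) =
    (((Polynomial.C (LieAlgebra.ad F M (f x) : Module.End F M) * Polynomial.X
      + Polynomial.C (LieAlgebra.ad F M (f y) : Module.End F M)) ^ n).coeff i) (f z) := by
  induction n generalizing i with
  | zero =>
    rcases i with _ | i
    · simp
    · simp [Polynomial.coeff_one]
  | succ n ih =>
    rcases i with _ | i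
    · simp [pow_succ', add_mul, mul_assoc, ih]
    · simp [pow_succ', add_mul, mul_assoc, Polynomial.coeff_X_mul, ih]

theorem map_jacobsonS (f : L →ₗ⁅F⁆ M) (i : ℕ) (x y : L) :
    f (jacobsonS p F i x y) = jacobsonS p F i (f x) (f y) := by
  simp only [jacobsonS, map_smul, map_ad_coeff]

theorem map_ad_pow (f : L →ₗ⁅F⁆ M) (x z : L) (n : ℕ) :
    f (((LieAlgebra.ad F L x : Module.End F L) ^ n) z) =
      ((LieAlgebra.ad F M (f x) : Module.End F M) ^ n) (f z) := by
  induction n with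
  | zero => simp
  | succ n ih => simp [pow_succ', ih]

variable [RestrictedLieAlgebra p F L]

/-- A Lie subalgebra closed under the `[p]`-mapping (a restricted subalgebra) is a restricted
Lie algebra. -/
@[reducible]
def ofSubalgebra (K : LieSubalgebra F L) (hK : ∀ x ∈ K, pmap p F x ∈ K) :
    RestrictedLieAlgebra p F K where
  pmap x := ⟨pmap p F (x : L), hK x x.2⟩
  ad_pmap x := by
    ext z
    have h := congrArg (fun g : Module.End F L => g (z : L)) (ad_pmap (p := p) (F := F) (x : L))
    have h2 := map_ad_pow F K.incl x z p
    simp only [LieSubalgebra.coe_incl] at h2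
    rw [h2, ← h]
    simp
  pmap_smul a x := Subtype.ext (pmap_smul a (x : L))
  pmap_add x y := by
    apply Subtype.ext
    have h := pmap_add (p := p) (F := F) (x : L) (y : L)
    have h2 := fun i => map_jacobsonS p F K.incl i x y
    simp only [LieSubalgebra.coe_incl] at h2
    simp [h, h2]

/-- The quotient map of a Lie algebra by an ideal, as a homomorphism of Lie algebras. -/
def quotMk (I : LieIdeal F L) : L →ₗ⁅F⁆ L ⧸ I :=
  { (I : Submodule F L).mkQ with
    map_lie' := fun {x y} => LieSubmodule.Quotient.mk_bracket I x y }

theorem quotMk_pmap (I : LieIdeal F L) (hI : ∀ x ∈ I, pmap p F x ∈ I) {x y : L}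
    (hxy : quotMk F I x = quotMk F I y) :
    quotMk F I (pmap p F x) = quotMk F I (pmap p F y) := by
  have key : ∀ z : L, quotMk F I z = 0 ↔ z ∈ I := fun z => LieSubmodule.Quotient.mk_eq_zero'
  have h0 : quotMk F I (x - y) = 0 := by rw [map_sub, hxy, sub_self]
  have h1 : quotMk F I (pmap p F (x - y)) = 0 := (key _).2 (hI _ ((key _).1 h0))
  have h := congrArg (quotMk F I) (pmap_add (p := p) (F := F) (x - y) y)
  have h2 : ∀ i, jacobsonS p F i (0 : L ⧸ I) (quotMk F I y) = 0 := by
    intro i; simp [jacobsonS]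
  simpa [h1, h0, map_jacobsonS, h2] using h

/-- The quotient of a restricted Lie algebra by an ideal closed under the `[p]`-mapping, with
`(x + I) ^ [p] = x ^ [p] + I`. -/
@[reducible]
def ofQuotient (I : LieIdeal F L) (hI : ∀ x ∈ I, pmap p F x ∈ I) :
    RestrictedLieAlgebra p F (L ⧸ I) where
  pmap := Quotient.map' (s₁ := (I : Submodule F L).quotientRel)
    (s₂ := (I : Submodule F L).quotientRel) (pmap p F) (fun x y h => Quotient.exact
      (quotMk_pmap p F I hI (Quotient.sound h : quotMk F I x = quotMk F I y)))
  ad_pmap x := by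
    induction x using Quotient.inductionOn' with | _ x => ?_
    ext z
    induction z using Quotient.inductionOn' with | _ z => ?_
    have h := congrArg (fun g : Module.End F L => quotMk F I (g z))
      (ad_pmap (p := p) (F := F) x)
    exact h.trans (map_ad_pow F (quotMk F I) x z p)
  pmap_smul a x := by
    induction x using Quotient.inductionOn' with | _ x => ?_
    exact congrArg (quotMk F I) (pmap_smul (p := p) a x)
  pmap_add x y := by
    induction x using Quotient.inductionOn' with | _ x => ?_
    induction y using Quotient.inductionOn' with | _ y => ?_
    have h := congrArg (quotMk F I) (pmap_add (p := p) (F := F) x y)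
    simp only [map_add, map_sum, map_jacobsonS] at h
    exact h

end Constructions

/-! ### Nilpotency and the derived restricted subalgebra -/

/-- `L` is `p`-nilpotent: for some `k ≥ 1`, the `k`-fold `[p]`-power of every element is `0`. -/
def IsPNilpotent (p : ℕ) (F L : Type*) [Field F] [LieRing L] [LieAlgebra F L]
    [RestrictedLieAlgebra p F L] : Prop :=
  ∃ k : ℕ, 0 < k ∧ ∀ x : L, (pmap p F)^[k] x = 0

/-- The restricted subalgebra generated by a set: the smallest Lie subalgebra which contains the
set and is closed under the `[p]`-mapping. -/
def restrictedClosure (p : ℕ) (F : Type*) {L : Type*} [Field F] [LieRing L] [LieAlgebra F L]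
    [RestrictedLieAlgebra p F L] (X : Set L) : LieSubalgebra F L :=
  sInf {K : LieSubalgebra F L | X ⊆ K ∧ ∀ x ∈ K, pmap p F x ∈ K}

theorem pmap_mem_restrictedClosure (p : ℕ) (F : Type*) {L : Type*} [Field F] [LieRing L]
    [LieAlgebra F L] [RestrictedLieAlgebra p F L] (X : Set L) :
    ∀ x ∈ restrictedClosure p F X, pmap p F x ∈ restrictedClosure p F X := by
  intro x hx
  have key : ∀ z : L, z ∈ restrictedClosure p F X ↔
      ∀ K ∈ {K : LieSubalgebra F L | X ⊆ K ∧ ∀ x ∈ K, pmap p F x ∈ K}, z ∈ K := by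
    intro z
    rw [restrictedClosure, ← SetLike.mem_coe, LieSubalgebra.coe_sInf]
    simp
  rw [key] at hx ⊢
  exact fun K hK => hK.2 x (hx K hK)

/-- `L'_p`, the restricted subalgebra generated by the derived subalgebra `L' = [L, L]`. -/
def derivedRestricted (p : ℕ) (F L : Type*) [Field F] [LieRing L] [LieAlgebra F L]
    [RestrictedLieAlgebra p F L] : LieSubalgebra F L :=
  restrictedClosure p F ((⁅(⊤ : LieIdeal F L), (⊤ : LieIdeal F L)⁆ : LieIdeal F L) : Set L)

instance (p : ℕ) (F L : Type*) [Field F] [LieRing L] [LieAlgebra F L]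
    [RestrictedLieAlgebra p F L] : RestrictedLieAlgebra p F (derivedRestricted p F L) :=
  ofSubalgebra p F _ (pmap_mem_restrictedClosure p F _)

end RestrictedLieAlgebra

open RestrictedLieAlgebra

/-! ### The restricted enveloping algebra -/

section Enveloping

attribute [local instance 100] LieRing.ofAssociativeRing

variable (p : ℕ) (F L : Type*) [Field F] [LieRing L] [LieAlgebra F L] [RestrictedLieAlgebra p F L]

/-- The relations `x ^ [p] = x ^ p`, for `x ∈ L`, in the universal enveloping algebra. -/
inductive RestrictedEnvelopingAlgebra.Rel :
    UniversalEnvelopingAlgebra F L → UniversalEnvelopingAlgebra F L → Prop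
  | pmap_compat (x : L) : Rel (UniversalEnvelopingAlgebra.ι F (pmap p F x))
      (UniversalEnvelopingAlgebra.ι F x ^ p)

/-- The restricted enveloping algebra `u(L)`: the quotient of the universal enveloping algebra
`U(L)` by the two-sided ideal generated by all `x ^ [p] - x ^ p` with `x ∈ L`. -/
abbrev RestrictedEnvelopingAlgebra : Type _ := RingQuot (RestrictedEnvelopingAlgebra.Rel p F L)

namespace RestrictedEnvelopingAlgebra

/-- The natural map `L → u(L)`. -/
def ι : L →ₗ[F] RestrictedEnvelopingAlgebra p F L :=
  (RingQuot.mkAlgHom F (Rel p F L)).toLinearMap ∘ₗ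
    (UniversalEnvelopingAlgebra.ι F : L →ₗ⁅F⁆ UniversalEnvelopingAlgebra F L).toLinearMap

theorem ι_pmap (x : L) : ι p F L (pmap p F x) = ι p F L x ^ p := by
  have h := RingQuot.mkAlgHom_rel F (Rel.pmap_compat (p := p) (F := F) x)
  simpa [ι] using h

theorem ι_lie (x y : L) : ι p F L ⁅x, y⁆ = ι p F L x * ι p F L y - ι p F L y * ι p F L x := by
  simp [ι, LieRing.of_associative_ring_bracket]

variable [Fact p.Prime]

/-- The augmentation map `u(L) → F`, the algebra homomorphism with `x ↦ 0` for `x ∈ L`. -/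
def augmentation : RestrictedEnvelopingAlgebra p F L →ₐ[F] F :=
  RingQuot.liftAlgHom F ⟨UniversalEnvelopingAlgebra.lift F 0, by
    rintro _ _ ⟨x⟩
    simp [(Fact.out : p.Prime).ne_zero]⟩

theorem augmentation_ι (x : L) : augmentation p F L (ι p F L x) = 0 := by
  simp [augmentation, ι]

/-- The augmentation ideal `ω(L)`, the kernel of the augmentation map. -/
def augmentationIdeal : Ideal (RestrictedEnvelopingAlgebra p F L) :=
  RingHom.ker (augmentation p F L)

instance : (augmentationIdeal p F L).IsTwoSided := RingHom.instIsTwoSidedKer _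

end RestrictedEnvelopingAlgebra

open RestrictedEnvelopingAlgebra

variable [Fact p.Prime]

/-! ### Dimension subalgebras -/

/-- The `n`-th dimension subalgebra `D_n(L) = L ∩ ω(L) ^ n`, an ideal of `L`. -/
def dimensionSubalgebra (n : ℕ) : LieIdeal F L where
  carrier := {x | ι p F L x ∈ augmentationIdeal p F L ^ n}
  add_mem' hx hy := by
    simp only [Set.mem_ofPred_eq, map_add] at *
    exact add_mem hx hy
  zero_mem' := by simp
  smul_mem' a x hx := by
    simp only [Set.mem_ofPred_eq, map_smul, Algebra.smul_def] at *
    exact Ideal.mul_mem_left _ _ hx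
  lie_mem {x m} hm := by
    have hm' : ι p F L m ∈ augmentationIdeal p F L ^ n := hm
    change ι p F L ⁅x, m⁆ ∈ augmentationIdeal p F L ^ n
    rw [ι_lie]
    exact sub_mem (Ideal.mul_mem_left _ _ hm') (Ideal.mul_mem_right _ _ hm')

theorem mem_dimensionSubalgebra (n : ℕ) (x : L) :
    x ∈ dimensionSubalgebra p F L n ↔ ι p F L x ∈ augmentationIdeal p F L ^ n := Iff.rfl

theorem pmap_mem_dimensionSubalgebra (n : ℕ) :
    ∀ x ∈ dimensionSubalgebra p F L n, pmap p F x ∈ dimensionSubalgebra p F L n := by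
  intro x hx
  rw [mem_dimensionSubalgebra, ι_pmap]
  exact Ideal.pow_mem_of_mem _ hx p (Fact.out : p.Prime).pos

instance (n : ℕ) : RestrictedLieAlgebra p F (dimensionSubalgebra p F L n) :=
  ofSubalgebra p F (dimensionSubalgebra p F L n : LieSubalgebra F L)
    (pmap_mem_dimensionSubalgebra p F L n)

/-- `D_{n+1}(L)`, as an ideal of `D_n(L)`. -/
def nextDimensionIdeal (n : ℕ) : LieIdeal F (dimensionSubalgebra p F L n) :=
  LieIdeal.comap (dimensionSubalgebra p F L n).incl (dimensionSubalgebra p F L (n + 1))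

/-- The quotient `D_n(L) / D_{n+1}(L)`. -/
abbrev DimensionQuotient (n : ℕ) : Type _ :=
  dimensionSubalgebra p F L n ⧸ nextDimensionIdeal p F L n

instance (n : ℕ) : RestrictedLieAlgebra p F (DimensionQuotient p F L n) :=
  ofQuotient p F (nextDimensionIdeal p F L n)
    (fun x hx => pmap_mem_dimensionSubalgebra p F L (n + 1) x hx)

end Enveloping

end

/-! The common tool is the Poincaré-Birkhoff-Witt (PBW) theorem for `u(L)`. Its independence half
comes from letting `L` act on polynomials in an ordered basis and dividing out the images of the
central operators `x ^ p - x ^ [p]`; Jacobson's formula extends `x ^ [p] = x ^ p` from basis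
elements to all of `L`. Call a descending family `R` of subspaces with `R 1 = L`, `[R i, R j] ⊆ R (i
+ j)` and `(R i) ^ [p] ⊆ R (p i)` a restricted filtration. In a basis adapted to `R`, sorting a word
and replacing `p` equal letters by a `[p]`-power never lowers the weight. So if `x ∈ L` is a
combination of products of weight at least `n` in `u(L)`, its PBW coordinates force `x ∈ R n`
(`mem_of_ι_mem_productSpan`).

Statement 1. By that principle the dimension subalgebras are the smallest restricted filtration.
Hence `D_n / D_{n+1}` is the degree `n` part of the restricted Lie algebra generated by `ω / ω ^ 2`
in the graded algebra of `ω`, which depends only on the pair `(u(L), ω)`. A translation `x ↦ x -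
c(x)` makes the isomorphism respect augmentations (`exists_algEquiv_augmentation`).

Statement 2. For an algebra `A` let `E_m` be the smallest multiplicative filtration with `E_0 = A`
and `[E_m, A] ⊆ E_{m+1}`, and let `Q_m` be the span of all `E_i E_j` with `i + j = m` and `i, j ≥
1`. In `u(L)` one has `E_m ⊆ γ_{m+1}(L) u(L) + Q_m` for `m ≥ 1`, so `γ_{c+1}(L) = 0` with `c ≥ 1`
gives `E_c = Q_c`, which passes to `u(H)`. There `γ_{c+1}(H) ⊆ E_c = Q_c`, and `Q_c` consists of
elements of weight at least `c + 2` for every restricted filtration of `H`. For the filtration by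
the effect of `ad` on the lower central series this says `γ_{c+2}(H) ⊆ γ_{c+3}(H)`, and nilpotency
makes both zero. Nilpotency itself comes from Engel's theorem, and `p`-nilpotency passes to `H`
because it amounts to nilpotency of `ω`.

Statement 3. The ideal of `u(L)` generated by commutators is `ω(L'_p) u(L)`, and its `n`-th power is
`ω(L'_p) ^ n u(L)`. As `u(L)` is free over `u(L'_p)`, the dimensions of these powers determine those
of `ω(L'_p) ^ n`. Counting PBW monomials by weight then recovers the dimension of each `D_n(L'_p) /
D_{n+1}(L'_p)`. -/

noncomputable section

open Finsupp

/-! ### The action of a Lie algebra on polynomials in an ordered basis -/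

namespace PBW

section Action

variable {F L I : Type*} [Field F] [LieRing L] [LieAlgebra F L]

/-- The polynomials in the variables `I` of degree less than `k`. -/
def low (F I : Type*) [Field F] (k : ℕ) : Submodule F (Multiset I →₀ F) :=
  Finsupp.supported F F {m | Multiset.card m < k}

theorem single_mem_low {k : ℕ} {m : Multiset I} (h : Multiset.card m < k) (a : F) :
    single m a ∈ low F I k :=
  Finsupp.single_mem_supported F a h

theorem low_mono {k l : ℕ} (h : k ≤ l) : low F I k ≤ low F I l :=
  Finsupp.supported_mono fun _ hm => lt_of_lt_of_le hm h

theorem low_zero : low F I 0 = ⊥ := by simp [low]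

theorem exists_mem_low (v : Multiset I →₀ F) : ∃ k, v ∈ low F I k := by
  refine ⟨v.support.sup Multiset.card + 1, ?_⟩
  rw [low, Finsupp.mem_supported]
  intro m hm
  exact Nat.lt_succ_of_le (Finset.le_sup (f := Multiset.card) hm)

theorem low_eq_span (k : ℕ) :
    low F I k = Submodule.span F ((fun m => single m (1 : F)) '' {m | Multiset.card m < k}) := by
  rw [low, Finsupp.supported_eq_span_single]

theorem low_induction {k : ℕ} {P : (Multiset I →₀ F) → Prop}
    (hs : ∀ m : Multiset I, Multiset.card m < k → P (single m 1)) (h0 : P 0)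
    (ha : ∀ u v, P u → P v → P (u + v)) (hc : ∀ (a : F) v, P v → P (a • v))
    {v : Multiset I →₀ F} (hv : v ∈ low F I k) : P v := by
  rw [low_eq_span] at hv
  refine Submodule.span_induction ?_ h0 (fun u v _ _ => ha u v) (fun a v _ => hc a v) hv
  rintro _ ⟨m, hm, rfl⟩
  exact hs m hm

theorem basis_induction (b : Module.Basis I F L) {P : L → Prop} (hs : ∀ i, P (b i)) (h0 : P 0)
    (ha : ∀ u v, P u → P v → P (u + v)) (hc : ∀ (a : F) v, P v → P (a • v)) (x : L) : P x := by
  have hx : x ∈ Submodule.span F (Set.range b) := by rw [b.span_eq]; trivial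
  refine Submodule.span_induction ?_ h0 (fun u v _ _ => ha u v) (fun a v _ => hc a v) hx
  rintro _ ⟨i, rfl⟩
  exact hs i

variable [LinearOrder I] (b : Module.Basis I F L)

open Classical in
/-- Approximations to the action: the `n`-th one is correct in degrees at most `n`. -/
def stage : ℕ → L →ₗ[F] (Multiset I →₀ F) →ₗ[F] (Multiset I →₀ F)
  | 0 => b.constr F fun i => Finsupp.linearCombination F fun m => single (i ::ₘ m) 1
  | n + 1 => b.constr F fun i => Finsupp.linearCombination F fun m =>
      -- With `m = j m'` and `j` minimal, this is the forced value `x_j (x_i m') + [x_i, x_j] m'`.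
      -- The leading part `i m'` of `x_i m'` is split off and `x_j (i m') = i j m'` inserted by
      -- hand, since `i m'` may have degree `n + 1`, where stage `n` is not yet correct.
      if h : ∃ j ∈ m, j < i ∧ ∀ k ∈ m, j ≤ k then
        single (i ::ₘ m) 1
          + stage n (b h.choose) (stage n (b i) (single (m.erase h.choose) 1)
            - single (i ::ₘ m.erase h.choose) 1)
          + stage n ⁅b i, b h.choose⁆ (single (m.erase h.choose) 1)
      else single (i ::ₘ m) 1

theorem stage_le (n : ℕ) {i : I} {m : Multiset I} (h : ∀ k ∈ m, i ≤ k) :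
    stage b n (b i) (single m 1) = single (i ::ₘ m) 1 := by
  cases n with
  | zero => simp [stage]
  | succ n =>
    have h' : ¬ ∃ j ∈ m, j < i ∧ ∀ k ∈ m, j ≤ k :=
      fun ⟨j, hj, hji, _⟩ => absurd (h j hj) (not_le.2 hji)
    simp only [stage, Module.Basis.constr_basis, Finsupp.linearCombination_single, one_smul]
    rw [dif_neg h']

theorem stage_lt (n : ℕ) {i j : I} {m : Multiset I} (hji : j < i) (h : ∀ k ∈ m, j ≤ k) :
    stage b (n + 1) (b i) (single (j ::ₘ m) 1) = single (i ::ₘ j ::ₘ m) 1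
      + stage b n (b j) (stage b n (b i) (single m 1) - single (i ::ₘ m) 1)
      + stage b n ⁅b i, b j⁆ (single m 1) := by
  have h' : ∃ j' ∈ j ::ₘ m, j' < i ∧ ∀ k ∈ j ::ₘ m, j' ≤ k :=
    ⟨j, by simp, hji, by simpa using h⟩
  have hc : h'.choose = j := by
    obtain ⟨h1, _, h3⟩ := h'.choose_spec
    refine le_antisymm (h3 j (by simp)) ?_
    rcases Multiset.mem_cons.1 h1 with h1 | h1
    · exact h1.ge
    · exact h _ h1
  simp only [stage, Module.Basis.constr_basis, Finsupp.linearCombination_single, one_smul]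
  rw [dif_pos h', hc, Multiset.erase_cons_head]

theorem le_or_exists_cons (i : I) (m : Multiset I) :
    (∀ k ∈ m, i ≤ k) ∨ ∃ j m', m = j ::ₘ m' ∧ j < i ∧ ∀ k ∈ m', j ≤ k := by
  by_cases h : ∀ k ∈ m, i ≤ k
  · exact Or.inl h
  · push Not at h
    obtain ⟨k, hk, hki⟩ := h
    have hne : m.toFinset.Nonempty := ⟨k, by simpa using hk⟩
    have hmem : m.toFinset.min' hne ∈ m := by simpa using m.toFinset.min'_mem hne
    refine Or.inr ⟨m.toFinset.min' hne, m.erase (m.toFinset.min' hne),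
      (Multiset.cons_erase hmem).symm, lt_of_le_of_lt (Finset.min'_le _ _ (by simpa using hk)) hki,
      fun l hl => Finset.min'_le _ _ ?_⟩
    simpa using Multiset.mem_of_mem_erase hl

/-- Leading term, stability and degree bound have to be proved together: the recursive terms of
stage `n + 1` apply stage `n` twice, and the bounds at stage `n` are what keeps those arguments in
the range where stage `n` is stable. -/
theorem stage_spec (n : ℕ) : (∀ m : Multiset I, Multiset.card m ≤ n → ∀ i,
      stage b n (b i) (single m 1) - single (i ::ₘ m) 1 ∈ low F I (Multiset.card m + 1)) ∧
    (∀ v ∈ low F I (n + 1), ∀ x, stage b (n + 1) x v = stage b n x v) ∧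
    (∀ k ≤ n + 1, ∀ v ∈ low F I k, ∀ x, stage b n x v ∈ low F I (k + 1)) := by
  have key : ∀ n, (∀ m : Multiset I, Multiset.card m ≤ n → ∀ i,
      stage b n (b i) (single m 1) - single (i ::ₘ m) 1 ∈ low F I (Multiset.card m + 1)) →
      (∀ k ≤ n + 1, ∀ v ∈ low F I k, ∀ x, stage b n x v ∈ low F I (k + 1)) := by
    intro n hn k hk v hv x
    refine low_induction (P := fun v => stage b n x v ∈ low F I (k + 1)) ?_ (by simp)
      (fun u v hu hv => by rw [map_add]; exact add_mem hu hv)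
      (fun a v hv => by rw [map_smul]; exact Submodule.smul_mem _ _ hv) hv
    intro m hm
    refine basis_induction b (P := fun x => stage b n x (single m 1) ∈ low F I (k + 1)) ?_
      (by simp) (fun u v hu hv => by rw [map_add, LinearMap.add_apply]; exact add_mem hu hv)
      (fun a v hv => by rw [map_smul, LinearMap.smul_apply]; exact Submodule.smul_mem _ _ hv) x
    intro i
    have h := hn m (by omega) i
    rw [← sub_add_cancel (stage b n (b i) (single m 1)) (single (i ::ₘ m) 1)]
    exact add_mem (low_mono (by omega) h) (single_mem_low (by simp; omega) _)
  have key2 : ∀ n, (∀ m : Multiset I, Multiset.card m ≤ n → ∀ i,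
      stage b (n + 1) (b i) (single m 1) = stage b n (b i) (single m 1)) →
      (∀ v ∈ low F I (n + 1), ∀ x, stage b (n + 1) x v = stage b n x v) := by
    intro n hn v hv x
    refine low_induction (P := fun v => stage b (n + 1) x v = stage b n x v) ?_ (by simp)
      (fun u v hu hv => by rw [map_add, map_add, hu, hv])
      (fun a v hv => by rw [map_smul, map_smul, hv]) hv
    intro m hm
    refine basis_induction b
      (P := fun x => stage b (n + 1) x (single m 1) = stage b n x (single m 1)) ?_
      (by simp) (fun u v hu hv => by simp only [map_add, LinearMap.add_apply, hu, hv])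
      (fun a v hv => by simp only [map_smul, LinearMap.smul_apply, hv]) x
    exact fun i => hn m (by omega) i
  induction n with
  | zero =>
    have h1 : ∀ m : Multiset I, Multiset.card m ≤ 0 → ∀ i,
        stage b 0 (b i) (single m 1) - single (i ::ₘ m) 1 ∈ low F I (Multiset.card m + 1) := by
      intro m _ i
      simp [stage]
    refine ⟨h1, key2 0 ?_, key 0 h1⟩
    intro m hm i
    have : m = 0 := by simpa using hm
    subst this
    rw [stage_le b 1 (by simp), stage_le b 0 (by simp)]
  | succ n ih =>
    obtain ⟨ih1, ih2, ih3⟩ := ih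
    have h1 : ∀ m : Multiset I, Multiset.card m ≤ n + 1 → ∀ i,
        stage b (n + 1) (b i) (single m 1) - single (i ::ₘ m) 1
          ∈ low F I (Multiset.card m + 1) := by
      intro m hm i
      rcases le_or_exists_cons i m with h | ⟨j, m', rfl, hji, h⟩
      · simp [stage_le b _ h]
      · rw [stage_lt b n hji h, add_assoc, add_sub_cancel_left]
        rw [Multiset.card_cons] at hm ⊢
        refine add_mem (ih3 _ (by omega) _ (ih1 m' (by omega) i) _)
          (ih3 _ (by omega) _ (single_mem_low (by omega) _) _)
    refine ⟨h1, key2 _ ?_, key _ h1⟩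
    intro m hm i
    rcases le_or_exists_cons i m with h | ⟨j, m', rfl, hji, h⟩
    · rw [stage_le b _ h, stage_le b _ h]
    · rw [Multiset.card_cons] at hm
      have hm' : single m' (1 : F) ∈ low F I (n + 1) := single_mem_low (by omega) _
      rw [stage_lt b _ hji h, stage_lt b _ hji h, ih2 _ hm', ih2 _ hm',
        ih2 _ (low_mono (by omega) (ih1 m' (by omega) i))]

theorem stage_eq_of_le {k n : ℕ} (h : k ≤ n) {v : Multiset I →₀ F} (hv : v ∈ low F I (k + 1))
    (x : L) : stage b n x v = stage b k x v := by
  induction n, h using Nat.le_induction with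
  | base => rfl
  | succ n hn ih => rw [(stage_spec b n).2.1 v (low_mono (by omega) hv), ih]

/-- The action of `L` on the polynomials in an ordered basis. -/
def act : L →ₗ[F] (Multiset I →₀ F) →ₗ[F] (Multiset I →₀ F) :=
  b.constr F fun i => Finsupp.linearCombination F fun m =>
    stage b (Multiset.card m) (b i) (single m 1)

theorem act_eq_stage {n : ℕ} {v : Multiset I →₀ F} (hv : v ∈ low F I (n + 1)) (x : L) :
    act b x v = stage b n x v := by
  refine low_induction (P := fun v => act b x v = stage b n x v) ?_ (by simp)
    (fun u v hu hv => by rw [map_add, map_add, hu, hv])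
    (fun a v hv => by rw [map_smul, map_smul, hv]) hv
  intro m hm
  refine basis_induction b
    (P := fun x => act b x (single m 1) = stage b n x (single m 1)) ?_
    (by simp) (fun u v hu hv => by simp only [map_add, LinearMap.add_apply, hu, hv])
    (fun a v hv => by simp only [map_smul, LinearMap.smul_apply, hv]) x
  intro i
  simp only [act, Module.Basis.constr_basis, Finsupp.linearCombination_single, one_smul]
  exact (stage_eq_of_le b (by omega) (single_mem_low (by omega) _) _).symm

theorem act_le {i : I} {m : Multiset I} (h : ∀ k ∈ m, i ≤ k) :
    act b (b i) (single m 1) = single (i ::ₘ m) 1 := by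
  rw [act_eq_stage b (single_mem_low (Nat.lt_succ_self _) _), stage_le b _ h]

theorem act_sub_mem_low (i : I) (m : Multiset I) :
    act b (b i) (single m 1) - single (i ::ₘ m) 1 ∈ low F I (Multiset.card m + 1) := by
  rw [act_eq_stage b (single_mem_low (Nat.lt_succ_self _) _)]
  exact (stage_spec b _).1 m le_rfl i

theorem act_mem_low {k : ℕ} {v : Multiset I →₀ F} (hv : v ∈ low F I k) (x : L) :
    act b x v ∈ low F I (k + 1) := by
  rw [act_eq_stage b (low_mono (Nat.le_succ k) hv)]
  exact (stage_spec b _).2.2 k (by omega) v hv x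

/-- The action is valid in all degrees, so the split-off leading term recombines with the rest of
`x_i m`. -/
theorem act_lt {i j : I} {m : Multiset I} (hji : j < i) (h : ∀ k ∈ m, j ≤ k) :
    act b (b i) (single (j ::ₘ m) 1) =
      act b (b j) (act b (b i) (single m 1)) + act b ⁅b i, b j⁆ (single m 1) := by
  have hm : single m (1 : F) ∈ low F I (Multiset.card m + 1) :=
    single_mem_low (Nat.lt_succ_self _) _
  have hs := act_sub_mem_low b i m
  have hj : ∀ k ∈ i ::ₘ m, j ≤ k := by
    intro k hk
    rcases Multiset.mem_cons.1 hk with rfl | hk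
    · exact hji.le
    · exact h k hk
  rw [act_eq_stage b (n := Multiset.card m + 1) (single_mem_low (by simp) _),
    stage_lt b _ hji h, ← act_eq_stage b hm, ← act_eq_stage b hm, ← act_eq_stage b hs, map_sub,
    act_le b hj, Multiset.cons_swap]
  abel

/-- Strong induction on the degree. For basis elements `x_i, x_k` with `k < i`, the relation on `m`
is the definition when `k ≤ m`. Otherwise `m = j m'` with `j < k < i`; pulling `x_j` to the front
leaves relations on `m'`, and these add up by the Jacobi identity. -/
theorem act_lie_single (n : ℕ) : ∀ m : Multiset I, Multiset.card m ≤ n → ∀ x y : L,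
    act b x (act b y (single m 1)) - act b y (act b x (single m 1)) =
      act b ⁅x, y⁆ (single m 1) := by
  induction n using Nat.strong_induction_on with
  | _ n ih =>
  have ih' : ∀ (k : ℕ) (v : Multiset I →₀ F), k ≤ n → v ∈ low F I k → ∀ x y : L,
      act b x (act b y v) - act b y (act b x v) = act b ⁅x, y⁆ v := by
    intro k v hk hv x y
    refine low_induction
      (P := fun v => act b x (act b y v) - act b y (act b x v) = act b ⁅x, y⁆ v) ?_ (by simp)
      (fun u v hu hv => by simp only [map_add, ← hu, ← hv]; abel)
      (fun a v hv => by simp only [map_smul, ← hv, smul_sub]) hv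
    intro m hm
    exact ih (Multiset.card m) (by omega) m le_rfl x y
  have main : ∀ m : Multiset I, Multiset.card m ≤ n → ∀ i k : I, k < i →
      act b (b i) (act b (b k) (single m 1)) - act b (b k) (act b (b i) (single m 1)) =
      act b ⁅b i, b k⁆ (single m 1) := by
    intro m hm i k hki
    rcases le_or_exists_cons k m with h | ⟨j, m', rfl, hjk, h⟩
    · rw [act_le b h, act_lt b hki h, add_sub_cancel_left]
    · rw [Multiset.card_cons] at hm
      have hm' : single m' (1 : F) ∈ low F I (Multiset.card m' + 1) :=
        single_mem_low (Nat.lt_succ_self _) _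
      -- `x_k m'` is `k m'` plus terms of degree at most that of `m'`. The first is handled by the
      -- definition, as `j` is still minimal there, the others by induction.
      have swap : ∀ i k : I, j < i → j < k →
          act b (b i) (act b (b j) (act b (b k) (single m' 1))) =
          act b (b j) (act b (b i) (act b (b k) (single m' 1))) +
            act b ⁅b i, b j⁆ (act b (b k) (single m' 1)) := by
        intro i k hji hjk
        have hjm : ∀ l ∈ k ::ₘ m', j ≤ l := by
          intro l hl
          rcases Multiset.mem_cons.1 hl with rfl | hl
          · exact hjk.le
          · exact h l hl
        have e1 : act b (b i) (act b (b j) (single (k ::ₘ m') 1)) =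
            act b (b j) (act b (b i) (single (k ::ₘ m') 1)) +
              act b ⁅b i, b j⁆ (single (k ::ₘ m') 1) := by
          rw [act_le b hjm, act_lt b hji hjm]
        have e2 := ih' _ _ (by omega) (act_sub_mem_low b k m') (b i) (b j)
        simp only [map_sub] at e2
        rw [e1] at e2
        rw [sub_eq_iff_eq_add] at e2
        have e3 := sub_eq_iff_eq_add.1 e2
        rw [e3]
        abel
      have hji := hjk.trans hki
      have hmin : act b (b j) (single m' 1) = single (j ::ₘ m') 1 := act_le b h
      have lie2 := fun x y : L => ih' _ _ (by omega) hm' x y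
      have f1 := congrArg (act b (b j)) (lie2 (b i) (b k))
      rw [map_sub] at f1
      have f2 := lie2 ⁅b i, b j⁆ (b k)
      have f3 := lie2 (b i) ⁅b k, b j⁆
      have f4 := lie2 ⁅b i, b k⁆ (b j)
      rw [hmin] at f4
      have jac : ⁅⁅b i, b j⁆, b k⁆ + ⁅b i, ⁅b k, b j⁆⁆ = ⁅⁅b i, b k⁆, b j⁆ := by
        rw [leibniz_lie (b i) (b k) (b j), ← lie_skew (b k) ⁅b i, b j⁆]
        abel
      have f5 := congrArg (fun z => act b z (single m' 1)) jac
      simp only [map_add, LinearMap.add_apply] at f5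
      rw [act_lt b hjk h, act_lt b hji h, map_add, map_add, swap i k hji hjk, swap k i hjk hji]
      linear_combination (norm := module) f1 + f2 + f3 - f4 + f5
  intro m hm x y
  refine basis_induction b (P := fun x => act b x (act b y (single m 1)) -
    act b y (act b x (single m 1)) = act b ⁅x, y⁆ (single m 1)) ?_ (by simp)
    (fun u v hu hv => by
      simp only [map_add, LinearMap.add_apply, add_lie, ← hu, ← hv]; abel)
    (fun a v hv => by
      simp only [map_smul, LinearMap.smul_apply, smul_lie, ← hv, smul_sub]) x
  intro i
  refine basis_induction b (P := fun y => act b (b i) (act b y (single m 1)) -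
    act b y (act b (b i) (single m 1)) = act b ⁅b i, y⁆ (single m 1)) ?_ (by simp)
    (fun u v hu hv => by
      simp only [map_add, LinearMap.add_apply, lie_add, ← hu, ← hv]; abel)
    (fun a v hv => by
      simp only [map_smul, LinearMap.smul_apply, lie_smul, ← hv, smul_sub]) y
  intro k
  rcases lt_trichotomy k i with h | rfl | h
  · exact main m hm i k h
  · simp
  · rw [← lie_skew, map_neg, LinearMap.neg_apply, ← main m hm k i h, neg_sub]

theorem act_lie (x y : L) (v : Multiset I →₀ F) :
    act b ⁅x, y⁆ v = act b x (act b y v) - act b y (act b x v) := by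
  obtain ⟨k, hk⟩ := exists_mem_low v
  refine low_induction
    (P := fun v => act b ⁅x, y⁆ v = act b x (act b y v) - act b y (act b x v)) ?_ (by simp)
    (fun u v hu hv => by simp only [map_add, hu, hv]; abel)
    (fun a v hv => by simp only [map_smul, hv, smul_sub]) hk
  intro m _
  exact (act_lie_single b _ m le_rfl x y).symm

end Action

end PBW

end

noncomputable section

open Finsupp

/-! ### Jacobson's formula for the `p`-th power of a sum -/

section Jacobson

/-- Pascal's rule: consecutive entries of row `p - 1` add up to an entry of row `p`, which is
divisible by `p`. -/
theorem cast_choose_prime_sub_one (R : Type*) [Ring R] (p : ℕ) [hp : Fact p.Prime] [CharP R p]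
    (k : ℕ) (hk : k < p) : ((p - 1).choose k : R) = (-1) ^ k := by
  induction k with
  | zero => simp
  | succ k ih =>
    have h1 : ((p - 1).choose k : R) + ((p - 1).choose (k + 1) : R) = 0 := by
      rw [← Nat.cast_add, ← Nat.choose_succ_succ', Nat.sub_add_cancel hp.out.one_le,
        CharP.cast_eq_zero_iff R p]
      exact hp.out.dvd_choose_self (by omega) hk
    rw [ih (by omega)] at h1
    rw [pow_succ, mul_neg_one]
    exact (neg_eq_of_add_eq_zero_right h1).symm

theorem Commute.sub_pow_prime_sub_one {R : Type*} [Ring R] (p : ℕ) [hp : Fact p.Prime] [CharP R p]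
    {a c : R} (h : Commute a c) :
    (a - c) ^ (p - 1) = ∑ k ∈ Finset.range p, a ^ k * c ^ (p - 1 - k) := by
  rw [sub_eq_add_neg, h.neg_right.add_pow, Nat.sub_add_cancel hp.out.one_le]
  refine Finset.sum_congr rfl fun k hk => ?_
  have hk := Finset.mem_range.1 hk
  rw [Nat.choose_symm_of_eq_add (by omega : p - 1 = k + (p - 1 - k)),
    cast_choose_prime_sub_one R p _ (by omega), neg_pow, mul_assoc, mul_assoc]
  rw [← ((Commute.neg_one_left (c ^ (p - 1 - k))).pow_left (p - 1 - k)).eq,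
    ← mul_assoc ((-1) ^ (p - 1 - k)), ← mul_pow, neg_one_mul, neg_neg, one_pow, one_mul]
  exact Commute.refl _

open Polynomial in
theorem Polynomial.derivative_pow_eq_sum {R : Type*} [Ring R] (q : R[X]) (n : ℕ) :
    derivative (q ^ n) = ∑ k ∈ Finset.range n, q ^ k * derivative q * q ^ (n - 1 - k) := by
  induction n with
  | zero => simp
  | succ n ih =>
    rw [pow_succ, derivative_mul, ih, Finset.sum_range_succ, Finset.sum_mul]
    congr 1
    · refine Finset.sum_congr rfl fun k hk => ?_
      have hk := Finset.mem_range.1 hk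
      rw [mul_assoc _ _ q, ← pow_succ]
      congr 2
      omega
    · simp

attribute [local instance 100] LieRing.ofAssociativeRing

variable (p : ℕ) [hp : Fact p.Prime] {F A : Type*} [Field F] [CharP F p] [Ring A] [Algebra F A]

open Polynomial in
-- Translates the commutator with `x X + y` inside `A[X]` into the polynomial with coefficients in
-- `End A` that defines `jacobsonS`.
theorem coeff_ad_pow_apply (x y z : A) (n j : ℕ) :
    (((LinearMap.mulLeft F (C x * X + C y) - LinearMap.mulRight F (C x * X + C y) :
      Module.End F A[X]) ^ n) (C z)).coeff j =
    ((C (LieAlgebra.ad F A x : Module.End F A) * X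
      + C (LieAlgebra.ad F A y : Module.End F A)) ^ n).coeff j z := by
  induction n generalizing j with
  | zero =>
    rcases j with _ | j
    · simp
    · simp [Polynomial.coeff_one]
  | succ n ih =>
    rw [pow_succ', pow_succ', Module.End.mul_apply]
    generalize ((LinearMap.mulLeft F (C x * X + C y) - LinearMap.mulRight F (C x * X + C y) :
      Module.End F A[X]) ^ n) (C z) = v at ih ⊢
    have hv : v * (C x * X) = v * C x * X := (mul_assoc _ _ _).symm
    simp only [LinearMap.sub_apply, LinearMap.mulLeft_apply, LinearMap.mulRight_apply]
    rcases j with _ | j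
    · simp [add_mul, mul_add, mul_assoc, ih, LieRing.of_associative_ring_bracket]
    · simp only [add_mul, mul_add, hv, coeff_sub, coeff_add]
      simp only [mul_assoc, coeff_C_mul, coeff_X_mul, LinearMap.add_apply, Module.End.mul_apply,
        LieAlgebra.ad_apply, LieRing.of_associative_ring_bracket, coeff_mul_C]
      simp only [← mul_assoc, coeff_mul_X, coeff_mul_C, ih]
      abel

open Polynomial in
/-- Jacobson's formula in an associative algebra of characteristic `p`. -/
theorem add_pow_eq_sum_jacobsonS (x y : A) :
    (x + y) ^ p = x ^ p + y ^ p + ∑ i ∈ Finset.Icc 1 (p - 1), jacobsonS p F i x y := by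
  rcases subsingleton_or_nontrivial A with hA | hA
  · exact Subsingleton.elim _ _
  have hCA : CharP A p := charP_of_injective_algebraMap (algebraMap F A).injective p
  have hCE : CharP (Module.End F A[X]) p :=
    charP_of_injective_algebraMap (algebraMap F (Module.End F A[X])).injective p
  set q : A[X] := C x * X + C y with hq
  -- The derivative is `∑ q ^ k x q ^ (p - 1 - k)`, which in characteristic `p` equals `(ad q) ^ (p
  -- - 1) x`. Comparing coefficients gives `i` times the `i`-th coefficient of `q ^ p`; evaluation
  -- at `X = 1` then yields the formula.
  have hder : derivative (q ^ p) =
      ((LinearMap.mulLeft F q - LinearMap.mulRight F q : Module.End F A[X]) ^ (p - 1)) (C x) := by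
    rw [Commute.sub_pow_prime_sub_one p (LinearMap.commute_mulLeft_right q q),
      derivative_pow_eq_sum, LinearMap.sum_apply]
    refine Finset.sum_congr rfl fun k _ => ?_
    rw [LinearMap.pow_mulLeft, LinearMap.pow_mulRight]
    simp [hq, mul_assoc]
  have hcoef : ∀ i ∈ Finset.Icc 1 (p - 1), (q ^ p).coeff i = jacobsonS p F i x y := by
    intro i hi
    obtain ⟨h1, h2⟩ := Finset.mem_Icc.1 hi
    have h3 := congrArg (fun r => r.coeff (i - 1)) hder
    simp only [coeff_derivative] at h3
    rw [hq, coeff_ad_pow_apply, ← hq] at h3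
    have hi0 : (i : F) ≠ 0 := by
      rw [Ne, CharP.cast_eq_zero_iff F p]
      intro h
      have := Nat.le_of_dvd h1 h
      have := hp.out.two_le
      omega
    rw [jacobsonS, ← h3, Nat.sub_add_cancel h1, ← Nat.cast_add_one, Nat.sub_add_cancel h1,
      ← Nat.cast_commute, ← nsmul_eq_mul, ← Nat.cast_smul_eq_nsmul F, smul_smul,
      inv_mul_cancel₀ hi0, one_smul]
  have hdeg : (q ^ p).natDegree < p + 1 := by
    have h1 : q.natDegree ≤ 1 := natDegree_linear_le
    have := natDegree_pow_le_of_le p h1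
    omega
  let ev : A[X] →+* A := eval₂RingHom' (RingHom.id A) 1 (fun a => Commute.one_right a)
  have hev : ∀ r : A[X], ev r = r.eval 1 := fun r => rfl
  have h0 : (x + y) ^ p = (q ^ p).eval 1 := by
    rw [← hev, map_pow, hev, hq]
    simp
  rw [h0, eval_eq_sum_range' hdeg, Finset.sum_range_succ, Finset.range_eq_Ico,
    Finset.sum_eq_sum_Ico_succ_bot hp.out.pos]
  have hp1 : (q ^ p).coeff p = x ^ p := by
    have := coeff_pow_of_natDegree_le (p := q) (m := p) (n := 1) natDegree_linear_le
    rw [mul_one] at this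
    rw [this, hq]
    simp
  have hp0 : (q ^ p).coeff 0 = y ^ p := by
    have : ∀ n, (q ^ n).coeff 0 = y ^ n := by
      intro n
      induction n with
      | zero => simp
      | succ n ih => rw [pow_succ, mul_coeff_zero, ih, pow_succ, hq]; simp
    exact this p
  have hIco : Finset.Ico (0 + 1) p = Finset.Icc 1 (p - 1) := by
    ext i
    have := hp.out.pos
    simp only [Finset.mem_Ico, Finset.mem_Icc]
    omega
  rw [hp1, hp0, hIco]
  simp only [one_pow, mul_one]
  rw [Finset.sum_congr rfl hcoef]
  abel

open RestrictedLieAlgebra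

/-- A homomorphism from a restricted Lie algebra to an associative algebra is compatible with
`p`-th powers if it is so on a basis. -/
theorem map_pmap_of_basis {L I : Type*} [LieRing L] [LieAlgebra F L] [RestrictedLieAlgebra p F L]
    (b : Module.Basis I F L) (f : L →ₗ⁅F⁆ A) (h : ∀ i, f (pmap p F (b i)) = f (b i) ^ p) (x : L) :
    f (pmap p F x) = f x ^ p := by
  refine PBW.basis_induction b (P := fun x => f (pmap p F x) = f x ^ p) h ?_ ?_ ?_ x
  · have := pmap_smul (p := p) (F := F) 0 (0 : L)
    rw [zero_smul, zero_pow hp.out.ne_zero, zero_smul] at this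
    simp [this, hp.out.ne_zero]
  · intro x y hx hy
    rw [pmap_add, map_add, map_add, hx, hy, map_sum, map_add, add_pow_eq_sum_jacobsonS p (F := F)]
    simp only [map_jacobsonS]
  · intro a x hx
    rw [pmap_smul, map_smul, hx, map_smul, smul_pow]

/-- Left and right multiplication by `x` commute, so the `p`-th power of their difference is the
difference of their `p`-th powers. -/
theorem pow_prime_mul_sub_mul_pow (x y : A) :
    x ^ p * y - y * x ^ p = ((LieAlgebra.ad F A x : Module.End F A) ^ p) y := by
  rcases subsingleton_or_nontrivial A with hA | hA
  · exact Subsingleton.elim _ _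
  have hCE : CharP (Module.End F A) p :=
    charP_of_injective_algebraMap (algebraMap F (Module.End F A)).injective p
  have h1 : (LieAlgebra.ad F A x : Module.End F A) =
      LinearMap.mulLeft F x - LinearMap.mulRight F x := by
    ext z; simp [LieRing.of_associative_ring_bracket]
  rw [h1, sub_pow_char_of_commute p (LinearMap.commute_mulLeft_right x x),
    LinearMap.pow_mulLeft, LinearMap.pow_mulRight]
  simp

/-- On `f y`, both `f x ^ p` and `f (x ^ [p])` act by commutators as the `p`-th power of `ad (f x)`.
-/
theorem commute_pow_sub_map_pmap {L : Type*} [LieRing L] [LieAlgebra F L]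
    [RestrictedLieAlgebra p F L] (f : L →ₗ⁅F⁆ A) (x y : L) :
    Commute (f x ^ p - f (pmap p F x)) (f y) := by
  have h1 := pow_prime_mul_sub_mul_pow p (F := F) (f x) (f y)
  rw [← map_ad_pow, ← ad_pmap, LieAlgebra.ad_apply, LieHom.map_lie,
    LieRing.of_associative_ring_bracket] at h1
  rw [Commute, SemiconjBy, sub_mul, mul_sub]
  rw [sub_eq_sub_iff_add_eq_add] at h1 ⊢
  rw [add_comm, add_comm (f y * f x ^ p)] at *
  rw [← h1]

end Jacobson

end

noncomputable section

open Finsupp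

attribute [local instance 100] LieRing.ofAssociativeRing

/-! ### Restricted monomials modulo the central elements `x ^ p - x ^ [p]` -/

namespace PBW

/-- A multiset in which no element occurs `p` times or more. -/
def IsTruncated (p : ℕ) {I : Type*} (m : Multiset I) : Prop :=
  ∀ i, ¬ Multiset.replicate p i ≤ m

theorem isTruncated_iff_count_lt {p : ℕ} {I : Type*} [DecidableEq I] {m : Multiset I} :
    IsTruncated p m ↔ ∀ i, m.count i < p := by
  simp only [IsTruncated, ← Multiset.le_count_iff_replicate_le, not_le]

section Phi

variable {F I : Type*} [Field F] (p : ℕ)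
  (ζ : I → Module.End F (Multiset I →₀ F))

open Classical in
/-- The polynomial obtained from the monomial `m` by replacing each factor `i ^ p` by the
operator `ζ i`. -/
def phi (m : Multiset I) : Multiset I →₀ F :=
  if h : 0 < p ∧ ∃ x : I × Multiset I, m = Multiset.replicate p x.1 + x.2 then
    ζ h.2.choose.1 (phi h.2.choose.2)
  else single m 1
termination_by Multiset.card m
decreasing_by
  have h1 := congrArg Multiset.card h.2.choose_spec
  rw [Multiset.card_add, Multiset.card_replicate] at h1
  have := h.1
  omega

variable {p ζ}

theorem phi_of_isTruncated {m : Multiset I} (h : IsTruncated p m) : phi p ζ m = single m 1 := by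
  rw [phi, dif_neg]
  rintro ⟨_, x, hx⟩
  exact h x.1 (hx ▸ Multiset.le_add_right _ _)

theorem exists_eq_add_of_not_isTruncated [hp : Fact p.Prime] {m : Multiset I}
    (h : ¬ IsTruncated p m) :
    ∃ k m', m = Multiset.replicate p k + m' ∧ phi p ζ m = ζ k (phi p ζ m') := by
  have h' : ∃ x : I × Multiset I, m = Multiset.replicate p x.1 + x.2 := by
    rw [IsTruncated] at h
    push Not at h
    obtain ⟨i, hi⟩ := h
    obtain ⟨m', hm'⟩ := Multiset.le_iff_exists_add.1 hi
    exact ⟨(i, m'), hm'⟩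
  refine ⟨h'.choose.1, h'.choose.2, h'.choose_spec, ?_⟩
  rw [phi, dif_pos ⟨hp.out.pos, h'⟩]

/-- The definition of `phi` chooses which factor `k ^ p` to extract; commutativity of the operators
makes the choice irrelevant. If `k ≠ i`, both factors can be removed in either order. -/
theorem phi_replicate_add [hp : Fact p.Prime] (hcomm : ∀ i j, Commute (ζ i) (ζ j)) (n : ℕ) :
    ∀ (m : Multiset I), Multiset.card m = n → ∀ i,
      phi p ζ (Multiset.replicate p i + m) = ζ i (phi p ζ m) := by
  classical
  induction n using Nat.strong_induction_on with
  | _ n ih =>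
  intro m hm i
  have hex : ¬ IsTruncated p (Multiset.replicate p i + m) :=
    fun h => h i (Multiset.le_add_right _ _)
  obtain ⟨k, m', h1, h2⟩ := exists_eq_add_of_not_isTruncated (ζ := ζ) hex
  rw [h2]
  by_cases hki : k = i
  · subst hki
    rw [add_left_cancel h1]
  · have hk : Multiset.replicate p k ≤ m := by
      rw [← Multiset.le_count_iff_replicate_le]
      have := congrArg (Multiset.count k) h1
      rw [Multiset.count_add, Multiset.count_add, Multiset.count_replicate,
        Multiset.count_replicate, if_neg (Ne.symm hki), if_pos rfl] at this
      omega
    obtain ⟨m'', rfl⟩ := Multiset.le_iff_exists_add.1 hk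
    have h3 : m' = Multiset.replicate p i + m'' := by
      rw [add_left_comm] at h1
      exact (add_left_cancel h1).symm
    have hcard : Multiset.card m'' < n := by
      rw [← hm, Multiset.card_add, Multiset.card_replicate]
      have := hp.out.pos
      omega
    rw [h3, ih _ hcard m'' rfl i, ih _ hcard m'' rfl k]
    exact congrArg (fun g : Module.End F (Multiset I →₀ F) => g (phi p ζ m'')) (hcomm k i)

theorem zeta_mem_low
    (hlead : ∀ i m, ζ i (single m 1) - single (Multiset.replicate p i + m) 1 ∈
      low F I (Multiset.card m + p)) (i : I) {k : ℕ} {v : Multiset I →₀ F} (hv : v ∈ low F I k) :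
    ζ i v ∈ low F I (k + p) := by
  refine low_induction (P := fun v => ζ i v ∈ low F I (k + p)) ?_ (by simp)
      (fun u v hu hv => by rw [map_add]; exact add_mem hu hv)
      (fun a v hv => by rw [map_smul]; exact Submodule.smul_mem _ _ hv) hv
  intro m hm
  rw [← sub_add_cancel (ζ i (single m 1)) (single (Multiset.replicate p i + m) 1)]
  exact add_mem (low_mono (by omega) (hlead i m)) (single_mem_low (by simp; omega) _)

theorem phi_sub_mem_low [hp : Fact p.Prime]
    (hlead : ∀ i m, ζ i (single m 1) - single (Multiset.replicate p i + m) 1 ∈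
      low F I (Multiset.card m + p)) (n : ℕ) : ∀ m : Multiset I, Multiset.card m = n →
    phi p ζ m - single m 1 ∈ low F I n := by
  induction n using Nat.strong_induction_on with
  | _ n ih =>
  intro m hm
  by_cases h : IsTruncated p m
  · rw [phi_of_isTruncated h, sub_self]
    exact zero_mem _
  · obtain ⟨k, m', rfl, h2⟩ := exists_eq_add_of_not_isTruncated (ζ := ζ) h
    rw [Multiset.card_add, Multiset.card_replicate] at hm
    have := hp.out.pos
    have h3 := zeta_mem_low hlead k (ih (Multiset.card m') (by omega) m' rfl)
    have h4 := hlead k m'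
    rw [h2, ← hm, add_comm p, ← sub_add_sub_cancel _ (ζ k (single m' 1)) _, ← map_sub]
    exact add_mem h3 h4

theorem linearCombination_phi_sub_mem_low [hp : Fact p.Prime]
    (hlead : ∀ i m, ζ i (single m 1) - single (Multiset.replicate p i + m) 1 ∈
      low F I (Multiset.card m + p)) {n : ℕ} {v : Multiset I →₀ F}
    (hv : v ∈ low F I (n + 1)) :
    Finsupp.linearCombination F (phi p ζ) v - v ∈ low F I n := by
  refine low_induction (P := fun v => Finsupp.linearCombination F (phi p ζ) v - v ∈ low F I n) ?_
      (by simp) (fun u v hu hv => by rw [map_add, add_sub_add_comm]; exact add_mem hu hv)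
      (fun a v hv => by rw [map_smul, ← smul_sub]; exact Submodule.smul_mem _ _ hv) hv
  intro m hm
  rw [Finsupp.linearCombination_single, one_smul]
  exact low_mono (by omega) (phi_sub_mem_low hlead _ m rfl)

/-- The linear extension of `phi` is the identity up to terms of lower degree, hence unitriangular;
this gives injectivity and, below, surjectivity. -/
theorem linearCombination_phi_injective [hp : Fact p.Prime]
    (hlead : ∀ i m, ζ i (single m 1) - single (Multiset.replicate p i + m) 1 ∈
      low F I (Multiset.card m + p)) :
    Function.Injective (Finsupp.linearCombination F (phi p ζ)) := by
  rw [injective_iff_map_eq_zero]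
  intro v hv
  have h : ∀ n, v ∈ low F I n → v = 0 := by
    intro n
    induction n with
    | zero => simp [low_zero]
    | succ n ih =>
      intro h
      have := linearCombination_phi_sub_mem_low hlead h
      rw [hv, zero_sub, neg_mem_iff] at this
      exact ih this
  obtain ⟨n, hn⟩ := exists_mem_low v
  exact h n hn

theorem linearCombination_phi_surjective [hp : Fact p.Prime]
    (hlead : ∀ i m, ζ i (single m 1) - single (Multiset.replicate p i + m) 1 ∈
      low F I (Multiset.card m + p)) :
    Function.Surjective (Finsupp.linearCombination F (phi p ζ)) := by
  have h : ∀ n, ∀ v ∈ low F I n, ∃ u, Finsupp.linearCombination F (phi p ζ) u = v := by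
    intro n
    induction n with
    | zero =>
      intro v hv
      rw [low_zero, Submodule.mem_bot] at hv
      exact ⟨0, by simp [hv]⟩
    | succ n ih =>
      intro v hv
      obtain ⟨u, hu⟩ := ih _ (linearCombination_phi_sub_mem_low hlead hv)
      exact ⟨v - u, by rw [map_sub, hu]; abel⟩
  intro v
  obtain ⟨n, hn⟩ := exists_mem_low v
  exact h n v hn

/-- Truncated polynomials are linearly independent modulo the images of the operators `ζ i`. -/
theorem eq_zero_of_mem_supported_of_mem_iSup_range [hp : Fact p.Prime]
    (hlead : ∀ i m, ζ i (single m 1) - single (Multiset.replicate p i + m) 1 ∈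
      low F I (Multiset.card m + p))
    (hcomm : ∀ i j, Commute (ζ i) (ζ j))
    {v : Multiset I →₀ F} (hv : v ∈ Finsupp.supported F F {m | IsTruncated p m})
    (hv' : v ∈ ⨆ i, LinearMap.range (ζ i)) : v = 0 := by
  -- Every vector is `phi` of some `u`, and multiplying the monomials of `u` by `i ^ p` realises `ζ
  -- i` while making all of them non-truncated.
  have h1 : ⨆ i, LinearMap.range (ζ i) ≤
      (Finsupp.supported F F {m | ¬ IsTruncated p m}).map
        (Finsupp.linearCombination F (phi p ζ)) := by
    refine iSup_le fun i => ?_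
    rintro _ ⟨u, rfl⟩
    obtain ⟨u, rfl⟩ := linearCombination_phi_surjective hlead u
    refine ⟨Finsupp.lmapDomain F F (Multiset.replicate p i + ·) u, ?_, ?_⟩
    · refine Finsupp.supported_comap_lmapDomain F F _ _ ((Finsupp.mem_supported F u).2 ?_)
      intro m _ hm
      exact hm i (Multiset.le_add_right _ _)
    · induction u using Finsupp.induction_linear with
      | zero => simp
      | add u v hu hv => simp only [map_add, hu, hv]
      | single m a =>
        simp [Finsupp.mapDomain_single, phi_replicate_add hcomm _ m rfl]
  obtain ⟨u, hu, huv⟩ := h1 hv'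
  -- `phi` fixes truncated monomials. By injectivity `v` has both truncated and non-truncated
  -- support, so it vanishes.
  have h2 : Finsupp.linearCombination F (phi p ζ) v = v := by
    rw [Finsupp.linearCombination_apply]
    conv_rhs => rw [← Finsupp.sum_single v]
    refine Finsupp.sum_congr fun m hm => ?_
    rw [phi_of_isTruncated (hv hm)]
    simp
  have h3 : u = v := linearCombination_phi_injective hlead (huv.trans h2.symm)
  have h4 := (Finsupp.disjoint_supported_supported (M := F) (R := F)
    (disjoint_compl_right (a := {m : Multiset I | IsTruncated p m}))).le_bot ⟨hv, h3 ▸ hu⟩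
  simpa using h4

end Phi

end PBW

end

noncomputable section

open Finsupp RestrictedLieAlgebra

attribute [local instance 100] LieRing.ofAssociativeRing

/-! ### Linear independence of the ordered restricted monomials -/

namespace RestrictedEnvelopingAlgebra

/-! ### Universal property and generators of `u(L)`. -/

section Basic

variable {p : ℕ} {F L A : Type*} [Field F] [LieRing L] [LieAlgebra F L] [RestrictedLieAlgebra p F L]
  [Ring A] [Algebra F A]

/-- The universal property of `u(L)`. -/
def lift (f : L →ₗ⁅F⁆ A) (hf : ∀ x, f (pmap p F x) = f x ^ p) :
    RestrictedEnvelopingAlgebra p F L →ₐ[F] A :=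
  RingQuot.liftAlgHom F ⟨UniversalEnvelopingAlgebra.lift F f, by
    rintro _ _ ⟨x⟩
    rw [map_pow, UniversalEnvelopingAlgebra.lift_ι_apply, UniversalEnvelopingAlgebra.lift_ι_apply,
      hf]⟩

theorem lift_ι (f : L →ₗ⁅F⁆ A) (hf : ∀ x, f (pmap p F x) = f x ^ p) (x : L) :
    lift f hf (ι p F L x) = f x := by
  simp only [lift, ι, LinearMap.comp_apply, AlgHom.toLinearMap_apply,
    RingQuot.liftAlgHom_mkAlgHom_apply, LieHom.coe_toLinearMap,
    UniversalEnvelopingAlgebra.lift_ι_apply]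

theorem algHom_ext {f g : RestrictedEnvelopingAlgebra p F L →ₐ[F] A}
    (h : ∀ x, f (ι p F L x) = g (ι p F L x)) : f = g := by
  apply RingQuot.ringQuot_ext'
  apply UniversalEnvelopingAlgebra.hom_ext
  ext x
  exact h x

variable (p F L) in
/-- The natural map `L → u(L)` as a homomorphism of Lie algebras. -/
def ιLie : L →ₗ⁅F⁆ RestrictedEnvelopingAlgebra p F L :=
  { ι p F L with
    map_lie' := fun {x y} => by
      simpa [LieRing.of_associative_ring_bracket] using ι_lie p F L x y }

theorem ιLie_apply (x : L) : ιLie p F L x = ι p F L x := rfl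

/-- By the universal property `u(L)` maps to the subalgebra generated by `L`, and the composite with
the inclusion is the identity. -/
theorem adjoin_range_ι : Algebra.adjoin F (Set.range (ι p F L)) = ⊤ := by
  let S := Algebra.adjoin F (Set.range (ι p F L))
  let f : L →ₗ⁅F⁆ S :=
    { toFun := fun x => ⟨ι p F L x, Algebra.subset_adjoin ⟨x, rfl⟩⟩
      map_add' := fun x y => Subtype.ext (map_add _ x y)
      map_smul' := fun a x => Subtype.ext (map_smul _ a x)
      map_lie' := fun {x y} => Subtype.ext (by
        simp [LieRing.of_associative_ring_bracket, ι_lie]) }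
  have hf : ∀ x, f (pmap p F x) = f x ^ p := fun x => Subtype.ext (ι_pmap p F L x)
  have h : S.val.comp (lift f hf) = AlgHom.id F _ := by
    apply algHom_ext
    intro x
    rw [AlgHom.comp_apply, lift_ι]
    rfl
  rw [eq_top_iff]
  intro u _
  have := congrArg (fun g : RestrictedEnvelopingAlgebra p F L →ₐ[F] _ => g u) h
  change ((lift f hf u : S) : RestrictedEnvelopingAlgebra p F L) = u at this
  rw [← this]
  exact (lift f hf u).2

theorem induction {P : RestrictedEnvelopingAlgebra p F L → Prop}
    (hι : ∀ x, P (ι p F L x)) (halg : ∀ a, P (algebraMap F _ a))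
    (hadd : ∀ u v, P u → P v → P (u + v)) (hmul : ∀ u v, P u → P v → P (u * v))
    (u : RestrictedEnvelopingAlgebra p F L) : P u := by
  have hu : u ∈ Algebra.adjoin F (Set.range (ι p F L)) := by rw [adjoin_range_ι]; trivial
  refine Algebra.adjoin_induction ?_ halg (fun u v _ _ => hadd u v) (fun u v _ _ => hmul u v) hu
  rintro _ ⟨x, rfl⟩
  exact hι x

variable {I : Type*} (b : Module.Basis I F L)

variable (p) in
/-- The product in `u(L)` of a word in basis elements of `L`. -/
def monomial (l : List I) : RestrictedEnvelopingAlgebra p F L :=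
  (l.map fun i => ι p F L (b i)).prod

theorem monomial_nil : monomial p b [] = 1 := rfl

theorem monomial_cons (i : I) (l : List I) :
    monomial p b (i :: l) = ι p F L (b i) * monomial p b l := by
  simp [monomial]

theorem monomial_append (l l' : List I) :
    monomial p b (l ++ l') = monomial p b l * monomial p b l' := by
  simp [monomial]

variable (p) in
/-- The ordered product in `u(L)` of a multiset of basis elements of `L`. -/
def orderedMonomial [LinearOrder I] (m : Multiset I) : RestrictedEnvelopingAlgebra p F L :=
  monomial p b (m.sort (· ≤ ·))

end Basic

/-! ### A `u(L)`-module on which the truncated monomials are independent. -/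

section Independence

open PBW

variable {p : ℕ} [hp : Fact p.Prime] {F L I : Type*} [Field F] [LieRing L]
  [LieAlgebra F L] [RestrictedLieAlgebra p F L] [LinearOrder I] (b : Module.Basis I F L)

/-- The action of `L` on the polynomials in an ordered basis, as a homomorphism of Lie algebras. -/
def actLie : L →ₗ⁅F⁆ Module.End F (Multiset I →₀ F) :=
  { act b with
    map_lie' := fun {x y} => by
      ext1 v
      ext1
      simp [act_lie, LieRing.of_associative_ring_bracket] }

theorem actLie_apply (x : L) (v : Multiset I →₀ F) : actLie b x v = act b x v := rfl

variable (p) in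
/-- The central operator by which `x ^ p - x ^ [p]` acts, for a basis element `x`. -/
def centralOperator (i : I) : Module.End F (Multiset I →₀ F) :=
  actLie b (b i) ^ p - actLie b (pmap p F (b i))

theorem actLie_pow_sub_mem_low (i : I) (m : Multiset I) (n : ℕ) :
    (actLie b (b i) ^ n) (single m 1) - single (Multiset.replicate n i + m) 1 ∈
      low F I (Multiset.card m + n) := by
  induction n with
  | zero => simp
  | succ n ih =>
    have h1 := act_mem_low b ih (b i)
    have h2 := act_sub_mem_low b i (Multiset.replicate n i + m)
    rw [Multiset.card_add, Multiset.card_replicate] at h2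
    rw [pow_succ', Module.End.mul_apply, actLie_apply, Multiset.replicate_succ,
      Multiset.cons_add, ← sub_add_sub_cancel _ (act b (b i) (single (Multiset.replicate n i + m) 1)),
      ← map_sub]
    exact add_mem h1 (low_mono (by omega) h2)

/-- The term `x ^ [p]` raises the degree by at most one, less than `p`, so it does not disturb the
leading term `i ^ p m` of `x ^ p`. -/
theorem centralOperator_sub_mem_low (i : I) (m : Multiset I) :
    centralOperator p b i (single m 1) - single (Multiset.replicate p i + m) 1 ∈
      low F I (Multiset.card m + p) := by
  have h1 := actLie_pow_sub_mem_low b i m p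
  have h2 : act b (pmap p F (b i)) (single m 1) ∈ low F I (Multiset.card m + 2) :=
    act_mem_low b (single_mem_low (Nat.lt_succ_self _) _) _
  have := hp.out.two_le
  rw [centralOperator, LinearMap.sub_apply, sub_right_comm, actLie_apply]
  exact sub_mem h1 (low_mono (by omega) h2)

variable [CharP F p]

theorem commute_centralOperator (i : I) (x : L) :
    Commute (centralOperator p b i) (actLie b x) :=
  commute_pow_sub_map_pmap p (actLie b) (b i) x

theorem commute_centralOperator_centralOperator (i j : I) :
    Commute (centralOperator p b i) (centralOperator p b j) := by
  rw [centralOperator.eq_1 p b j]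
  exact Commute.sub_right (R := Module.End F (Multiset I →₀ F))
    ((commute_centralOperator b i (b j)).pow_right p) (commute_centralOperator b i _)

variable (p) in
/-- The polynomials in an ordered basis modulo the images of the central operators. -/
abbrev ReducedModule : Type _ :=
  (Multiset I →₀ F) ⧸ (⨆ i, LinearMap.range (centralOperator p b i))

/-- The images of operators commuting with `L` are stable under `L`, so the action descends to the
quotient. -/
theorem iSup_range_le_comap (x : L) : (⨆ i, LinearMap.range (centralOperator p b i)) ≤
    (⨆ i, LinearMap.range (centralOperator p b i)).comap (actLie b x) := by
  refine iSup_le fun i => ?_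
  rintro _ ⟨v, rfl⟩
  have h := congrArg (fun g : Module.End F (Multiset I →₀ F) => g v) (commute_centralOperator b i x)
  change centralOperator p b i (actLie b x v) = actLie b x (centralOperator p b i v) at h
  rw [Submodule.mem_comap, ← h]
  exact Submodule.mem_iSup_of_mem i ⟨_, rfl⟩

variable (p) in
/-- The action of `L` on the reduced module. -/
def reducedAct : L →ₗ⁅F⁆ Module.End F (ReducedModule p b) where
  toFun x := Submodule.mapQ _ _ (actLie b x) (iSup_range_le_comap b x)
  map_add' x y := by
    refine LinearMap.ext fun v => ?_
    obtain ⟨v, rfl⟩ := Submodule.Quotient.mk_surjective _ v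
    simp only [LinearMap.add_apply, Submodule.mapQ_apply, map_add, Submodule.Quotient.mk_add]
  map_smul' a x := by
    refine LinearMap.ext fun v => ?_
    obtain ⟨v, rfl⟩ := Submodule.Quotient.mk_surjective _ v
    simp only [LinearMap.smul_apply, Submodule.mapQ_apply, map_smul, Submodule.Quotient.mk_smul,
      RingHom.id_apply]
  map_lie' {x y} := by
    refine LinearMap.ext fun v => ?_
    obtain ⟨v, rfl⟩ := Submodule.Quotient.mk_surjective _ v
    simp only [LieRing.of_associative_ring_bracket, LinearMap.sub_apply, Module.End.mul_apply,
      Submodule.mapQ_apply, LieHom.map_lie, Submodule.Quotient.mk_sub]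

theorem reducedAct_mk (x : L) (v : Multiset I →₀ F) :
    reducedAct p b x (Submodule.Quotient.mk v) = Submodule.Quotient.mk (act b x v) := rfl

theorem reducedAct_pow_mk (x : L) (v : Multiset I →₀ F) (n : ℕ) :
    (reducedAct p b x ^ n) (Submodule.Quotient.mk v) =
      Submodule.Quotient.mk ((actLie b x ^ n) v) := by
  induction n with
  | zero => rfl
  | succ n ih =>
    rw [pow_succ', pow_succ', Module.End.mul_apply, Module.End.mul_apply, ih, reducedAct_mk,
      actLie_apply]

/-- For basis elements the difference has been divided out; `map_pmap_of_basis` does the rest. -/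
theorem reducedAct_pmap (x : L) : reducedAct p b (pmap p F x) = reducedAct p b x ^ p := by
  refine map_pmap_of_basis p b (reducedAct p b) (fun i => ?_) x
  refine LinearMap.ext fun v => ?_
  obtain ⟨v, rfl⟩ := Submodule.Quotient.mk_surjective _ v
  rw [reducedAct_pow_mk, reducedAct_mk, eq_comm, Submodule.Quotient.eq]
  exact Submodule.mem_iSup_of_mem i ⟨v, rfl⟩

/-- Each letter of a sorted word meets a monomial with no smaller letter, so it acts by plain
multiplication. -/
theorem lift_monomial_apply (l : List I) (hl : l.Pairwise (· ≤ ·)) :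
    lift (reducedAct p b) (reducedAct_pmap b) (monomial p b l)
      (Submodule.Quotient.mk (single 0 1)) = Submodule.Quotient.mk (single (l : Multiset I) 1) := by
  induction l with
  | nil => simp [monomial_nil]
  | cons i l ih =>
    rw [List.pairwise_cons] at hl
    rw [monomial_cons, map_mul, Module.End.mul_apply, ih hl.2, lift_ι, reducedAct_mk,
      act_le b (by simpa using hl.1)]
    rfl

/-- The ordered restricted monomials in a basis of `L` are linearly independent in `u(L)`. -/
theorem linearIndependent_orderedMonomial :
    LinearIndependent F (fun m : {m : Multiset I // IsTruncated p m} =>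
      orderedMonomial p b (m : Multiset I)) := by
  let g : RestrictedEnvelopingAlgebra p F L →ₗ[F] ReducedModule p b :=
    (LinearMap.applyₗ (Submodule.Quotient.mk (single 0 1) : ReducedModule p b)) ∘ₗ
      (lift (reducedAct p b) (reducedAct_pmap b)).toLinearMap
  refine LinearIndependent.of_comp g ?_
  have h1 : (g ∘ fun m : {m : Multiset I // IsTruncated p m} =>
      orderedMonomial p b (m : Multiset I)) =
      (⨆ i, LinearMap.range (centralOperator p b i)).mkQ ∘
        fun m : {m : Multiset I // IsTruncated p m} => single (m : Multiset I) (1 : F) := by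
    funext m
    have h2 := lift_monomial_apply (p := p) b ((m : Multiset I).sort (· ≤ ·))
      (Multiset.pairwise_sort _ _)
    rw [Multiset.sort_eq] at h2
    exact h2
  rw [h1]
  refine LinearIndependent.map ?_ ?_
  · exact (Finsupp.linearIndependent_single_one F (Multiset I)).comp
      (fun m : {m : Multiset I // IsTruncated p m} => (m : Multiset I)) Subtype.val_injective
  · rw [Submodule.ker_mkQ, Submodule.disjoint_def]
    intro v hv hv'
    refine eq_zero_of_mem_supported_of_mem_iSup_range (centralOperator_sub_mem_low b)
      (commute_centralOperator_centralOperator b) ?_ hv'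
    refine Submodule.span_le.2 ?_ hv
    rintro _ ⟨m, rfl⟩
    exact Finsupp.single_mem_supported F _ m.2

end Independence

end RestrictedEnvelopingAlgebra

end

noncomputable section

open Finsupp RestrictedLieAlgebra

attribute [local instance 100] LieRing.ofAssociativeRing

/-! ### Straightening of words and the Poincaré-Birkhoff-Witt basis -/

namespace RestrictedEnvelopingAlgebra

open PBW

section Straightening

variable {p : ℕ} {F L I : Type*} [Field F] [LieRing L]
  [LieAlgebra F L] [RestrictedLieAlgebra p F L] (b : Module.Basis I F L) (w : I → ℕ) (N : ℕ)

variable (p) in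
/-- The span of the words of length less than `r` whose weight is at least `min k N`. -/
def wordSpan (r k : ℕ) : Submodule F (RestrictedEnvelopingAlgebra p F L) :=
  Submodule.span F {u | ∃ l : List I, l.length < r ∧ min k N ≤ (l.map w).sum ∧ monomial p b l = u}

theorem monomial_mem_wordSpan {r k : ℕ} {l : List I} (h1 : l.length < r)
    (h2 : min k N ≤ (l.map w).sum) : monomial p b l ∈ wordSpan p b w N r k :=
  Submodule.subset_span ⟨l, h1, h2, rfl⟩

theorem wordSpan_mono {r r' k k' : ℕ} (hr : r ≤ r') (hk : min k' N ≤ k) :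
    wordSpan p b w N r k ≤ wordSpan p b w N r' k' := by
  refine Submodule.span_mono ?_
  rintro _ ⟨l, h1, h2, rfl⟩
  exact ⟨l, h1.trans_le hr, by omega, rfl⟩

theorem ι_mul_mem_wordSpan {x : L} {c r k : ℕ} (hx : ∀ i, b.repr x i ≠ 0 → c ≤ w i)
    {u : RestrictedEnvelopingAlgebra p F L} (hu : u ∈ wordSpan p b w N r k) :
    ι p F L x * u ∈ wordSpan p b w N (r + 1) (min k N + c) := by
  refine Submodule.span_induction (p := fun u _ =>
    ι p F L x * u ∈ wordSpan p b w N (r + 1) (min k N + c)) ?_ (by simp)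
    (fun u v _ _ hu hv => by rw [mul_add]; exact add_mem hu hv)
    (fun a u _ hu => by rw [mul_smul_comm]; exact Submodule.smul_mem _ _ hu) hu
  rintro _ ⟨l, h1, h2, rfl⟩
  conv =>
    enter [2]
    rw [← b.linearCombination_repr x, Finsupp.linearCombination_apply, Finsupp.sum, map_sum,
      Finset.sum_mul]
  refine Submodule.sum_mem _ fun i hi => ?_
  rw [map_smul, smul_mul_assoc, ← monomial_cons]
  refine Submodule.smul_mem _ _ (monomial_mem_wordSpan b w N (by simpa using h1) ?_)
  have := hx i (Finsupp.mem_support_iff.1 hi)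
  rw [List.map_cons, List.sum_cons]
  omega

/-- Exchanging two neighbours costs a bracket: one letter fewer, and weight not lowered below the
cutoff `N`. -/
theorem monomial_sub_monomial_mem_wordSpan
    (hlie : ∀ i j k, b.repr ⁅b i, b j⁆ k ≠ 0 → min (w i + w j) N ≤ w k)
    {l l' : List I} (h : l.Perm l') :
    monomial p b l - monomial p b l' ∈ wordSpan p b w N l.length (l.map w).sum := by
  induction h with
  | nil => simp
  | cons i h ih =>
    rw [monomial_cons, monomial_cons, ← mul_sub]
    refine wordSpan_mono b w N (by simp) ?_ (ι_mul_mem_wordSpan b w N (c := w i) ?_ ih)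
    · rw [List.map_cons, List.sum_cons]
      omega
    · intro k hk
      rw [b.repr_self] at hk
      rw [(Finsupp.single_apply_ne_zero.1 hk).1]
  | swap i j l =>
    have h1 := ι_mul_mem_wordSpan b w N (hlie j i)
      (monomial_mem_wordSpan (p := p) b w N (Nat.lt_succ_self l.length) (min_le_left (l.map w).sum N))
    rw [ι_lie, sub_mul, mul_assoc, mul_assoc, ← monomial_cons, ← monomial_cons, ← monomial_cons,
      ← monomial_cons] at h1
    refine wordSpan_mono b w N (by simp) ?_ h1
    simp only [List.map_cons, List.sum_cons]
    omega
  | trans h1 h2 ih1 ih2 =>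
    rw [← sub_add_sub_cancel]
    refine add_mem ih1 ?_
    rw [h1.length_eq, (h1.map w).sum_eq]
    exact ih2

variable [LinearOrder I]

variable (p) in
/-- The span of the ordered restricted monomials of weight at least `min k N`. -/
def weightSpan (k : ℕ) : Submodule F (RestrictedEnvelopingAlgebra p F L) :=
  Submodule.span F {u | ∃ m : Multiset I, IsTruncated p m ∧ min k N ≤ (m.map w).sum ∧
    orderedMonomial p b m = u}

/-- Induction on length. Modulo shorter words of no smaller weight a word may be permuted: if
truncated, it is sorted; if not, `p` equal letters are brought together. -/
theorem wordSpan_le_weightSpan [hp : Fact p.Prime]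
    (hlie : ∀ i j k, b.repr ⁅b i, b j⁆ k ≠ 0 → min (w i + w j) N ≤ w k)
    (hpow : ∀ i k, b.repr (pmap p F (b i)) k ≠ 0 → min (p * w i) N ≤ w k) (r k : ℕ) :
    wordSpan p b w N r k ≤ weightSpan p b w N k := by
  induction r generalizing k with
  | zero =>
    refine Submodule.span_le.2 ?_
    rintro _ ⟨l, h1, h2, rfl⟩
    omega
  | succ r ih =>
    have perm : ∀ l l' : List I, l.Perm l' → l.length < r + 1 → min k N ≤ (l.map w).sum →
        monomial p b l' ∈ weightSpan p b w N k → monomial p b l ∈ weightSpan p b w N k := by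
      intro l l' h h1 h2 h3
      rw [← sub_add_cancel (monomial p b l) (monomial p b l')]
      refine add_mem (ih k ?_) h3
      exact wordSpan_mono b w N (by omega) h2 (monomial_sub_monomial_mem_wordSpan b w N hlie h)
    refine Submodule.span_le.2 ?_
    rintro _ ⟨l, h1, h2, rfl⟩
    by_cases ht : IsTruncated p (l : Multiset I)
    · refine perm l ((l : Multiset I).sort (· ≤ ·)) ?_ h1 h2 ?_
      · rw [← Multiset.coe_eq_coe, Multiset.sort_eq]
      · exact Submodule.subset_span ⟨_, ht, by simpa using h2, rfl⟩
    · rw [IsTruncated] at ht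
      push Not at ht
      obtain ⟨i, hi⟩ := ht
      obtain ⟨m, hm⟩ := Multiset.le_iff_exists_add.1 hi
      obtain ⟨t, rfl⟩ := Quot.exists_rep m
      have hl : l.Perm (List.replicate p i ++ t) := by
        rw [← Multiset.coe_eq_coe, hm, ← Multiset.coe_add, Multiset.coe_replicate]
        rfl
      -- The block of `p` equal letters is replaced by `x ^ [p]`, a combination of single letters,
      -- so the length drops by `p - 1 ≥ 1`.
      refine perm l _ hl h1 h2 (ih k ?_)
      have hlen := hl.length_eq
      have hsum := (hl.map w).sum_eq
      simp only [List.length_append, List.length_replicate, List.map_append, List.map_replicate,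
        List.sum_append, List.sum_replicate, smul_eq_mul] at hlen hsum
      have h3 : monomial p b (List.replicate p i ++ t) =
          ι p F L (pmap p F (b i)) * monomial p b t := by
        rw [monomial_append, ι_pmap]
        simp [monomial]
      have h4 := ι_mul_mem_wordSpan b w N (hpow i)
        (monomial_mem_wordSpan (p := p) b w N (Nat.lt_succ_self t.length)
          (min_le_left (t.map w).sum N))
      rw [h3]
      have := hp.out.two_le
      exact wordSpan_mono b w N (by omega) (by omega) h4

end Straightening

theorem isTruncated_singleton (p : ℕ) [hp : Fact p.Prime] {I : Type*} (i : I) : IsTruncated p ({i} : Multiset I) := by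
  intro j h
  have := Multiset.card_le_card h
  have := hp.out.two_le
  simp at *
  omega

/-! ### The PBW basis and its coordinates. -/

section Basis

section Span

variable (p : ℕ) {F L I : Type*} [Field F] [LieRing L] [LieAlgebra F L]
  [RestrictedLieAlgebra p F L] (b : Module.Basis I F L)

theorem mem_span_range_monomial (u : RestrictedEnvelopingAlgebra p F L) :
    u ∈ Submodule.span F (Set.range (monomial p b)) := by
  have h1 : ∀ i, ι p F L (b i) ∈ Submodule.span F (Set.range (monomial p b)) := fun i =>
    Submodule.subset_span ⟨[i], by simp [monomial]⟩
  have h0 : (1 : RestrictedEnvelopingAlgebra p F L) ∈ Submodule.span F (Set.range (monomial p b)) :=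
    Submodule.subset_span ⟨[], rfl⟩
  refine induction (P := fun u => u ∈ Submodule.span F (Set.range (monomial p b))) ?_ ?_ ?_ ?_ u
  · intro x
    refine PBW.basis_induction b
      (P := fun x => ι p F L x ∈ Submodule.span F (Set.range (monomial p b))) h1 (by simp) ?_ ?_ x
    · intro x y hx hy
      rw [map_add]
      exact add_mem hx hy
    · intro a x hx
      rw [map_smul]
      exact Submodule.smul_mem _ _ hx
  · intro a
    rw [Algebra.algebraMap_eq_smul_one]
    exact Submodule.smul_mem _ _ h0
  · exact fun u v hu hv => add_mem hu hv
  · intro u v hu hv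
    have := Submodule.mul_mem_mul hu hv
    rw [Submodule.span_mul_span] at this
    refine Submodule.span_mono ?_ this
    rintro _ ⟨_, ⟨l, rfl⟩, _, ⟨l', rfl⟩, rfl⟩
    exact ⟨l ++ l', monomial_append b l l'⟩

end Span

variable (p : ℕ) [hp : Fact p.Prime] {F L I : Type*} [Field F] [CharP F p] [LieRing L]
  [LieAlgebra F L] [RestrictedLieAlgebra p F L] [LinearOrder I] (b : Module.Basis I F L)

/-- The Poincaré-Birkhoff-Witt basis of `u(L)`. -/
def pbwBasis : Module.Basis {m : Multiset I // IsTruncated p m} F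
    (RestrictedEnvelopingAlgebra p F L) :=
  Module.Basis.mk (linearIndependent_orderedMonomial b) (by
    intro u _
    have h := mem_span_range_monomial p b u
    -- With cutoff `N = 0` all weight conditions are void, and straightening is just the spanning
    -- statement.
    have h1 : Submodule.span F (Set.range (monomial p b)) ≤ weightSpan p b (fun _ => 0) 0 0 := by
      refine Submodule.span_le.2 ?_
      rintro _ ⟨l, rfl⟩
      exact wordSpan_le_weightSpan b (fun _ => 0) 0 (by simp) (by simp) (l.length + 1) 0
        (monomial_mem_wordSpan b _ _ (Nat.lt_succ_self _) (by simp))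
    refine Submodule.span_mono ?_ (h1 h)
    rintro _ ⟨m, hm, _, rfl⟩
    exact ⟨⟨m, hm⟩, rfl⟩)

theorem pbwBasis_apply (m : {m : Multiset I // IsTruncated p m}) :
    pbwBasis p b m = orderedMonomial p b (m : Multiset I) := by
  simp [pbwBasis]

/-- This lets coordinates of `x ∈ L` be read off inside `u(L)`; injectivity of `ι` and the detection
of filtration steps both rest on it. -/
theorem pbwBasis_repr_ι (x : L) (i : I) :
    (pbwBasis p b).repr (ι p F L x) ⟨{i}, isTruncated_singleton p i⟩ = b.repr x i := by
  refine PBW.basis_induction b (P := fun x =>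
    (pbwBasis p b).repr (ι p F L x) ⟨{i}, isTruncated_singleton p i⟩ = b.repr x i) ?_ (by simp)
    (fun u v hu hv => by simp [hu, hv]) (fun a v hv => by simp [hv]) x
  intro j
  have h1 : ι p F L (b j) = pbwBasis p b ⟨{j}, isTruncated_singleton p j⟩ := by
    rw [pbwBasis_apply]
    simp [orderedMonomial, monomial]
  rw [h1, Module.Basis.repr_self, Module.Basis.repr_self]
  by_cases h : j = i
  · subst h
    simp
  · rw [Finsupp.single_eq_of_ne, Finsupp.single_eq_of_ne]
    · exact Ne.symm h
    · intro h'
      simp only [Subtype.mk.injEq, Multiset.singleton_inj] at h'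
      exact h h'.symm

theorem weightSpan_eq_span_image (w : I → ℕ) (N k : ℕ) : weightSpan p b w N k =
    Submodule.span F (pbwBasis p b '' {m | min k N ≤ ((m : Multiset I).map w).sum}) := by
  rw [weightSpan]
  congr 1
  ext u
  constructor
  · rintro ⟨m, h1, h2, rfl⟩
    exact ⟨⟨m, h1⟩, h2, pbwBasis_apply p b _⟩
  · rintro ⟨m, h2, rfl⟩
    exact ⟨m, m.2, h2, (pbwBasis_apply p b _).symm⟩

theorem mem_weightSpan_iff (w : I → ℕ) (N k : ℕ) (u : RestrictedEnvelopingAlgebra p F L) :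
    u ∈ weightSpan p b w N k ↔
      ∀ m, (pbwBasis p b).repr u m ≠ 0 → min k N ≤ ((m : Multiset I).map w).sum := by
  rw [weightSpan_eq_span_image, Module.Basis.mem_span_image]
  constructor
  · exact fun h m hm => h (Finsupp.mem_support_iff.2 hm)
  · exact fun h m hm => h m (Finsupp.mem_support_iff.1 hm)

end Basis

theorem ι_injective (p : ℕ) [hp : Fact p.Prime] (F L : Type*) [Field F] [CharP F p] [LieRing L]
    [LieAlgebra F L] [RestrictedLieAlgebra p F L] : Function.Injective (ι p F L) := by
  let b := Module.Basis.ofVectorSpace F L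
  classical
  let _ : LinearOrder (Module.Basis.ofVectorSpaceIndex F L) := linearOrderOfSTO WellOrderingRel
  rw [injective_iff_map_eq_zero]
  intro x hx
  refine b.repr.injective (Finsupp.ext fun i => ?_)
  rw [← pbwBasis_repr_ι p b, hx]
  simp

end RestrictedEnvelopingAlgebra

/-! ### Bases adapted to a filtration -/

section Adapted

open Module

variable {F V : Type*} [Field F] [AddCommGroup V] [Module F V]

/-- A basis with weights which is adapted to the first `N` steps of a descending filtration. -/
def IsAdapted (R : ℕ → Submodule F V) (N : ℕ) {I : Type*} (b : Basis I F V) (w : I → ℕ) : Prop :=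
  (∀ i, b i ∈ R (w i)) ∧ ∀ k x, x ∈ R k → ∀ i, b.repr x i ≠ 0 → min k N ≤ w i

/-- Induction on `N` through the shifted filtration: a family adapted to `R 1, R 2, …` is extended
inside `R 0`, the old weights go up by one and new vectors get weight `0`. -/
theorem exists_linearIndepOn_filtration (N : ℕ) : ∀ (R : ℕ → Submodule F V), Antitone R →
    ∃ (B : Set V) (w : V → ℕ), LinearIndepOn F id B ∧ (∀ v ∈ B, v ∈ R (w v)) ∧
      ∀ k ≤ N, R k ≤ Submodule.span F {v | v ∈ B ∧ k ≤ w v} := by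
  classical
  induction N with
  | zero =>
    intro R _
    obtain ⟨B, hB, -, hspan, hli⟩ := exists_linearIndepOn_id_extension
      (linearIndepOn_empty F (id : V → V)) (Set.empty_subset (R 0 : Set V))
    refine ⟨B, fun _ => 0, hli, fun v hv => hB hv, ?_⟩
    intro k hk
    obtain rfl : k = 0 := by omega
    simpa using hspan
  | succ N ih =>
    intro R hR
    obtain ⟨B', w', hli', hw', hspan'⟩ := ih (fun k => R (k + 1)) (fun k l h => hR (by omega))
    obtain ⟨B, hB, hBB, hspan, hli⟩ := exists_linearIndepOn_id_extension hli'
      (fun v hv => hR (Nat.zero_le _) (hw' v hv) : B' ⊆ (R 0 : Set V))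
    refine ⟨B, fun v => if v ∈ B' then w' v + 1 else 0, hli, ?_, ?_⟩
    · intro v hv
      by_cases h : v ∈ B'
      · simpa [h] using hw' v h
      · simpa [h] using hB hv
    · intro k hk
      rcases k with _ | k
      · simpa using hspan
      · refine (hspan' k (by omega)).trans (Submodule.span_mono ?_)
        rintro v ⟨hv, hkv⟩
        exact ⟨hBB hv, by simp [hv, hkv]⟩

theorem exists_isAdapted (R : ℕ → Submodule F V) (hR : Antitone R) (h0 : R 0 = ⊤) (N : ℕ) :
    ∃ (B : Set V) (b : Basis B F V) (w : B → ℕ), IsAdapted R N b w := by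
  obtain ⟨B, w, hli, hw, hspan⟩ := exists_linearIndepOn_filtration N R hR
  have hli' : LinearIndependent F (fun v : B => (v : V)) := hli
  let b : Basis B F V := Basis.mk hli' (by
    rw [← h0]
    refine (hspan 0 (Nat.zero_le _)).trans (Submodule.span_mono ?_)
    rintro v ⟨hv, -⟩
    exact ⟨⟨v, hv⟩, rfl⟩)
  have hb : ∀ i, b i = (i : V) := fun i => Basis.mk_apply hli' _ i
  refine ⟨B, b, fun i => w i, fun i => by rw [hb]; exact hw i i.2, ?_⟩
  intro k x hx i hi
  have h1 := hspan (min k N) (min_le_right _ _) (hR (min_le_left _ _) hx)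
  have h2 : {v | v ∈ B ∧ min k N ≤ w v} = b '' {i | min k N ≤ w (i : V)} := by
    ext v
    constructor
    · rintro ⟨hv, h⟩
      exact ⟨⟨v, hv⟩, h, hb _⟩
    · rintro ⟨i, h, rfl⟩
      rw [hb]
      exact ⟨i.2, h⟩
  rw [h2, Basis.mem_span_image] at h1
  exact h1 (Finsupp.mem_support_iff.2 hi)

end Adapted

/-! ### Restricted filtrations -/

section Filtration

open Module RestrictedEnvelopingAlgebra

variable (p : ℕ) (F : Type*) {L : Type*} [Field F] [LieRing L] [LieAlgebra F L]
  [RestrictedLieAlgebra p F L]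

/-- A descending filtration of a restricted Lie algebra, compatible with bracket and `[p]`-map. -/
structure IsRestrictedFiltration (R : ℕ → Submodule F L) : Prop where
  antitone : Antitone R
  one : R 1 = ⊤
  lie_mem : ∀ {i j : ℕ} {x y : L}, 1 ≤ i → 1 ≤ j → x ∈ R i → y ∈ R j → ⁅x, y⁆ ∈ R (i + j)
  pmap_mem : ∀ {i : ℕ} {x : L}, 1 ≤ i → x ∈ R i → pmap p F x ∈ R (p * i)

variable {F}

/-- The span in `u(L)` of the products of elements of total weight at least `n`. -/
def productSpan (R : ℕ → Submodule F L) (n : ℕ) :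
    Submodule F (RestrictedEnvelopingAlgebra p F L) :=
  Submodule.span F {u | ∃ l : List (ℕ × L), (∀ a ∈ l, a.2 ∈ R a.1) ∧ n ≤ (l.map Prod.fst).sum ∧
    (l.map fun a => ι p F L a.2).prod = u}

variable {p} {R : ℕ → Submodule F L}

theorem IsRestrictedFiltration.zero (hR : IsRestrictedFiltration p F R) : R 0 = ⊤ :=
  top_le_iff.1 (hR.one ▸ hR.antitone (Nat.zero_le 1))

theorem productSpan_antitone : Antitone (productSpan p R) := by
  intro m n h
  refine Submodule.span_mono ?_
  rintro _ ⟨l, h1, h2, rfl⟩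
  exact ⟨l, h1, h.trans h2, rfl⟩

theorem mul_mem_productSpan {m n : ℕ} {u v : RestrictedEnvelopingAlgebra p F L}
    (hu : u ∈ productSpan p R m) (hv : v ∈ productSpan p R n) :
    u * v ∈ productSpan p R (m + n) := by
  have := Submodule.mul_mem_mul hu hv
  rw [productSpan, productSpan, Submodule.span_mul_span] at this
  refine Submodule.span_mono ?_ this
  rintro _ ⟨_, ⟨l, h1, h2, rfl⟩, _, ⟨l', h1', h2', rfl⟩, rfl⟩
  refine ⟨l ++ l', ?_, ?_, by simp⟩
  · intro a ha
    rcases List.mem_append.1 ha with ha | ha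
    · exact h1 a ha
    · exact h1' a ha
  · simp only [List.map_append, List.sum_append]
    omega

theorem ι_mem_productSpan {n : ℕ} {x : L} (hx : x ∈ R n) : ι p F L x ∈ productSpan p R n :=
  Submodule.subset_span ⟨[(n, x)], by simpa using hx, by simp, by simp⟩

theorem one_mem_productSpan : (1 : RestrictedEnvelopingAlgebra p F L) ∈ productSpan p R 0 :=
  Submodule.subset_span ⟨[], by simp, by simp, by simp⟩

variable {N : ℕ} {I : Type*} {b : Basis I F L} {w : I → ℕ}

theorem IsAdapted.one_le (hR : IsRestrictedFiltration p F R) (hb : IsAdapted R N b w) (hN : 1 ≤ N)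
    (i : I) : 1 ≤ w i := by
  have h := hb.2 1 (b i) (by rw [hR.one]; trivial) i (by simp)
  rwa [min_eq_left hN] at h

/-- Expanding the factors in an adapted basis gives words of no smaller weight up to `N`. The
filtration axioms are exactly the hypotheses under which straightening preserves this. -/
theorem productSpan_le_weightSpan [Fact p.Prime] [LinearOrder I] (hR : IsRestrictedFiltration p F R)
    (hb : IsAdapted R N b w) (hN : 1 ≤ N) (n : ℕ) :
    productSpan p R n ≤ weightSpan p b w N n := by
  refine Submodule.span_le.2 ?_
  rintro _ ⟨l, h1, h2, rfl⟩
  have key : (l.map fun a => ι p F L a.2).prod ∈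
      wordSpan p b w N (l.length + 1) (l.map Prod.fst).sum := by
    clear h2
    induction l with
    | nil => exact monomial_mem_wordSpan b w N (l := []) (by simp) (by simp)
    | cons a l ih =>
      have h3 := ih fun a ha => h1 a (List.mem_cons_of_mem _ ha)
      have h4 := ι_mul_mem_wordSpan b w N (hb.2 a.1 a.2 (h1 a (by simp))) h3
      simp only [List.map_cons, List.prod_cons, List.sum_cons]
      exact wordSpan_mono b w N (by simp) (by omega) h4
  have hlie : ∀ i j k, b.repr ⁅b i, b j⁆ k ≠ 0 → min (w i + w j) N ≤ w k := fun i j k h =>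
    hb.2 _ _ (hR.lie_mem (hb.one_le hR hN i) (hb.one_le hR hN j) (hb.1 i) (hb.1 j)) k h
  have hpow : ∀ i k, b.repr (pmap p F (b i)) k ≠ 0 → min (p * w i) N ≤ w k := fun i k h =>
    hb.2 _ _ (hR.pmap_mem (hb.one_le hR hN i) (hb.1 i)) k h
  exact wordSpan_le_weightSpan b w N hlie hpow _ _
    (wordSpan_mono b w N le_rfl ((min_le_left _ _).trans h2) key)

/-- An element of `L` which is a combination of products of weight at least `n` in `u(L)` lies in
the `n`-th step of the filtration. -/
theorem mem_of_ι_mem_productSpan [Fact p.Prime] [CharP F p] (hR : IsRestrictedFiltration p F R) {n : ℕ} {x : L}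
    (hx : ι p F L x ∈ productSpan p R n) : x ∈ R n := by
  rcases Nat.eq_zero_or_pos n with rfl | hn
  · rw [hR.zero]
    trivial
  obtain ⟨B, b, w, hb⟩ := exists_isAdapted R hR.antitone hR.zero n
  classical
  let _ : LinearOrder B := linearOrderOfSTO WellOrderingRel
  have h1 := (mem_weightSpan_iff p b w n n _).1 (productSpan_le_weightSpan hR hb hn n hx)
  rw [← b.linearCombination_repr x, Finsupp.linearCombination_apply]
  refine Submodule.sum_mem _ fun i hi => Submodule.smul_mem _ _ ?_
  -- A nonzero coordinate of `x` at `b i` is one of `ι x` at the one-letter monomial, whose weight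
  -- `w i` must then be at least `n`.
  have h2 := h1 ⟨{i}, isTruncated_singleton p i⟩
    (by rw [pbwBasis_repr_ι]; exact Finsupp.mem_support_iff.1 hi)
  simp only [Multiset.map_singleton, Multiset.sum_singleton, min_self] at h2
  exact hR.antitone h2 (hb.1 i)

end Filtration

end

noncomputable section

open Finsupp RestrictedLieAlgebra RestrictedEnvelopingAlgebra

attribute [local instance 100] LieRing.ofAssociativeRing

/-! ### Powers of a two-sided ideal -/

section IdealPowers

variable {A : Type*} [Ring A] {J : Ideal A}

theorem Ideal.mul_mem_pow_add [J.IsTwoSided] {i j : ℕ} {x y : A} (hx : x ∈ J ^ i) (hy : y ∈ J ^ j) :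
    x * y ∈ J ^ (i + j) := by
  rw [Ideal.IsTwoSided.pow_add]
  exact Ideal.mul_mem_mul hx hy

theorem Ideal.pow_mem_pow_mul [J.IsTwoSided] {i : ℕ} {x : A} (hx : x ∈ J ^ i) (n : ℕ) :
    x ^ n ∈ J ^ (n * i) := by
  induction n with
  | zero => rw [zero_mul, Submodule.pow_zero, Ideal.one_eq_top]; exact Submodule.mem_top
  | succ n ih =>
    rw [pow_succ, add_mul, one_mul]
    exact Ideal.mul_mem_pow_add ih hx

theorem Ideal.pow_succ_le_pow [J.IsTwoSided] (n : ℕ) : J ^ (n + 1) ≤ J ^ n := by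
  rw [Ideal.IsTwoSided.pow_add]
  exact Ideal.mul_le_left

/-- Powers are well defined on the graded algebra of `J`; used below for `p`-th powers. -/
theorem Ideal.add_pow_sub_pow_mem [J.IsTwoSided] {i : ℕ} {x r : A} (hx : x ∈ J ^ i)
    (hr : r ∈ J ^ (i + 1)) (n : ℕ) : (x + r) ^ n - x ^ n ∈ J ^ (n * i + 1) := by
  induction n with
  | zero => simp
  | succ n ih =>
    have h1 : (x + r) ^ (n + 1) - x ^ (n + 1) =
        ((x + r) ^ n - x ^ n) * x + (x + r) ^ n * r := by
      rw [pow_succ, pow_succ]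
      noncomm_ring
    have h2 := Ideal.mul_mem_pow_add ih hx
    have h3 := Ideal.mul_mem_pow_add
      (Ideal.pow_mem_pow_mul (add_mem hx (Ideal.pow_succ_le_pow i hr)) n) hr
    have e1 : n * i + 1 + i = (n + 1) * i + 1 := by ring
    have e2 : n * i + (i + 1) = (n + 1) * i + 1 := by ring
    rw [e1] at h2
    rw [e2] at h3
    rw [h1]
    exact add_mem h2 h3

end IdealPowers

/-! ### The dimension subalgebras are the smallest restricted filtration -/

section Dimension

variable {p : ℕ} {F L : Type*} [Field F] [LieRing L] [LieAlgebra F L]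
  [RestrictedLieAlgebra p F L]

theorem productSpan_zero_eq_top {R : ℕ → Submodule F L} (hR : IsRestrictedFiltration p F R) :
    productSpan p R 0 = ⊤ := by
  refine Submodule.eq_top_iff'.2 fun u => ?_
  refine induction (P := fun u => u ∈ productSpan p R 0) ?_ ?_ ?_ ?_ u
  · intro x
    exact ι_mem_productSpan (by rw [hR.zero]; exact Submodule.mem_top)
  · intro a
    rw [Algebra.algebraMap_eq_smul_one]
    exact Submodule.smul_mem _ _ one_mem_productSpan
  · exact fun u v hu hv => Submodule.add_mem _ hu hv
  · exact fun u v hu hv => mul_mem_productSpan (m := 0) (n := 0) hu hv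

variable (p F) in
/-- Membership in the smallest restricted filtration. -/
inductive MemMinimalFiltration : ℕ → L → Prop
  | zero_index (x : L) : MemMinimalFiltration 0 x
  | one_index (x : L) : MemMinimalFiltration 1 x
  | lie {i j : ℕ} {x y : L} : 1 ≤ i → 1 ≤ j → MemMinimalFiltration i x →
      MemMinimalFiltration j y → MemMinimalFiltration (i + j) ⁅x, y⁆
  | pmap {i : ℕ} {x : L} : 1 ≤ i → MemMinimalFiltration i x →
      MemMinimalFiltration (p * i) (pmap p F x)
  | of_succ {i : ℕ} {x : L} : MemMinimalFiltration (i + 1) x → MemMinimalFiltration i x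
  | zero (i : ℕ) : MemMinimalFiltration i 0
  | add {i : ℕ} {x y : L} : MemMinimalFiltration i x → MemMinimalFiltration i y →
      MemMinimalFiltration i (x + y)
  | smul {i : ℕ} (a : F) {x : L} : MemMinimalFiltration i x → MemMinimalFiltration i (a • x)

variable (p F L) in
/-- The smallest restricted filtration. -/
def minimalFiltration (n : ℕ) : Submodule F L where
  carrier := {x | MemMinimalFiltration p F n x}
  add_mem' := MemMinimalFiltration.add
  zero_mem' := MemMinimalFiltration.zero n
  smul_mem' a _ := MemMinimalFiltration.smul a

variable (p F L) in
theorem isRestrictedFiltration_minimalFiltration :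
    IsRestrictedFiltration p F (minimalFiltration p F L) where
  antitone := antitone_nat_of_succ_le fun _ _ hx => MemMinimalFiltration.of_succ hx
  one := eq_top_iff.2 fun x _ => MemMinimalFiltration.one_index x
  lie_mem := MemMinimalFiltration.lie
  pmap_mem := MemMinimalFiltration.pmap

variable [hp : Fact p.Prime]

theorem ι_mem_augmentationIdeal (x : L) : ι p F L x ∈ augmentationIdeal p F L := by
  rw [augmentationIdeal, RingHom.mem_ker]
  exact augmentation_ι p F L x

theorem mem_productSpan_one {R : ℕ → Submodule F L} (hR : IsRestrictedFiltration p F R)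
    {u : RestrictedEnvelopingAlgebra p F L} (hu : u ∈ augmentationIdeal p F L) :
    u ∈ productSpan p R 1 := by
  have h : ∀ u : RestrictedEnvelopingAlgebra p F L,
      u - algebraMap F _ (augmentation p F L u) ∈ productSpan p R 1 := by
    intro u
    refine induction (P := fun u => u - algebraMap F _ (augmentation p F L u) ∈ productSpan p R 1)
      ?_ ?_ ?_ ?_ u
    · intro x
      rw [augmentation_ι, map_zero, sub_zero]
      exact ι_mem_productSpan (by rw [hR.one]; trivial)
    · intro a
      simp
    · intro u v hu hv
      rw [map_add, map_add, add_sub_add_comm]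
      exact add_mem hu hv
    · intro u v hu hv
      have h1 : u * v - algebraMap F _ (augmentation p F L (u * v)) =
          (u - algebraMap F _ (augmentation p F L u)) * v +
          augmentation p F L u • (v - algebraMap F _ (augmentation p F L v)) := by
        rw [map_mul, map_mul, sub_mul, Algebra.smul_def, mul_sub]
        abel
      rw [h1]
      refine add_mem ?_ (Submodule.smul_mem _ _ hv)
      exact mul_mem_productSpan (n := 0) hu (by rw [productSpan_zero_eq_top hR]; trivial)
  have h1 := h u
  rw [augmentationIdeal, RingHom.mem_ker] at hu
  have hu' : augmentation p F L u = 0 := hu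
  rwa [hu', map_zero, sub_zero] at h1

/-- Since `R 1 = L`, elements of `ω` are sums of products of weight at least `1`. With
`mem_of_ι_mem_productSpan` this places `D_n` inside every restricted filtration. -/
theorem augmentationIdeal_pow_le_productSpan {R : ℕ → Submodule F L}
    (hR : IsRestrictedFiltration p F R) (n : ℕ) :
    ∀ u ∈ augmentationIdeal p F L ^ n, u ∈ productSpan p R n := by
  induction n with
  | zero =>
    intro u _
    rw [productSpan_zero_eq_top hR]
    trivial
  | succ n ih =>
    intro u hu
    rw [Ideal.IsTwoSided.pow_succ] at hu
    refine Submodule.smul_induction_on hu ?_ (fun u v hu hv => add_mem hu hv)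
    intro r hr s hs
    rw [add_comm]
    exact mul_mem_productSpan (mem_productSpan_one hR hr) (ih s hs)

variable (p F L) in
/-- The dimension subalgebras form a restricted filtration. -/
theorem isRestrictedFiltration_dimensionSubalgebra : IsRestrictedFiltration p F
    (fun n => (dimensionSubalgebra p F L n : Submodule F L)) where
  antitone := antitone_nat_of_succ_le fun n _ hx => Ideal.pow_succ_le_pow n hx
  one := by
    rw [eq_top_iff]
    intro x _
    change ι p F L x ∈ augmentationIdeal p F L ^ 1
    rw [Submodule.pow_one]
    exact ι_mem_augmentationIdeal x
  lie_mem := by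
    intro i j x y _ _ hx hy
    change ι p F L ⁅x, y⁆ ∈ augmentationIdeal p F L ^ (i + j)
    rw [ι_lie]
    exact sub_mem (Ideal.mul_mem_pow_add hx hy) (add_comm i j ▸ Ideal.mul_mem_pow_add hy hx)
  pmap_mem := by
    intro i x _ hx
    change ι p F L (pmap p F x) ∈ augmentationIdeal p F L ^ (p * i)
    rw [ι_pmap]
    exact Ideal.pow_mem_pow_mul hx p

theorem MemMinimalFiltration.mem_dimensionSubalgebra {n : ℕ} {x : L}
    (h : MemMinimalFiltration p F n x) : x ∈ dimensionSubalgebra p F L n := by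
  have hD := isRestrictedFiltration_dimensionSubalgebra p F L
  induction h with
  | zero_index x => exact (hD.zero ▸ Submodule.mem_top : x ∈ (dimensionSubalgebra p F L 0 : Submodule F L))
  | one_index x => exact (hD.one ▸ Submodule.mem_top : x ∈ (dimensionSubalgebra p F L 1 : Submodule F L))
  | lie hi hj _ _ hx hy => exact hD.lie_mem hi hj hx hy
  | pmap hi _ hx => exact hD.pmap_mem hi hx
  | of_succ _ hx => exact hD.antitone (Nat.le_succ _) hx
  | zero i => exact zero_mem _
  | add _ _ hx hy => exact add_mem hx hy
  | smul a _ hx => exact Submodule.smul_mem (dimensionSubalgebra p F L _ : Submodule F L) a hx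

theorem memMinimalFiltration_of_mem_dimensionSubalgebra [CharP F p] {n : ℕ} {x : L}
    (h : x ∈ dimensionSubalgebra p F L n) : MemMinimalFiltration p F n x :=
  mem_of_ι_mem_productSpan (isRestrictedFiltration_minimalFiltration p F L)
    (augmentationIdeal_pow_le_productSpan (isRestrictedFiltration_minimalFiltration p F L) n _ h)

end Dimension

/-! ### The Lie elements of the graded algebra of an ideal -/

section LieElements

variable (p : ℕ) (F : Type*) {A : Type*} [Field F] [Ring A] [Algebra F A]

/-- The elements of an algebra which, modulo `J ^ (n + 1)`, lie in the degree `n` part of the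
restricted Lie algebra generated by `J / J ^ 2` in the graded algebra of `J`. -/
inductive IsGradedLieElement (J : Ideal A) : ℕ → A → Prop
  | one_index {x : A} : x ∈ J → IsGradedLieElement J 1 x
  | of_mem {n : ℕ} {x : A} : x ∈ J ^ (n + 1) → IsGradedLieElement J n x
  | lie {i j : ℕ} {x y : A} : 1 ≤ i → 1 ≤ j → IsGradedLieElement J i x →
      IsGradedLieElement J j y → IsGradedLieElement J (i + j) (x * y - y * x)
  | pow {i : ℕ} {x : A} : 1 ≤ i → IsGradedLieElement J i x → IsGradedLieElement J (p * i) (x ^ p)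
  | add {i : ℕ} {x y : A} : IsGradedLieElement J i x → IsGradedLieElement J i y →
      IsGradedLieElement J i (x + y)
  | smul {i : ℕ} (a : F) {x : A} : IsGradedLieElement J i x → IsGradedLieElement J i (a • x)

/-- The space of all elements as in `IsGradedLieElement`. -/
def gradedLieElements (J : Ideal A) (n : ℕ) : Submodule F A where
  carrier := {x | IsGradedLieElement p F J n x}
  add_mem' := IsGradedLieElement.add
  zero_mem' := IsGradedLieElement.of_mem (zero_mem _)
  smul_mem' a _ := IsGradedLieElement.smul a

variable {p F} {B : Type*} [Ring B] [Algebra F B]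

theorem Ideal.map_mem_pow_of_forall {J : Ideal A} {K : Ideal B} [J.IsTwoSided] [K.IsTwoSided]
    (e : A →ₐ[F] B) (h : ∀ x ∈ J, e x ∈ K) (n : ℕ) : ∀ x ∈ J ^ n, e x ∈ K ^ n := by
  induction n with
  | zero =>
    intro x _
    rw [Submodule.pow_zero, Ideal.one_eq_top]
    exact Submodule.mem_top
  | succ n ih =>
    intro x hx
    rw [Ideal.IsTwoSided.pow_succ] at hx ⊢
    refine Submodule.smul_induction_on hx ?_ (fun u v hu hv => by rw [map_add]; exact add_mem hu hv)
    intro r hr s hs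
    rw [smul_eq_mul, map_mul]
    exact Ideal.mul_mem_mul (h r hr) (ih s hs)

theorem IsGradedLieElement.map {J : Ideal A} {K : Ideal B} [J.IsTwoSided] [K.IsTwoSided]
    (e : A →ₐ[F] B) (h : ∀ x ∈ J, e x ∈ K) {n : ℕ} {x : A} (hx : IsGradedLieElement p F J n x) :
    IsGradedLieElement p F K n (e x) := by
  induction hx with
  | one_index hx => exact .one_index (h _ hx)
  | of_mem hx => exact .of_mem (Ideal.map_mem_pow_of_forall e h _ _ hx)
  | lie hi hj _ _ hx hy =>
    rw [map_sub, map_mul, map_mul]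
    exact .lie hi hj hx hy
  | pow hi _ hx =>
    rw [map_pow]
    exact .pow hi hx
  | add _ _ hx hy =>
    rw [map_add]
    exact .add hx hy
  | smul a _ hx =>
    rw [map_smul]
    exact .smul a hx

variable [hp : Fact p.Prime] {L : Type*} [LieRing L] [LieAlgebra F L] [RestrictedLieAlgebra p F L]

/-- The rules generating the smallest filtration are those generating graded Lie elements. An
element coming from step `n + 1` lies in `ω ^ (n + 1)` and is zero in degree `n`. -/
theorem MemMinimalFiltration.isGradedLieElement {n : ℕ} {x : L} (h : MemMinimalFiltration p F n x)
    (hn : 1 ≤ n) : IsGradedLieElement p F (augmentationIdeal p F L) n (ι p F L x) := by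
  induction h with
  | zero_index x => omega
  | one_index x => exact .one_index (ι_mem_augmentationIdeal x)
  | lie hi hj _ _ hx hy =>
    rw [ι_lie]
    exact .lie hi hj (hx hi) (hy hj)
  | pmap hi _ hx =>
    rw [ι_pmap]
    exact .pow hi (hx hi)
  | of_succ hx _ => exact .of_mem hx.mem_dimensionSubalgebra
  | zero i => rw [map_zero]; exact .of_mem (zero_mem _)
  | add _ _ hx hy => rw [map_add]; exact .add (hx hn) (hy hn)
  | smul a _ hx => rw [map_smul]; exact .smul a (hx hn)

/-- Every element of `u(L)` is a scalar plus an element of `L` modulo `ω ^ 2`; on `ω` the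
augmentation kills the scalar. -/
theorem exists_sub_ι_mem_pow_two {u : RestrictedEnvelopingAlgebra p F L}
    (hu : u ∈ augmentationIdeal p F L) : ∃ x : L, u - ι p F L x ∈ augmentationIdeal p F L ^ 2 := by
  have hmul : ∀ u v, u ∈ augmentationIdeal p F L → v ∈ augmentationIdeal p F L →
      u * v ∈ augmentationIdeal p F L ^ 2 := by
    intro u v hu hv
    rw [← Submodule.pow_one (augmentationIdeal p F L)] at hu hv
    exact Ideal.mul_mem_pow_add hu hv
  have hle : ∀ u : RestrictedEnvelopingAlgebra p F L, ∃ (a : F) (x : L),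
      u - algebraMap F _ a - ι p F L x ∈ augmentationIdeal p F L ^ 2 := by
    intro u
    refine induction (P := fun u => ∃ (a : F) (x : L),
      u - algebraMap F _ a - ι p F L x ∈ augmentationIdeal p F L ^ 2) ?_ ?_ ?_ ?_ u
    · exact fun x => ⟨0, x, by simp⟩
    · exact fun a => ⟨a, 0, by simp⟩
    · rintro u v ⟨a, x, h1⟩ ⟨c, y, h2⟩
      refine ⟨a + c, x + y, ?_⟩
      have h3 := add_mem h1 h2
      rw [map_add, map_add]
      convert h3 using 1
      abel
    · rintro u v ⟨a, x, h1⟩ ⟨c, y, h2⟩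
      refine ⟨a * c, a • y + c • x, ?_⟩
      have h3 : u * v - algebraMap F _ (a * c) - ι p F L (a • y + c • x) =
          (u - algebraMap F _ a - ι p F L x) * v +
          (algebraMap F _ a + ι p F L x) * (v - algebraMap F _ c - ι p F L y) +
          ι p F L x * ι p F L y := by
        rw [map_add, map_smul, map_smul, Algebra.smul_def, Algebra.smul_def, map_mul,
          Algebra.commutes c]
        noncomm_ring
      rw [h3]
      exact add_mem (add_mem (Ideal.mul_mem_right _ _ h1) (Ideal.mul_mem_left _ _ h2))
        (hmul _ _ (ι_mem_augmentationIdeal x) (ι_mem_augmentationIdeal y))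
  obtain ⟨a, x, h⟩ := hle u
  refine ⟨x, ?_⟩
  have h2 : u - algebraMap F _ a - ι p F L x ∈ augmentationIdeal p F L := by
    have := Ideal.pow_succ_le_pow 1 h
    rwa [Submodule.pow_one] at this
  have h3 : augmentation p F L (u - algebraMap F _ a - ι p F L x) = 0 := h2
  have h4 : augmentation p F L u = 0 := hu
  rw [map_sub, map_sub, augmentation_ι, h4, AlgHom.commutes] at h3
  have h5 : a = 0 := by simpa using h3
  rwa [h5, map_zero, sub_zero] at h

/-- Degree one is `exists_sub_ι_mem_pow_two`; brackets and `p`-th powers of representatives in `L`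
represent those of the classes, as the errors land one power of `ω` deeper. -/
theorem IsGradedLieElement.exists_sub_ι_mem {n : ℕ} {u : RestrictedEnvelopingAlgebra p F L}
    (hu : IsGradedLieElement p F (augmentationIdeal p F L) n u) :
    ∃ x ∈ dimensionSubalgebra p F L n, u - ι p F L x ∈ augmentationIdeal p F L ^ (n + 1) := by
  have hD := isRestrictedFiltration_dimensionSubalgebra p F L
  induction hu with
  | one_index hu =>
    obtain ⟨x, hx⟩ := exists_sub_ι_mem_pow_two hu
    exact ⟨x, (MemMinimalFiltration.one_index x).mem_dimensionSubalgebra, hx⟩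
  | of_mem hu => exact ⟨0, zero_mem _, by simpa using hu⟩
  | @lie i j u v hi hj _ _ hu hv =>
    obtain ⟨x, hx, hux⟩ := hu
    obtain ⟨y, hy, hvy⟩ := hv
    refine ⟨⁅x, y⁆, hD.lie_mem hi hj hx hy, ?_⟩
    have h1 : u * v - v * u - ι p F L ⁅x, y⁆ = (u - ι p F L x) * (v - ι p F L y)
        + (u - ι p F L x) * ι p F L y + ι p F L x * (v - ι p F L y)
        - (v - ι p F L y) * (u - ι p F L x) - (v - ι p F L y) * ι p F L x
        - ι p F L y * (u - ι p F L x) := by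
      rw [ι_lie]
      noncomm_ring
    have hux' := Ideal.pow_succ_le_pow _ hux
    have e1 : i + 1 + j = i + j + 1 := by omega
    have e2 : i + (j + 1) = i + j + 1 := by omega
    have e3 : j + 1 + i = i + j + 1 := by omega
    have e4 : j + (i + 1) = i + j + 1 := by omega
    rw [h1]
    exact sub_mem (sub_mem (sub_mem (add_mem (add_mem (e2 ▸ Ideal.mul_mem_pow_add hux' hvy)
      (e1 ▸ Ideal.mul_mem_pow_add hux hy)) (e2 ▸ Ideal.mul_mem_pow_add hx hvy))
      (e3 ▸ Ideal.mul_mem_pow_add hvy hux')) (e3 ▸ Ideal.mul_mem_pow_add hvy hx))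
      (e4 ▸ Ideal.mul_mem_pow_add hy hux)
  | pow hi _ hu =>
    obtain ⟨x, hx, hux⟩ := hu
    refine ⟨pmap p F x, hD.pmap_mem hi hx, ?_⟩
    have := Ideal.add_pow_sub_pow_mem hx hux p
    rwa [add_sub_cancel, ← ι_pmap] at this
  | add _ _ hu hv =>
    obtain ⟨x, hx, hux⟩ := hu
    obtain ⟨y, hy, hvy⟩ := hv
    refine ⟨x + y, add_mem hx hy, ?_⟩
    rw [map_add, add_sub_add_comm]
    exact add_mem hux hvy
  | smul a _ hu =>
    obtain ⟨x, hx, hux⟩ := hu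
    refine ⟨a • x, Submodule.smul_mem (dimensionSubalgebra p F L _ : Submodule F L) a hx, ?_⟩
    rw [map_smul, ← smul_sub, Algebra.smul_def]
    exact Ideal.mul_mem_left _ _ hux

end LieElements

end

noncomputable section

open Finsupp RestrictedLieAlgebra RestrictedEnvelopingAlgebra

attribute [local instance 100] LieRing.ofAssociativeRing

/-! ### Isomorphisms compatible with the augmentations -/

section Twist

variable {p : ℕ} [hp : Fact p.Prime] {F L H : Type*} [Field F] [CharP F p] [LieRing L]
  [LieAlgebra F L] [RestrictedLieAlgebra p F L] [LieRing H] [LieAlgebra F H]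
  [RestrictedLieAlgebra p F H]

/-- The translation `x ↦ x + c(x)` of `u(L)`, for a restricted character `c` of `L`. -/
def translation (c : L →ₗ[F] F) (hlie : ∀ x y : L, c ⁅x, y⁆ = 0) (hc : ∀ x, c (pmap p F x) = c x ^ p) :
    RestrictedEnvelopingAlgebra p F L →ₐ[F] RestrictedEnvelopingAlgebra p F L :=
  lift
    { toFun := fun x => ι p F L x + algebraMap F _ (c x)
      map_add' := fun x y => by rw [map_add, map_add, map_add, add_add_add_comm]
      map_smul' := fun a x => by
        rw [map_smul, map_smul, smul_add, RingHom.id_apply, smul_eq_mul, map_mul,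
          Algebra.smul_def a (algebraMap F _ (c x))]
      map_lie' := fun {x y} => by
        have h1 := Algebra.commutes (A := RestrictedEnvelopingAlgebra p F L) (c x) (ι p F L y)
        have h2 := Algebra.commutes (A := RestrictedEnvelopingAlgebra p F L) (c y) (ι p F L x)
        have h3 := Algebra.commutes (A := RestrictedEnvelopingAlgebra p F L) (c x)
          (algebraMap F _ (c y))
        simp only [hlie, map_zero, add_zero, LieRing.of_associative_ring_bracket, ι_lie]
        rw [mul_add, add_mul, add_mul, mul_add, add_mul, add_mul, h1, h2, h3]
        abel }
    (fun x => by
      have : CharP (RestrictedEnvelopingAlgebra p F L) p := by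
        have : Nontrivial (RestrictedEnvelopingAlgebra p F L) :=
          (augmentation p F L).toRingHom.domain_nontrivial
        exact charP_of_injective_algebraMap
          (algebraMap F (RestrictedEnvelopingAlgebra p F L)).injective p
      change ι p F L (pmap p F x) + algebraMap F _ (c (pmap p F x)) =
        (ι p F L x + algebraMap F _ (c x)) ^ p
      rw [add_pow_char_of_commute p (Algebra.commute_algebraMap_right (c x) (ι p F L x)), ι_pmap,
        hc, map_pow])

theorem translation_ι (c : L →ₗ[F] F) (hlie : ∀ x y : L, c ⁅x, y⁆ = 0)
    (hc : ∀ x, c (pmap p F x) = c x ^ p) (x : L) :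
    translation c hlie hc (ι p F L x) = ι p F L x + algebraMap F _ (c x) :=
  lift_ι _ _ x

/-- The augmentation of `u(H)` pulls back to a character of `u(L)`, whose restriction `c` to `L`
kills brackets and satisfies `c (x ^ [p]) = c x ^ p`. Precomposing with `x ↦ x - c x` turns it into
the augmentation. -/
theorem exists_algEquiv_augmentation
    (e : RestrictedEnvelopingAlgebra p F L ≃ₐ[F] RestrictedEnvelopingAlgebra p F H) :
    ∃ e' : RestrictedEnvelopingAlgebra p F L ≃ₐ[F] RestrictedEnvelopingAlgebra p F H,
      ∀ u, augmentation p F H (e' u) = augmentation p F L u := by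
  let χ : RestrictedEnvelopingAlgebra p F L →ₐ[F] F := (augmentation p F H).comp e
  let c : L →ₗ[F] F := χ.toLinearMap ∘ₗ ι p F L
  have hcχ : ∀ x, c x = χ (ι p F L x) := fun x => rfl
  have hlie : ∀ x y : L, c ⁅x, y⁆ = 0 := fun x y => by
    rw [hcχ, ι_lie, map_sub, map_mul, map_mul, mul_comm, sub_self]
  have hc : ∀ x, c (pmap p F x) = c x ^ p := fun x => by
    rw [hcχ, ι_pmap, map_pow, hcχ]
  have hlie' : ∀ x y : L, (-c) ⁅x, y⁆ = 0 := fun x y => by simp [hlie]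
  have hc' : ∀ x, (-c) (pmap p F x) = (-c) x ^ p := fun x => by
    rw [LinearMap.neg_apply, LinearMap.neg_apply, hc, neg_pow (c x), neg_one_pow_char, neg_one_mul]
  let t : RestrictedEnvelopingAlgebra p F L ≃ₐ[F] RestrictedEnvelopingAlgebra p F L :=
    AlgEquiv.ofAlgHom (translation (-c) hlie' hc') (translation c hlie hc)
      (algHom_ext fun x => by simp [translation_ι])
      (algHom_ext fun x => by simp [translation_ι])
  refine ⟨t.trans e, fun u => ?_⟩
  have h : ((augmentation p F H).comp ((t.trans e : RestrictedEnvelopingAlgebra p F L ≃ₐ[F]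
      RestrictedEnvelopingAlgebra p F H) : RestrictedEnvelopingAlgebra p F L →ₐ[F] _)) =
      augmentation p F L := by
    refine algHom_ext fun x => ?_
    have h1 : t (ι p F L x) = ι p F L x - algebraMap F _ (c x) := by
      change translation (-c) hlie' hc' _ = _
      rw [translation_ι, LinearMap.neg_apply, map_neg, sub_eq_add_neg]
    change augmentation p F H (e (t (ι p F L x))) = _
    rw [h1, map_sub, map_sub, AlgEquiv.commutes, AlgHom.commutes, augmentation_ι, hcχ]
    exact sub_self _
  exact congrArg (fun g : RestrictedEnvelopingAlgebra p F L →ₐ[F] F => g u) h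

end Twist

/-! ### The quotients of consecutive dimension subalgebras -/

section Quotients

variable {p : ℕ} [hp : Fact p.Prime] {F L : Type*} [Field F] [LieRing L]
  [LieAlgebra F L] [RestrictedLieAlgebra p F L]

theorem DimensionQuotient.mk_surjective {n : ℕ} (x : DimensionQuotient p F L n) :
    ∃ y : dimensionSubalgebra p F L n, quotMk F (nextDimensionIdeal p F L n) y = x :=
  Submodule.Quotient.mk_surjective _ x

theorem DimensionQuotient.quotMk_eq_zero {n : ℕ} {y : dimensionSubalgebra p F L n} :
    quotMk F (nextDimensionIdeal p F L n) y = 0 ↔ (y : L) ∈ dimensionSubalgebra p F L (n + 1) :=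
  LieSubmodule.Quotient.mk_eq_zero'

theorem DimensionQuotient.lie_eq_zero {n : ℕ} (hn : 1 ≤ n) (x y : DimensionQuotient p F L n) :
    ⁅x, y⁆ = 0 := by
  obtain ⟨x, rfl⟩ := DimensionQuotient.mk_surjective x
  obtain ⟨y, rfl⟩ := DimensionQuotient.mk_surjective y
  have hD := isRestrictedFiltration_dimensionSubalgebra p F L
  rw [← LieHom.map_lie, DimensionQuotient.quotMk_eq_zero]
  exact hD.antitone (by omega : n + 1 ≤ n + n) (hD.lie_mem hn hn x.2 y.2)

theorem DimensionQuotient.pmap_eq_zero {n : ℕ} (hn : 1 ≤ n) (x : DimensionQuotient p F L n) :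
    pmap p F x = 0 := by
  obtain ⟨x, rfl⟩ := DimensionQuotient.mk_surjective x
  have hD := isRestrictedFiltration_dimensionSubalgebra p F L
  change quotMk F (nextDimensionIdeal p F L n) (pmap p F x) = 0
  rw [DimensionQuotient.quotMk_eq_zero]
  have h2 : n + 1 ≤ p * n := by nlinarith [hp.out.two_le]
  exact hD.antitone h2 (hD.pmap_mem hn x.2)

/-- Linearly isomorphic quotients of dimension subalgebras are isomorphic as restricted Lie
algebras, since their brackets and `[p]`-maps vanish. -/
def DimensionQuotient.restrictedLieEquiv {H : Type*} [LieRing H] [LieAlgebra F H]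
    [RestrictedLieAlgebra p F H] {n : ℕ} (hn : 1 ≤ n)
    (e : DimensionQuotient p F L n ≃ₗ[F] DimensionQuotient p F H n) :
    RestrictedLieEquiv p F (DimensionQuotient p F L n) (DimensionQuotient p F H n) where
  __ := e
  map_lie' := fun {x y} => by
    change e ⁅x, y⁆ = ⁅e x, e y⁆
    rw [lie_eq_zero hn, lie_eq_zero hn, map_zero]
  map_pmap' x := by
    change e (pmap p F x) = pmap p F (e x)
    rw [pmap_eq_zero hn, pmap_eq_zero hn, map_zero]

variable [CharP F p]

/-- The quotient of consecutive dimension subalgebras, in terms of the associative algebra `u(L)`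
and its augmentation ideal. -/
theorem nonempty_dimensionQuotient_equiv {A : Type*} [Ring A] [Algebra F A] (J : Ideal A)
    [J.IsTwoSided] (e : RestrictedEnvelopingAlgebra p F L ≃ₐ[F] A)
    (he : ∀ u, e u ∈ J ↔ u ∈ augmentationIdeal p F L) {n : ℕ} (hn : 1 ≤ n) :
    Nonempty (DimensionQuotient p F L n ≃ₗ[F]
      (gradedLieElements p F J n ⧸
        ((J ^ (n + 1)).restrictScalars F).comap (gradedLieElements p F J n).subtype)) := by
  have he' : ∀ v, e.symm v ∈ augmentationIdeal p F L ↔ v ∈ J := fun v => by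
    rw [← he, AlgEquiv.apply_symm_apply]
  let f₁ : RestrictedEnvelopingAlgebra p F L →ₐ[F] A := e
  let f₂ : A →ₐ[F] RestrictedEnvelopingAlgebra p F L := e.symm
  have h₁ : ∀ u ∈ augmentationIdeal p F L, f₁ u ∈ J := fun u hu => (he u).2 hu
  have h₂ : ∀ v ∈ J, f₂ v ∈ augmentationIdeal p F L := fun v hv => (he' v).2 hv
  have hpow : ∀ k u, e u ∈ J ^ k ↔ u ∈ augmentationIdeal p F L ^ k := fun k u =>
    ⟨fun h => by
      have := Ideal.map_mem_pow_of_forall f₂ h₂ k _ h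
      rwa [show f₂ (e u) = u from e.symm_apply_apply u] at this,
    fun h => Ideal.map_mem_pow_of_forall f₁ h₁ k _ h⟩
  -- The minimality of the dimension filtration is used here: it is what makes the image of `D_n`
  -- consist of graded Lie elements.
  let g : (dimensionSubalgebra p F L n) →ₗ[F] gradedLieElements p F J n :=
    LinearMap.codRestrict _ ((e.toLinearMap ∘ₗ ι p F L) ∘ₗ
      (dimensionSubalgebra p F L n : Submodule F L).subtype) (fun x =>
        ((memMinimalFiltration_of_mem_dimensionSubalgebra x.2).isGradedLieElement hn).map
          f₁ h₁)
  have hg : ∀ x, (g x : A) = e (ι p F L x) := fun x => rfl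
  let f := (((J ^ (n + 1)).restrictScalars F).comap (gradedLieElements p F J n).subtype).mkQ ∘ₗ g
  have hf : Function.Surjective f := by
    intro y
    obtain ⟨⟨v, hv⟩, rfl⟩ := Submodule.mkQ_surjective _ y
    have h1 : IsGradedLieElement p F (augmentationIdeal p F L) n (e.symm v) :=
      IsGradedLieElement.map f₂ h₂ hv
    obtain ⟨x, hx, hx'⟩ := h1.exists_sub_ι_mem
    refine ⟨⟨x, hx⟩, ?_⟩
    change Submodule.Quotient.mk _ = Submodule.Quotient.mk _
    rw [Submodule.Quotient.eq, ← neg_mem_iff, neg_sub]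
    change v - e (ι p F L x) ∈ J ^ (n + 1)
    rw [← hpow, map_sub, AlgEquiv.apply_symm_apply] at hx'
    exact hx'
  have hker : LinearMap.ker f = (nextDimensionIdeal p F L n : Submodule F _) := by
    ext x
    rw [LinearMap.mem_ker]
    change Submodule.Quotient.mk _ = 0 ↔ _
    rw [Submodule.Quotient.mk_eq_zero]
    change e (ι p F L x) ∈ J ^ (n + 1) ↔ _
    rw [hpow]
    rfl
  exact ⟨(Submodule.quotEquivOfEq _ _ hker.symm).trans (f.quotKerEquivOfSurjective hf)⟩

theorem nonempty_restrictedLieEquiv_dimensionQuotient {H : Type*} [LieRing H] [LieAlgebra F H]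
    [RestrictedLieAlgebra p F H]
    (e : RestrictedEnvelopingAlgebra p F L ≃ₐ[F] RestrictedEnvelopingAlgebra p F H)
    {n : ℕ} (hn : 1 ≤ n) :
    Nonempty (RestrictedLieEquiv p F (DimensionQuotient p F L n) (DimensionQuotient p F H n)) := by
  obtain ⟨e', he'⟩ := exists_algEquiv_augmentation e
  obtain ⟨f⟩ := nonempty_dimensionQuotient_equiv (augmentationIdeal p F H) e'
    (fun u => by rw [augmentationIdeal, augmentationIdeal, RingHom.mem_ker, RingHom.mem_ker]; exact
      (he' u).symm ▸ Iff.rfl) hn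
  obtain ⟨g⟩ := nonempty_dimensionQuotient_equiv (augmentationIdeal p F H)
    (AlgEquiv.refl (A₁ := RestrictedEnvelopingAlgebra p F H)) (fun u => Iff.rfl) hn
  exact ⟨DimensionQuotient.restrictedLieEquiv hn (f.trans g.symm)⟩

end Quotients

end

noncomputable section

open Finsupp RestrictedLieAlgebra RestrictedEnvelopingAlgebra

attribute [local instance 100] LieRing.ofAssociativeRing

/-! ### Nilpotency -/

section LowerCentralSeries

open LieModule

variable (F : Type*) {L M : Type*} [Field F] [LieRing L] [LieAlgebra F L] [AddCommGroup M]
  [Module F M] [LieRingModule L M]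

theorem lie_mem_lowerCentralSeries_succ {k : ℕ} (x : L) {y : M}
    (hy : y ∈ lowerCentralSeries F L M k) : ⁅x, y⁆ ∈ lowerCentralSeries F L M (k + 1) := by
  rw [lowerCentralSeries_succ]
  exact LieSubmodule.lie_mem_lie (LieSubmodule.mem_top x) hy

variable [LieModule F L M]

theorem lowerCentralSeries_succ_le {k : ℕ} {S : Submodule F M}
    (h : ∀ (x : L) (y : M), y ∈ lowerCentralSeries F L M k → ⁅x, y⁆ ∈ S) {z : M}
    (hz : z ∈ lowerCentralSeries F L M (k + 1)) : z ∈ S := by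
  rw [lowerCentralSeries_succ, ← LieSubmodule.mem_toSubmodule,
    LieSubmodule.lieIdeal_oper_eq_linear_span'] at hz
  refine Submodule.span_le.2 ?_ hz
  rintro _ ⟨x, -, y, hy, rfl⟩
  exact h x y hy

/-- `nilpotencyLength` is defined by the series over `ℤ`, whose terms have the same elements as
those over `F`. Indices start at `0`, so the term `k` is `γ_{k+1}` and the length is the class. -/
theorem lowerCentralSeries_eq_bot_iff_nilpotencyLength_le [IsNilpotent L M] (k : ℕ) :
    lowerCentralSeries F L M k = ⊥ ↔ nilpotencyLength L M ≤ k := by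
  have aux (k : ℕ) : lowerCentralSeries F L M k = ⊥ ↔ lowerCentralSeries ℤ L M k = ⊥ := by
    simp [SetLike.ext'_iff, coe_lowerCentralSeries_eq_int F L M]
  rw [aux]
  have hne : {k | lowerCentralSeries ℤ L M k = ⊥}.Nonempty := IsNilpotent.nilpotent ℤ L M
  refine ⟨fun h => Nat.sInf_le h, fun h => ?_⟩
  have h1 : lowerCentralSeries ℤ L M (nilpotencyLength L M) = ⊥ := Nat.sInf_mem hne
  exact eq_bot_iff.2 (h1 ▸ antitone_lowerCentralSeries ℤ L M h)

theorem lowerCentralSeries_eq_bot_of_le_succ [IsNilpotent L M] {k : ℕ}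
    (h : lowerCentralSeries F L M k ≤ lowerCentralSeries F L M (k + 1)) :
    lowerCentralSeries F L M k = ⊥ := by
  have h1 : ∀ n, lowerCentralSeries F L M k ≤ lowerCentralSeries F L M (k + n) := by
    intro n
    induction n with
    | zero => exact le_rfl
    | succ n ih =>
      refine h.trans ?_
      rw [← add_assoc, lowerCentralSeries_succ, lowerCentralSeries_succ]
      exact LieSubmodule.mono_lie_right _ ih
  obtain ⟨n, hn⟩ := IsNilpotent.nilpotent F L M
  exact eq_bot_iff.2 ((h1 n).trans (hn ▸ antitone_lowerCentralSeries F L M (Nat.le_add_left n k)))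

end LowerCentralSeries

/-! ### Engel's theorem, `p`-nilpotency and nilpotency of the augmentation ideal. -/

section PNilpotent

variable {p : ℕ} {F L : Type*} [Field F] [LieRing L] [LieAlgebra F L]
  [RestrictedLieAlgebra p F L]

theorem ι_iterate_pmap (k : ℕ) (x : L) : ι p F L ((pmap p F)^[k] x) = ι p F L x ^ p ^ k := by
  induction k with
  | zero => simp
  | succ k ih => rw [Function.iterate_succ_apply', ι_pmap, ih, ← pow_mul, pow_succ]

theorem ad_iterate_pmap (k : ℕ) (x : L) : LieAlgebra.ad F L ((pmap p F)^[k] x) =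
    (LieAlgebra.ad F L x : Module.End F L) ^ p ^ k := by
  induction k with
  | zero => simp
  | succ k ih => rw [Function.iterate_succ_apply', ad_pmap, ih, ← pow_mul, pow_succ]

/-- Engel's theorem: `(ad x) ^ (p ^ k) = ad (x ^ [p] ^ k) = 0`. -/
theorem IsPNilpotent.isNilpotent [FiniteDimensional F L] (h : IsPNilpotent p F L) :
    LieRing.IsNilpotent L := by
  obtain ⟨k, -, hk⟩ := h
  rw [LieAlgebra.isNilpotent_iff_forall (R := F)]
  intro x
  refine ⟨p ^ k, ?_⟩
  rw [← ad_iterate_pmap, hk, map_zero]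

theorem finite_isTruncated (p : ℕ) (I : Type*) [Finite I] :
    Finite {m : Multiset I // PBW.IsTruncated p m} := by
  classical
  refine Finite.of_injective (β := I → Fin p)
    (fun m i => ⟨(m : Multiset I).count i, PBW.isTruncated_iff_count_lt.1 m.2 i⟩) ?_
  intro m m' h
  refine Subtype.ext (Multiset.ext.2 fun i => ?_)
  simpa using congrFun h i

theorem finiteDimensional_restrictedEnvelopingAlgebra [Fact p.Prime] [CharP F p]
    [FiniteDimensional F L] : FiniteDimensional F (RestrictedEnvelopingAlgebra p F L) := by
  have := finite_isTruncated p (Fin (Module.finrank F L))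
  exact (pbwBasis p (Module.finBasis F L)).finiteDimensional_of_finite

variable (p F L) in
/-- `u(L)` as a Lie module over `L`, by left multiplication. -/
@[reducible]
def leftLieRingModule : LieRingModule L (RestrictedEnvelopingAlgebra p F L) where
  bracket x u := ι p F L x * u
  add_lie x y u := by
    change ι p F L (x + y) * u = ι p F L x * u + ι p F L y * u
    rw [map_add, add_mul]
  lie_add x u v := mul_add _ _ _
  leibniz_lie x y u := by
    change ι p F L x * (ι p F L y * u) = ι p F L ⁅x, y⁆ * u + ι p F L y * (ι p F L x * u)
    rw [ι_lie]
    noncomm_ring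

variable (p F L) in
theorem leftLieModule :
    @LieModule F L (RestrictedEnvelopingAlgebra p F L) _ _ _ _ _ (leftLieRingModule p F L) :=
  letI := leftLieRingModule p F L
  { smul_lie := fun a x u => by
      change ι p F L (a • x) * u = a • (ι p F L x * u)
      rw [map_smul, smul_mul_assoc]
    lie_smul := fun a x u => mul_smul_comm _ _ _ }

variable [Fact p.Prime]

theorem mem_range_ι_mul_top {u : RestrictedEnvelopingAlgebra p F L}
    (hu : u ∈ augmentationIdeal p F L) :
    u ∈ LinearMap.range (ι p F L) * (⊤ : Submodule F (RestrictedEnvelopingAlgebra p F L)) := by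
  have h : ∀ u : RestrictedEnvelopingAlgebra p F L,
      u - algebraMap F _ (augmentation p F L u) ∈
        LinearMap.range (ι p F L) * (⊤ : Submodule F (RestrictedEnvelopingAlgebra p F L)) := by
    intro u
    refine induction (P := fun u => u - algebraMap F _ (augmentation p F L u) ∈
      LinearMap.range (ι p F L) * (⊤ : Submodule F (RestrictedEnvelopingAlgebra p F L)))
      ?_ ?_ ?_ ?_ u
    · intro x
      rw [augmentation_ι, map_zero, sub_zero, ← mul_one (ι p F L x)]
      exact Submodule.mul_mem_mul ⟨x, rfl⟩ Submodule.mem_top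
    · intro a
      simp
    · intro u v hu hv
      rw [map_add, map_add, add_sub_add_comm]
      exact Submodule.add_mem _ hu hv
    · intro u v hu hv
      have h1 : u * v - algebraMap F _ (augmentation p F L (u * v)) =
          (u - algebraMap F _ (augmentation p F L u)) * v +
          augmentation p F L u • (v - algebraMap F _ (augmentation p F L v)) := by
        rw [map_mul, map_mul, sub_mul, Algebra.smul_def, mul_sub]
        abel
      rw [h1]
      refine Submodule.add_mem _ ?_ (Submodule.smul_mem _ _ hv)
      have := Submodule.mul_mem_mul hu (Submodule.mem_top (x := v) (R := F))
      rw [mul_assoc] at this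
      exact Submodule.mul_induction_on this
        (fun a ha c _ => Submodule.mul_mem_mul ha Submodule.mem_top) (fun _ _ => Submodule.add_mem _)
  have h1 := h u
  have hu' : augmentation p F L u = 0 := hu
  rwa [hu', map_zero, sub_zero] at h1

/-- As a right ideal `ω` is generated by `L`, and Lie submodules of `u(L)` are left ideals, so `ω`
times a term of the series lies in the next term. -/
theorem augmentationIdeal_pow_le_lowerCentralSeries (k : ℕ) :
    letI := leftLieRingModule p F L
    ∀ u ∈ augmentationIdeal p F L ^ k,
      u ∈ LieModule.lowerCentralSeries F L (RestrictedEnvelopingAlgebra p F L) k := by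
  let _ := leftLieRingModule p F L
  have := leftLieModule p F L
  have hbr : ∀ (x : L) (u : RestrictedEnvelopingAlgebra p F L), ⁅x, u⁆ = ι p F L x * u :=
    fun _ _ => rfl
  have hleft : ∀ (N : LieSubmodule F L (RestrictedEnvelopingAlgebra p F L))
      (v u : RestrictedEnvelopingAlgebra p F L), u ∈ N → v * u ∈ N := by
    intro N v
    refine induction (P := fun v => ∀ u, u ∈ N → v * u ∈ N) ?_ ?_ ?_ ?_ v
    · intro x u hu
      rw [← hbr]
      exact N.lie_mem hu
    · intro a u hu
      rw [← Algebra.smul_def]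
      exact N.smul_mem a hu
    · intro v v' hv hv' u hu
      rw [add_mul]
      exact N.add_mem (hv u hu) (hv' u hu)
    · intro v v' hv hv' u hu
      rw [mul_assoc]
      exact hv _ (hv' u hu)
  induction k with
  | zero => exact fun u _ => LieSubmodule.mem_top u
  | succ k ih =>
    intro u hu
    rw [Ideal.IsTwoSided.pow_succ] at hu
    refine Submodule.smul_induction_on hu ?_ (fun u v hu hv => add_mem hu hv)
    intro r hr s hs
    have hs' := ih s hs
    rw [smul_eq_mul]
    refine Submodule.mul_induction_on (C := fun r => r * s ∈
      LieModule.lowerCentralSeries F L (RestrictedEnvelopingAlgebra p F L) (k + 1))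
      (mem_range_ι_mul_top hr) ?_ ?_
    · rintro _ ⟨x, rfl⟩ v -
      rw [mul_assoc, ← hbr]
      exact lie_mem_lowerCentralSeries_succ F x (hleft _ v s hs')
    · intro v v' hv hv'
      rw [add_mul]
      exact add_mem hv hv'

/-- The augmentation ideal of a finite-dimensional `p`-nilpotent restricted Lie algebra is
nilpotent. -/
theorem IsPNilpotent.exists_augmentationIdeal_pow_eq_bot [FiniteDimensional F L]
    (h : IsPNilpotent p F L) : ∃ k, augmentationIdeal p F L ^ k = ⊥ := by
  let _ := leftLieRingModule p F L
  have := leftLieModule p F L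
  obtain ⟨k, -, hk⟩ := h
  -- Engel's theorem for left multiplication on `u(L)`: each `x ∈ L` has `ι x ^ (p ^ k) = 0`.
  have hnil : LieModule.IsNilpotent L (RestrictedEnvelopingAlgebra p F L) := by
    rw [LieModule.isNilpotent_iff_forall (R := F)]
    intro x
    refine ⟨p ^ k, ?_⟩
    have h1 : LieModule.toEnd F L (RestrictedEnvelopingAlgebra p F L) x =
        LinearMap.mulLeft F (ι p F L x) := rfl
    rw [h1, LinearMap.pow_mulLeft, ← ι_iterate_pmap, hk, map_zero, LinearMap.mulLeft_zero_eq_zero]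
  obtain ⟨n, hn⟩ := LieModule.IsNilpotent.nilpotent F L (RestrictedEnvelopingAlgebra p F L)
  refine ⟨n, eq_bot_iff.2 fun u hu => ?_⟩
  have := augmentationIdeal_pow_le_lowerCentralSeries n u hu
  rwa [hn, LieSubmodule.mem_bot] at this

theorem isPNilpotent_of_augmentationIdeal_pow_eq_bot [CharP F p] {k : ℕ}
    (h : augmentationIdeal p F L ^ k = ⊥) : IsPNilpotent p F L := by
  -- The number of iterations must be positive and satisfy `k ≤ p ^ (k + 1)`, so that `ι x ^ k = 0`
  -- suffices.
  refine ⟨k + 1, Nat.succ_pos k, fun x => ι_injective p F L ?_⟩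
  have hp : 1 < p := (Fact.out : p.Prime).one_lt
  have h1 : k ≤ p ^ (k + 1) := (Nat.lt_pow_self hp).le.trans (Nat.pow_le_pow_right hp.le (by omega))
  have h2 : ι p F L x ^ k ∈ augmentationIdeal p F L ^ k := by
    have := Ideal.pow_mem_pow_mul (J := augmentationIdeal p F L) (i := 1) (x := ι p F L x)
      (by rw [Submodule.pow_one]; exact ι_mem_augmentationIdeal x) k
    rwa [mul_one] at this
  rw [h, Submodule.mem_bot] at h2
  rw [ι_iterate_pmap, map_zero, ← Nat.sub_add_cancel h1, pow_add, h2, mul_zero]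

variable {H : Type*} [LieRing H] [LieAlgebra F H] [RestrictedLieAlgebra p F H] [CharP F p]

theorem finiteDimensional_of_algEquiv [FiniteDimensional F L]
    (e : RestrictedEnvelopingAlgebra p F L ≃ₐ[F] RestrictedEnvelopingAlgebra p F H) :
    FiniteDimensional F H := by
  have := finiteDimensional_restrictedEnvelopingAlgebra (p := p) (F := F) (L := L)
  have : FiniteDimensional F (RestrictedEnvelopingAlgebra p F H) :=
    e.toLinearEquiv.finiteDimensional
  exact FiniteDimensional.of_injective (ι p F H) (ι_injective p F H)

theorem IsPNilpotent.of_algEquiv [FiniteDimensional F L] (h : IsPNilpotent p F L)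
    (e : RestrictedEnvelopingAlgebra p F L ≃ₐ[F] RestrictedEnvelopingAlgebra p F H) :
    IsPNilpotent p F H := by
  obtain ⟨e', he'⟩ := exists_algEquiv_augmentation e
  obtain ⟨k, hk⟩ := IsPNilpotent.exists_augmentationIdeal_pow_eq_bot h
  refine isPNilpotent_of_augmentationIdeal_pow_eq_bot (k := k) (eq_bot_iff.2 fun u hu => ?_)
  let f : RestrictedEnvelopingAlgebra p F H →ₐ[F] RestrictedEnvelopingAlgebra p F L := e'.symm
  have hf : ∀ v ∈ augmentationIdeal p F H, f v ∈ augmentationIdeal p F L := by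
    intro v hv
    change augmentation p F L (e'.symm v) = 0
    rw [← he', AlgEquiv.apply_symm_apply]
    exact hv
  have h1 : f u ∈ augmentationIdeal p F L ^ k := Ideal.map_mem_pow_of_forall f hf k u hu
  rw [hk, Submodule.mem_bot] at h1
  exact (Submodule.mem_bot _).2 (e'.symm.injective (h1.trans (map_zero e'.symm).symm))

end PNilpotent

end

noncomputable section

open Finsupp RestrictedLieAlgebra RestrictedEnvelopingAlgebra

attribute [local instance 100] LieRing.ofAssociativeRing

/-! ### Comparison of the nilpotency classes -/

section CommutatorFiltration

variable (F : Type*) {A B : Type*} [Field F] [Ring A] [Algebra F A] [Ring B] [Algebra F B]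

/-- The smallest multiplicative filtration of an algebra whose degree is raised by commutators. -/
inductive MemCommutatorFiltration : ℕ → A → Prop
  | zero_index (x : A) : MemCommutatorFiltration 0 x
  | mul {i j : ℕ} {x y : A} : MemCommutatorFiltration i x → MemCommutatorFiltration j y →
      MemCommutatorFiltration (i + j) (x * y)
  | commutator {i : ℕ} {x : A} (y : A) : MemCommutatorFiltration i x →
      MemCommutatorFiltration (i + 1) (x * y - y * x)
  | zero (i : ℕ) : MemCommutatorFiltration i 0
  | add {i : ℕ} {x y : A} : MemCommutatorFiltration i x → MemCommutatorFiltration i y →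
      MemCommutatorFiltration i (x + y)
  | smul {i : ℕ} (a : F) {x : A} : MemCommutatorFiltration i x →
      MemCommutatorFiltration i (a • x)

variable (A) in
/-- The span of the products of two elements of positive degrees `i` and `j`, where `i + j = m`. -/
def decomposables (m : ℕ) : Submodule F A :=
  Submodule.span F {z | ∃ (i j : ℕ) (x y : A), 1 ≤ i ∧ 1 ≤ j ∧ i + j = m ∧
    MemCommutatorFiltration F i x ∧ MemCommutatorFiltration F j y ∧ x * y = z}

variable {F}

theorem MemCommutatorFiltration.map (e : A ≃ₐ[F] B) {m : ℕ} {x : A}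
    (h : MemCommutatorFiltration F m x) : MemCommutatorFiltration F m (e x) := by
  induction h with
  | zero_index x => exact .zero_index _
  | mul _ _ hx hy => rw [map_mul]; exact .mul hx hy
  | commutator y _ hx => rw [map_sub, map_mul, map_mul]; exact .commutator _ hx
  | zero i => rw [map_zero]; exact .zero i
  | add _ _ hx hy => rw [map_add]; exact .add hx hy
  | smul a _ hx => rw [map_smul]; exact .smul a hx

theorem mul_mem_decomposables {i j m : ℕ} {x y : A} (hi : 1 ≤ i) (hj : 1 ≤ j) (hm : i + j = m)
    (hx : MemCommutatorFiltration F i x) (hy : MemCommutatorFiltration F j y) :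
    x * y ∈ decomposables F A m :=
  Submodule.subset_span ⟨i, j, x, y, hi, hj, hm, hx, hy, rfl⟩

theorem map_mem_decomposables (e : A ≃ₐ[F] B) {m : ℕ} {x : A} (h : x ∈ decomposables F A m) :
    e x ∈ decomposables F B m := by
  refine Submodule.span_induction (p := fun x _ => e x ∈ decomposables F B m) ?_ (by simp)
    (fun x y _ _ hx hy => by rw [map_add]; exact add_mem hx hy)
    (fun a x _ hx => by rw [map_smul]; exact Submodule.smul_mem _ _ hx) h
  rintro _ ⟨i, j, x, y, hi, hj, hm, hx, hy, rfl⟩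
  rw [map_mul]
  exact mul_mem_decomposables hi hj hm (hx.map e) (hy.map e)

theorem mul_left_mem_decomposables {m : ℕ} (u : A) {x : A} (h : x ∈ decomposables F A m) :
    u * x ∈ decomposables F A m := by
  refine Submodule.span_induction (p := fun x _ => u * x ∈ decomposables F A m) ?_ (by simp)
    (fun x y _ _ hx hy => by rw [mul_add]; exact add_mem hx hy)
    (fun a x _ hx => by rw [mul_smul_comm]; exact Submodule.smul_mem _ _ hx) h
  rintro _ ⟨i, j, x, y, hi, hj, hm, hx, hy, rfl⟩
  rw [← mul_assoc]
  have := MemCommutatorFiltration.mul (.zero_index u) hx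
  rw [zero_add] at this
  exact mul_mem_decomposables hi hj hm this hy

theorem mul_right_mem_decomposables {m : ℕ} (u : A) {x : A} (h : x ∈ decomposables F A m) :
    x * u ∈ decomposables F A m := by
  refine Submodule.span_induction (p := fun x _ => x * u ∈ decomposables F A m) ?_ (by simp)
    (fun x y _ _ hx hy => by rw [add_mul]; exact add_mem hx hy)
    (fun a x _ hx => by rw [smul_mul_assoc]; exact Submodule.smul_mem _ _ hx) h
  rintro _ ⟨i, j, x, y, hi, hj, hm, hx, hy, rfl⟩
  rw [mul_assoc]
  exact mul_mem_decomposables hi hj hm hx (.mul hy (.zero_index u))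

theorem commutator_mem_decomposables {m : ℕ} (u : A) {x : A} (h : x ∈ decomposables F A m) :
    x * u - u * x ∈ decomposables F A (m + 1) := by
  refine Submodule.span_induction (p := fun x _ => x * u - u * x ∈ decomposables F A (m + 1)) ?_
    (by simp)
    (fun x y _ _ hx hy => by
      rw [add_mul, mul_add, add_sub_add_comm]; exact add_mem hx hy)
    (fun a x _ hx => by
      rw [smul_mul_assoc, mul_smul_comm, ← smul_sub]; exact Submodule.smul_mem _ _ hx) h
  rintro _ ⟨i, j, x, y, hi, hj, hm, hx, hy, rfl⟩
  have h1 : x * y * u - u * (x * y) = (x * u - u * x) * y + x * (y * u - u * y) := by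
    noncomm_ring
  rw [h1]
  exact add_mem (mul_mem_decomposables (by omega) hj (by omega) (.commutator u hx) hy)
    (mul_mem_decomposables hi (by omega) (by omega) hx (.commutator u hy))

end CommutatorFiltration

/-! ### The commutator filtration of `u(L)` against the lower central series. -/

section LowerCentral

open LieModule

variable (p : ℕ) {F L : Type*} [Field F] [LieRing L] [LieAlgebra F L] [RestrictedLieAlgebra p F L]

/-- The ideal of `u(L)` generated by an ideal of `L`. -/
def idealSpan (N : LieIdeal F L) : Submodule F (RestrictedEnvelopingAlgebra p F L) :=
  Submodule.span F {z | ∃ g ∈ N, ∃ v, ι p F L g * v = z}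

variable {p}

theorem ι_mul_mem_idealSpan {N : LieIdeal F L} {g : L} (hg : g ∈ N)
    (v : RestrictedEnvelopingAlgebra p F L) : ι p F L g * v ∈ idealSpan p N :=
  Submodule.subset_span ⟨g, hg, v, rfl⟩

theorem mul_right_mem_idealSpan {N : LieIdeal F L} (u : RestrictedEnvelopingAlgebra p F L)
    {x : RestrictedEnvelopingAlgebra p F L} (h : x ∈ idealSpan p N) :
    x * u ∈ idealSpan p N := by
  refine Submodule.span_induction (p := fun x _ => x * u ∈ idealSpan p N) ?_ (by simp)
    (fun x y _ _ hx hy => by rw [add_mul]; exact add_mem hx hy)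
    (fun a x _ hx => by rw [smul_mul_assoc]; exact Submodule.smul_mem _ _ hx) h
  rintro _ ⟨g, hg, v, rfl⟩
  rw [mul_assoc]
  exact ι_mul_mem_idealSpan hg _

theorem mul_left_mem_idealSpan {N : LieIdeal F L} (u : RestrictedEnvelopingAlgebra p F L) :
    ∀ {x : RestrictedEnvelopingAlgebra p F L}, x ∈ idealSpan p N →
      u * x ∈ idealSpan p N := by
  have key : ∀ (y : L) (x : RestrictedEnvelopingAlgebra p F L), x ∈ idealSpan p N →
      ι p F L y * x ∈ idealSpan p N := by
    intro y x h
    refine Submodule.span_induction (p := fun x _ => ι p F L y * x ∈ idealSpan p N) ?_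
      (by simp) (fun x y _ _ hx hy => by rw [mul_add]; exact add_mem hx hy)
      (fun a x _ hx => by rw [mul_smul_comm]; exact Submodule.smul_mem _ _ hx) h
    rintro _ ⟨g, hg, v, rfl⟩
    have h1 : ι p F L y * (ι p F L g * v) =
        ι p F L g * (ι p F L y * v) + ι p F L ⁅y, g⁆ * v := by
      rw [ι_lie]; noncomm_ring
    rw [h1]
    exact add_mem (ι_mul_mem_idealSpan hg _)
      (ι_mul_mem_idealSpan (LieSubmodule.lie_mem _ hg) _)
  intro x
  refine induction (P := fun u => ∀ x : RestrictedEnvelopingAlgebra p F L,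
    x ∈ idealSpan p N → u * x ∈ idealSpan p N) ?_ ?_ ?_ ?_ u x
  · exact fun y x hx => key y x hx
  · intro a x hx
    rw [← Algebra.smul_def]
    exact Submodule.smul_mem _ _ hx
  · intro u v hu hv x hx
    rw [add_mul]
    exact add_mem (hu x hx) (hv x hx)
  · intro u v hu hv x hx
    rw [mul_assoc]
    exact hu _ (hv x hx)

/-- The commutator with `g` is a derivation of `u(L)`, so it suffices to test it on `L`, where it is
a bracket in `N'`. -/
theorem ι_commutator_mem_idealSpan {N N' : LieIdeal F L}
    (hN : ∀ (x : L), ∀ y ∈ N, ⁅x, y⁆ ∈ N') {g : L} (hg : g ∈ N)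
    (y : RestrictedEnvelopingAlgebra p F L) :
    ι p F L g * y - y * ι p F L g ∈ idealSpan p N' := by
  refine induction (P := fun y => ι p F L g * y - y * ι p F L g ∈
    idealSpan p N') ?_ ?_ ?_ ?_ y
  · intro x
    rw [← ι_lie, ← mul_one (ι p F L ⁅g, x⁆)]
    refine ι_mul_mem_idealSpan ?_ 1
    rw [← lie_skew]
    exact neg_mem (hN x g hg)
  · intro a
    rw [Algebra.commutes, sub_self]
    exact zero_mem _
  · intro u v hu hv
    rw [mul_add, add_mul, add_sub_add_comm]
    exact add_mem hu hv
  · intro u v hu hv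
    have h1 : ι p F L g * (u * v) - u * v * ι p F L g =
        (ι p F L g * u - u * ι p F L g) * v + u * (ι p F L g * v - v * ι p F L g) := by
      noncomm_ring
    rw [h1]
    exact add_mem (mul_right_mem_idealSpan v hu) (mul_left_mem_idealSpan u hv)

theorem commutator_mem_idealSpan {N : LieIdeal F L} (hN : ∀ x y : L, ⁅x, y⁆ ∈ N)
    (x y : RestrictedEnvelopingAlgebra p F L) :
    x * y - y * x ∈ idealSpan p N := by
  refine induction (P := fun x => x * y - y * x ∈ idealSpan p N) ?_ ?_ ?_ ?_ x
  · exact fun g => ι_commutator_mem_idealSpan (N := ⊤) (fun x y _ => hN x y)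
      (LieSubmodule.mem_top g) y
  · intro a
    rw [Algebra.commutes, sub_self]
    exact zero_mem _
  · intro u v hu hv
    rw [mul_add, add_mul, add_sub_add_comm]
    exact add_mem hu hv
  · intro u v hu hv
    have h1 : u * v * y - y * (u * v) = u * (v * y - y * v) + (u * y - y * u) * v := by
      noncomm_ring
    rw [h1]
    exact add_mem (mul_left_mem_idealSpan u hv) (mul_right_mem_idealSpan v hu)

theorem memCommutatorFiltration_ι (m : ℕ) : ∀ g ∈ lowerCentralSeries F L L m,
    MemCommutatorFiltration F m (ι p F L g) := by
  induction m with
  | zero => exact fun g _ => .zero_index _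
  | succ m ih =>
    intro g hg
    let S : Submodule F L :=
      { carrier := {g | MemCommutatorFiltration F (m + 1) (ι p F L g)}
        add_mem' := fun {x y} hx hy => by
          change MemCommutatorFiltration F (m + 1) (ι p F L (x + y))
          rw [map_add]
          exact .add hx hy
        zero_mem' := by
          change MemCommutatorFiltration F (m + 1) (ι p F L 0)
          rw [map_zero]
          exact .zero _
        smul_mem' := fun a x hx => by
          change MemCommutatorFiltration F (m + 1) (ι p F L (a • x))
          rw [map_smul]
          exact .smul a hx }
    refine lowerCentralSeries_succ_le F (S := S) (fun x y hy => ?_) hg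
    change MemCommutatorFiltration F (m + 1) (ι p F L ⁅x, y⁆)
    rw [← lie_skew, map_neg, ι_lie, ← neg_one_smul F]
    exact .smul _ (.commutator _ (ih y hy))

/-- Both summands are two-sided ideals, and commutators move each into the corresponding sum for `m
+ 1`. Commutators of arbitrary elements give degree `1`, which lies in `[L, L] u(L)`. -/
theorem MemCommutatorFiltration.mem_sup {m : ℕ} {x : RestrictedEnvelopingAlgebra p F L}
    (h : MemCommutatorFiltration F m x) (hm : 1 ≤ m) :
    x ∈ idealSpan p (lowerCentralSeries F L L m) ⊔ decomposables F _ m := by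
  induction h with
  | zero_index x => omega
  | @mul i j x y hx hy ihx ihy =>
    rcases Nat.eq_zero_or_pos i with rfl | hi
    · rw [zero_add] at hm ⊢
      obtain ⟨a, ha, c, hc, rfl⟩ := Submodule.mem_sup.1 (ihy hm)
      rw [mul_add]
      exact add_mem (Submodule.mem_sup_left (mul_left_mem_idealSpan x ha))
        (Submodule.mem_sup_right (mul_left_mem_decomposables x hc))
    · rcases Nat.eq_zero_or_pos j with rfl | hj
      · rw [add_zero] at hm ⊢
        obtain ⟨a, ha, c, hc, rfl⟩ := Submodule.mem_sup.1 (ihx hm)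
        rw [add_mul]
        exact add_mem (Submodule.mem_sup_left (mul_right_mem_idealSpan y ha))
          (Submodule.mem_sup_right (mul_right_mem_decomposables y hc))
      · exact Submodule.mem_sup_right (mul_mem_decomposables hi hj rfl hx hy)
  | @commutator i x y hx ihx =>
    rcases Nat.eq_zero_or_pos i with rfl | hi
    · exact Submodule.mem_sup_left (commutator_mem_idealSpan
        (fun x y => lie_mem_lowerCentralSeries_succ F x (LieSubmodule.mem_top y)) x y)
    · obtain ⟨a, ha, c, hc, rfl⟩ := Submodule.mem_sup.1 (ihx hi)
      have h1 : (a + c) * y - y * (a + c) = (a * y - y * a) + (c * y - y * c) := by noncomm_ring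
      rw [h1]
      refine add_mem ?_ (Submodule.mem_sup_right (commutator_mem_decomposables y hc))
      refine Submodule.span_induction (p := fun a _ => a * y - y * a ∈
        idealSpan p (lowerCentralSeries F L L (i + 1)) ⊔ decomposables F _ (i + 1)) ?_ (by simp)
        (fun x z _ _ hx hz => by rw [add_mul, mul_add, add_sub_add_comm]; exact add_mem hx hz)
        (fun a x _ hx => by
          rw [smul_mul_assoc, mul_smul_comm, ← smul_sub]; exact Submodule.smul_mem _ _ hx) ha
      rintro _ ⟨g, hg, v, rfl⟩
      -- By the Leibniz rule the first term is in the ideal generated by the next step of the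
      -- series; the second is a product of degrees `i` and `1`, hence decomposable.
      have h2 : ι p F L g * v * y - y * (ι p F L g * v) =
          (ι p F L g * y - y * ι p F L g) * v + ι p F L g * (v * y - y * v) := by noncomm_ring
      rw [h2]
      exact add_mem (Submodule.mem_sup_left
        (mul_right_mem_idealSpan v (ι_commutator_mem_idealSpan (lie_mem_lowerCentralSeries_succ F) hg y)))
        (Submodule.mem_sup_right (mul_mem_decomposables hi le_rfl rfl
          (memCommutatorFiltration_ι i g hg) (.commutator y (.zero_index v))))
  | zero i => exact zero_mem _
  | add _ _ hx hy => exact add_mem (hx hm) (hy hm)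
  | smul a _ hx => exact Submodule.smul_mem _ _ (hx hm)

theorem MemCommutatorFiltration.mem_decomposables {m : ℕ} {x : RestrictedEnvelopingAlgebra p F L}
    (h : MemCommutatorFiltration F m x) (hm : 1 ≤ m) (hL : lowerCentralSeries F L L m = ⊥) :
    x ∈ decomposables F (RestrictedEnvelopingAlgebra p F L) m := by
  have h1 : idealSpan p (lowerCentralSeries F L L m) = ⊥ := by
    rw [idealSpan, Submodule.span_eq_bot]
    rintro _ ⟨g, hg, v, rfl⟩
    rw [hL, LieSubmodule.mem_bot] at hg
    rw [hg, map_zero, zero_mul]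
  have := h.mem_sup hm
  rwa [h1, bot_sup_eq] at this

variable (F L) in
/-- The elements of `L` whose adjoint action lowers by `m` steps in the lower central series. -/
def adFiltration (m : ℕ) : Submodule F L where
  carrier := {x | ∀ k, ∀ y ∈ lowerCentralSeries F L L k, ⁅x, y⁆ ∈ lowerCentralSeries F L L (k + m)}
  add_mem' := fun {x x'} hx hx' k y hy => by
    rw [add_lie]
    exact add_mem (hx k y hy) (hx' k y hy)
  zero_mem' := fun k y _ => by
    rw [zero_lie]
    exact zero_mem _
  smul_mem' := fun a x hx k y hy => by
    rw [smul_lie]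
    exact (lowerCentralSeries F L L (k + m)).smul_mem a (hx k y hy)

variable (p F L) in
-- Brackets follow from the Jacobi identity and `[p]`-powers from `ad (x ^ [p]) = (ad x) ^ p`, which
-- shifts the series `p` times.
theorem isRestrictedFiltration_adFiltration : IsRestrictedFiltration p F (adFiltration F L) where
  antitone := fun i j hij x hx k y hy =>
    antitone_lowerCentralSeries F L L (Nat.add_le_add_left hij k) (hx k y hy)
  one := eq_top_iff.2 fun x _ _ _ hy => lie_mem_lowerCentralSeries_succ F x hy
  lie_mem := by
    intro i j x y _ _ hx hy k z hz
    rw [lie_lie]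
    refine sub_mem ?_ ?_
    · have := hx _ _ (hy k z hz)
      rwa [add_assoc, add_comm j] at this
    · have := hy _ _ (hx k z hz)
      rwa [add_assoc] at this
  pmap_mem := by
    intro i x _ hx k y hy
    have h1 : ∀ n, ((LieAlgebra.ad F L x : Module.End F L) ^ n) y ∈
        lowerCentralSeries F L L (k + n * i) := by
      intro n
      induction n with
      | zero => simpa using hy
      | succ n ih =>
        rw [pow_succ', Module.End.mul_apply, LieAlgebra.ad_apply]
        have := hx _ _ ih
        rwa [add_assoc, ← Nat.succ_mul] at this
    have h2 := h1 p
    rwa [← ad_pmap] at h2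

/-- By the Leibniz rule a commutator with `z ∈ L = R 1` hits one factor at a time and raises its
weight by one. -/
theorem commutator_mem_productSpan {R : ℕ → Submodule F L} (hR : IsRestrictedFiltration p F R)
    {n : ℕ} {x : RestrictedEnvelopingAlgebra p F L} (hx : x ∈ productSpan p R n)
    (y : RestrictedEnvelopingAlgebra p F L) : x * y - y * x ∈ productSpan p R (n + 1) := by
  have h0 : ∀ u, u ∈ productSpan p R 0 := fun u => by
    rw [productSpan_zero_eq_top hR]; exact Submodule.mem_top
  refine induction (P := fun y => x * y - y * x ∈ productSpan p R (n + 1)) ?_ ?_ ?_ ?_ y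
  · intro z
    refine Submodule.span_induction (p := fun x _ => x * ι p F L z - ι p F L z * x ∈
      productSpan p R (n + 1)) ?_ (by simp)
      (fun x z _ _ hx hz => by rw [add_mul, mul_add, add_sub_add_comm]; exact add_mem hx hz)
      (fun a x _ hx => by
        rw [smul_mul_assoc, mul_smul_comm, ← smul_sub]; exact Submodule.smul_mem _ _ hx) hx
    rintro _ ⟨l, h1, h2, rfl⟩
    refine productSpan_antitone (Nat.succ_le_succ h2) ?_
    clear h2
    induction l with
    | nil => simp
    | cons a l ih =>
      have h3 := ih fun a ha => h1 a (List.mem_cons_of_mem _ ha)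
      have h4 : (l.map fun a => ι p F L a.2).prod ∈ productSpan p R (l.map Prod.fst).sum :=
        Submodule.subset_span ⟨l, fun a ha => h1 a (List.mem_cons_of_mem _ ha), le_rfl, rfl⟩
      have h5 : ι p F L a.2 * (l.map fun a => ι p F L a.2).prod * ι p F L z -
          ι p F L z * (ι p F L a.2 * (l.map fun a => ι p F L a.2).prod) =
          ι p F L ⁅a.2, z⁆ * (l.map fun a => ι p F L a.2).prod + ι p F L a.2 *
          ((l.map fun a => ι p F L a.2).prod * ι p F L z -
            ι p F L z * (l.map fun a => ι p F L a.2).prod) := by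
        rw [ι_lie]
        noncomm_ring
      have h6 : ⁅a.2, z⁆ ∈ R (a.1 + 1) := by
        have hz : z ∈ R 1 := by rw [hR.one]; exact Submodule.mem_top
        rcases Nat.eq_zero_or_pos a.1 with h | h
        · rw [h, zero_add, hR.one]
          exact Submodule.mem_top
        · exact hR.lie_mem h le_rfl (h1 a (by simp)) hz
      simp only [List.map_cons, List.prod_cons, List.sum_cons]
      rw [h5]
      refine add_mem ?_ ?_
      · have := mul_mem_productSpan (ι_mem_productSpan (p := p) h6) h4
        rwa [add_right_comm] at this
      · have := mul_mem_productSpan (ι_mem_productSpan (p := p) (h1 a (by simp))) h3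
        exact this
  · intro a
    rw [Algebra.commutes, sub_self]
    exact zero_mem _
  · intro u v hu hv
    rw [mul_add, add_mul, add_sub_add_comm]
    exact add_mem hu hv
  · intro u v hu hv
    have h1 : x * (u * v) - u * v * x = (x * u - u * x) * v + u * (x * v - v * x) := by
      noncomm_ring
    rw [h1]
    refine add_mem ?_ ?_
    · have := mul_mem_productSpan hu (h0 v)
      rwa [add_zero] at this
    · have := mul_mem_productSpan (h0 u) hv
      rwa [zero_add] at this

theorem commutator_mem_productSpan_two {R : ℕ → Submodule F L} (hR : IsRestrictedFiltration p F R)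
    (x y : RestrictedEnvelopingAlgebra p F L) : x * y - y * x ∈ productSpan p R 2 := by
  have h0 : ∀ u, u ∈ productSpan p R 0 := fun u => by
    rw [productSpan_zero_eq_top hR]; exact Submodule.mem_top
  refine induction (P := fun x => x * y - y * x ∈ productSpan p R 2) ?_ ?_ ?_ ?_ x
  · intro z
    exact commutator_mem_productSpan hR (n := 1)
      (ι_mem_productSpan (by rw [hR.one]; exact Submodule.mem_top)) y
  · intro a
    rw [Algebra.commutes, sub_self]
    exact zero_mem _
  · intro u v hu hv
    rw [mul_add, add_mul, add_sub_add_comm]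
    exact add_mem hu hv
  · intro u v hu hv
    have h1 : u * v * y - y * (u * v) = u * (v * y - y * v) + (u * y - y * u) * v := by
      noncomm_ring
    rw [h1]
    refine Submodule.add_mem _ ?_ ?_
    · have := mul_mem_productSpan (h0 u) hv
      rwa [zero_add] at this
    · have := mul_mem_productSpan hu (h0 v)
      rwa [add_zero] at this

/-- The gain of one over `m` comes from degree `1`, where commutators already have weight `2`; it is
kept by further commutators and doubled in products of two positive degrees. -/
theorem MemCommutatorFiltration.mem_productSpan {R : ℕ → Submodule F L}
    (hR : IsRestrictedFiltration p F R) {m : ℕ} {x : RestrictedEnvelopingAlgebra p F L}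
    (h : MemCommutatorFiltration F m x) (hm : 1 ≤ m) : x ∈ productSpan p R (m + 1) := by
  have h0 : ∀ u, u ∈ productSpan p R 0 := fun u => by
    rw [productSpan_zero_eq_top hR]; exact Submodule.mem_top
  induction h with
  | zero_index x => omega
  | @mul i j x y _ _ ihx ihy =>
    rcases Nat.eq_zero_or_pos i with rfl | hi
    · rw [zero_add] at hm ⊢
      have := mul_mem_productSpan (h0 x) (ihy hm)
      rwa [zero_add] at this
    · rcases Nat.eq_zero_or_pos j with rfl | hj
      · have := mul_mem_productSpan (ihx hi) (h0 y)
        rw [add_zero] at this ⊢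
        exact this
      · exact productSpan_antitone (by omega) (mul_mem_productSpan (ihx hi) (ihy hj))
  | @commutator i x y _ ihx =>
    rcases Nat.eq_zero_or_pos i with rfl | hi
    · exact commutator_mem_productSpan_two hR x y
    · exact commutator_mem_productSpan hR (ihx hi) y
  | zero i => exact zero_mem _
  | add _ _ hx hy => exact add_mem (hx hm) (hy hm)
  | smul a _ hx => exact Submodule.smul_mem _ _ (hx hm)

theorem decomposables_le_productSpan {R : ℕ → Submodule F L} (hR : IsRestrictedFiltration p F R)
    (m : ℕ) : decomposables F (RestrictedEnvelopingAlgebra p F L) m ≤ productSpan p R (m + 2) := by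
  refine Submodule.span_le.2 ?_
  rintro _ ⟨i, j, x, y, hi, hj, rfl, hx, hy, rfl⟩
  exact productSpan_antitone (by omega)
    (mul_mem_productSpan (hx.mem_productSpan hR hi) (hy.mem_productSpan hR hj))

variable [Fact p.Prime] [CharP F p] {H : Type*} [LieRing H] [LieAlgebra F H]
  [RestrictedLieAlgebra p F H]

/-- With `γ_{c+1}(L) = 0`, every element of commutator degree `c` in `u(L)` is decomposable, and
this transfers to `u(H)`. So `y ∈ γ_{c+1}(H)` has weight at least `c + 2` for `adFiltration`, that
is, `[y, H] ⊆ γ_{c+3}(H)`. -/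
theorem lowerCentralSeries_le_succ_succ_of_algEquiv
    (e : RestrictedEnvelopingAlgebra p F L ≃ₐ[F] RestrictedEnvelopingAlgebra p F H) {c : ℕ}
    (hc : 1 ≤ c) (hL : lowerCentralSeries F L L c = ⊥) :
    lowerCentralSeries F H H (c + 1) ≤ lowerCentralSeries F H H (c + 2) := by
  intro z hz
  rw [← LieSubmodule.mem_toSubmodule]
  refine lowerCentralSeries_succ_le F (fun x y hy => ?_) hz
  have h1 := ((memCommutatorFiltration_ι (p := p) c y hy).map e.symm).mem_decomposables hc hL
  have h2 := map_mem_decomposables e h1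
  rw [AlgEquiv.apply_symm_apply] at h2
  have hR := isRestrictedFiltration_adFiltration p F H
  have h3 : y ∈ adFiltration F H (c + 2) :=
    mem_of_ι_mem_productSpan hR (decomposables_le_productSpan hR c h2)
  have h4 := h3 0 x (LieSubmodule.mem_top x)
  rw [zero_add] at h4
  rw [LieSubmodule.mem_toSubmodule, ← lie_skew]
  exact neg_mem h4

/-- There are no decomposables of degree `1`, since `1` is not a sum of two positive integers. -/
theorem lowerCentralSeries_one_eq_bot_of_algEquiv
    (e : RestrictedEnvelopingAlgebra p F L ≃ₐ[F] RestrictedEnvelopingAlgebra p F H)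
    (hL : lowerCentralSeries F L L 1 = ⊥) : lowerCentralSeries F H H 1 = ⊥ := by
  refine eq_bot_iff.2 fun y hy => ?_
  have h1 := ((memCommutatorFiltration_ι (p := p) 1 y hy).map e.symm).mem_decomposables le_rfl hL
  have h2 : decomposables F (RestrictedEnvelopingAlgebra p F L) 1 = ⊥ := by
    rw [decomposables, Submodule.span_eq_bot]
    rintro _ ⟨i, j, x, y, hi, hj, hij, -⟩
    omega
  rw [h2, Submodule.mem_bot] at h1
  have h3 : ι p F H y = 0 := e.symm.injective (h1.trans (map_zero e.symm).symm)
  exact (LieSubmodule.mem_bot _).2 (ι_injective p F H (h3.trans (map_zero _).symm))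

/-- The nilpotency class of `H` exceeds that of `L` by at most one. -/
theorem nilpotencyLength_le_succ_of_algEquiv [LieRing.IsNilpotent L] [LieRing.IsNilpotent H]
    (e : RestrictedEnvelopingAlgebra p F L ≃ₐ[F] RestrictedEnvelopingAlgebra p F H) :
    nilpotencyLength H H ≤ nilpotencyLength L L + 1 := by
  have hL := (lowerCentralSeries_eq_bot_iff_nilpotencyLength_le F (L := L) (M := L) _).2 le_rfl
  rw [← lowerCentralSeries_eq_bot_iff_nilpotencyLength_le F]
  rcases Nat.eq_zero_or_pos (nilpotencyLength L L) with h | h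
  -- The general argument needs `c ≥ 1`. If `L` has class `0` it is abelian, hence so is `H`.
  · rw [h] at hL ⊢
    refine lowerCentralSeries_one_eq_bot_of_algEquiv e (eq_bot_iff.2 ?_)
    exact hL ▸ antitone_lowerCentralSeries F L L (Nat.zero_le 1)
  · exact lowerCentralSeries_eq_bot_of_le_succ F
      (lowerCentralSeries_le_succ_succ_of_algEquiv e h hL)

end LowerCentral

end

noncomputable section

open Finsupp RestrictedLieAlgebra RestrictedEnvelopingAlgebra

attribute [local instance 100] LieRing.ofAssociativeRing

/-! ### The dimensions of the powers of the augmentation ideal -/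

section Counting

open PBW

theorem PBW.isTruncated_map_iff {p : ℕ} (hp : p ≠ 0) {I I' : Type*} {f : I → I'}
    (hf : Function.Injective f) {m : Multiset I} : IsTruncated p (m.map f) ↔ IsTruncated p m := by
  constructor
  · intro h i hi
    refine h (f i) ?_
    rw [← Multiset.map_replicate]
    exact Multiset.map_le_map hi
  · intro h j hj
    obtain ⟨i, -, rfl⟩ := Multiset.mem_map.1
      (Multiset.mem_of_le hj (Multiset.mem_replicate.2 ⟨hp, rfl⟩))
    rw [← Multiset.map_replicate, Multiset.map_le_map_iff hf] at hj
    exact h i hj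

/-- The truncated multisets of weight at most `n`. -/
def truncatedMultisets (p : ℕ) {I : Type*} (w : I → ℕ) (n : ℕ) : Set (Multiset I) :=
  {m | IsTruncated p m ∧ (m.map w).sum ≤ n}

variable {p : ℕ} {I I' : Type*}

theorem finite_truncatedMultisets [Finite I] (w : I → ℕ) (n : ℕ) :
    (truncatedMultisets p w n).Finite := by
  have := finite_isTruncated p I
  refine Set.Finite.subset (Set.finite_range
    (Subtype.val : {m : Multiset I // IsTruncated p m} → Multiset I)) ?_
  rintro m ⟨h, -⟩
  exact ⟨⟨m, h⟩, rfl⟩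

theorem map_mem_truncatedMultisets (hp : p ≠ 0) {f : I → I'} (hf : Function.Injective f)
    {w : I' → ℕ} {n : ℕ} {m : Multiset I} :
    m.map f ∈ truncatedMultisets p w n ↔ m ∈ truncatedMultisets p (w ∘ f) n := by
  simp only [truncatedMultisets, Set.mem_ofPred_eq, isTruncated_map_iff hp hf, Multiset.map_map]

theorem ncard_truncatedMultisets_le [Finite I'] (hp : p ≠ 0) (w : I' → ℕ) {f : I → I'}
    (hf : Function.Injective f) (n : ℕ) :
    (truncatedMultisets p (w ∘ f) n).ncard ≤ (truncatedMultisets p w n).ncard :=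
  Set.ncard_le_ncard_of_injOn (Multiset.map f)
    (fun _ hm => (map_mem_truncatedMultisets hp hf).2 hm)
    (Multiset.map_injective hf).injOn (finite_truncatedMultisets w n)

/-- All weights are positive, so in a multiset of weight at most `n` a letter of weight at least `n`
must stand alone and weigh exactly `n`. -/
theorem ncard_truncatedMultisets [Finite I] (hp : 2 ≤ p) {w : I → ℕ} (hw : ∀ i, 1 ≤ w i) (n : ℕ) :
    (truncatedMultisets p w n).ncard =
      (truncatedMultisets p (fun i : {i // w i < n} => w i) n).ncard + {i | w i = n}.ncard := by
  have hinj : Function.Injective (Multiset.map (Subtype.val : {i // w i < n} → I)) :=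
    Multiset.map_injective Subtype.val_injective
  have hsing : Function.Injective (fun i : I => ({i} : Multiset I)) :=
    fun _ _ h => Multiset.singleton_inj.1 h
  rw [← Set.ncard_image_of_injective _ hinj, ← Set.ncard_image_of_injective {i | w i = n} hsing,
    ← Set.ncard_union_eq ?_ ((finite_truncatedMultisets _ n).image _) ((Set.toFinite _).image _)]
  · congr 1
    ext m
    constructor
    · rintro ⟨h1, h2⟩
      by_cases h : ∀ i ∈ m, w i < n
      · obtain ⟨m, rfl⟩ : ∃ m' : Multiset {i // w i < n}, m'.map Subtype.val = m :=
          CanLift.prf m h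
        exact Or.inl ⟨m, (map_mem_truncatedMultisets (by omega) Subtype.val_injective).1 ⟨h1, h2⟩,
          rfl⟩
      · push Not at h
        obtain ⟨i, hi, hin⟩ := h
        obtain ⟨t, rfl⟩ := Multiset.exists_cons_of_mem hi
        rw [Multiset.map_cons, Multiset.sum_cons] at h2
        have h3 : t = 0 := by
          refine Multiset.eq_zero_of_forall_notMem fun j hj => ?_
          have := Multiset.single_le_sum (s := t.map w) (fun _ _ => Nat.zero_le _) _
            (Multiset.mem_map_of_mem w hj)
          have := hw j
          omega
        subst h3
        exact Or.inr ⟨i, by simp at h2; change w i = n; omega, rfl⟩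
    · rintro (⟨m, hm, rfl⟩ | ⟨i, hi, rfl⟩)
      · exact (map_mem_truncatedMultisets (by omega) Subtype.val_injective).2 hm
      · refine ⟨fun j hj => ?_, ?_⟩
        · have := Multiset.card_le_card hj
          simp at this
          omega
        · change w i = n at hi
          simp [hi]
  · rw [Set.disjoint_left]
    rintro _ ⟨m, -, rfl⟩ ⟨i, hi, h⟩
    change w i = n at hi
    have h1 : i ∈ Multiset.map Subtype.val m := h ▸ Multiset.mem_singleton_self i
    obtain ⟨j, -, rfl⟩ := Multiset.mem_map.1 h1
    exact j.2.ne hi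

/-- The number of truncated multisets of weight at most `n` in letters of weight less than `n`
depends only on the numbers of letters of each weight. -/
theorem ncard_truncatedMultisets_le_of_ncard_eq [Finite I] [Finite I'] (hp : p ≠ 0) {w : I → ℕ}
    {w' : I' → ℕ} {n : ℕ} (h : ∀ j < n, {i | w i = j}.ncard = {i | w' i = j}.ncard) :
    (truncatedMultisets p (fun i : {i // w i < n} => w i) n).ncard ≤
      (truncatedMultisets p (fun i : {i // w' i < n} => w' i) n).ncard := by
  -- Bijections weight by weight are glued to a weight-preserving injection `f` of the letters,
  -- which induces one of multisets.
  let e : ∀ j : ℕ, j < n → ({i // w i = j} ≃ {i // w' i = j}) := fun j hj =>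
    Classical.choice (Finite.card_eq.1 (h j hj))
  let f : {i // w i < n} → {i // w' i < n} := fun i =>
    ⟨(e (w i) i.2 ⟨i, rfl⟩ : I'), by rw [(e (w i) i.2 ⟨i, rfl⟩).2]; exact i.2⟩
  have hf : ∀ i, w' (f i) = w i := fun i => (e (w i) i.2 ⟨i, rfl⟩).2
  have hfe : ∀ (j : ℕ) (hj : j < n) (i : {i // w i < n}) (hi : w i = j),
      (f i : I') = e j hj ⟨i, hi⟩ := by
    rintro _ _ _ rfl
    rfl
  have hinj : Function.Injective f := by
    intro i i' hii
    have h2 : w i' = w i := by rw [← hf, ← hf, hii]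
    have h3 : e (w i) i.2 ⟨i, rfl⟩ = e (w i) i.2 ⟨i', h2⟩ := Subtype.ext
      ((hfe (w i) i.2 i rfl).symm.trans ((congrArg Subtype.val hii).trans (hfe (w i) i.2 i' h2)))
    exact Subtype.ext (Subtype.mk.inj ((e (w i) i.2).injective h3))
  have h4 := ncard_truncatedMultisets_le (p := p) hp (fun i : {i // w' i < n} => w' i) hinj n
  have h5 : (fun i : {i // w' i < n} => w' i) ∘ f = fun i : {i // w i < n} => w i := funext hf
  rwa [h5] at h4

end Counting

/-! ### Dimensions of the powers of the augmentation ideal and of the dimension quotients. -/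

section Dimensions

open PBW Module

theorem Module.Basis.finrank_span_image {F V J : Type*} [Field F] [AddCommGroup V] [Module F V]
    [Finite J] (b : Basis J F V) (S : Set J) :
    finrank F (Submodule.span F (b '' S)) = S.ncard := by
  classical
  have := Fintype.ofFinite J
  have h := finrank_span_eq_card (b.linearIndependent.comp (Subtype.val : S → J)
    Subtype.val_injective)
  rw [Set.range_comp, Subtype.range_coe] at h
  rw [h, ← Nat.card_eq_fintype_card, Nat.card_coe_set_eq]

theorem IsAdapted.finrank_eq {F V I : Type*} [Field F] [AddCommGroup V] [Module F V] [Finite I]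
    {R : ℕ → Submodule F V} {N : ℕ} {b : Basis I F V} {w : I → ℕ} (hR : Antitone R)
    (h : IsAdapted R N b w) {k : ℕ} (hk : k ≤ N) : finrank F (R k) = {i | k ≤ w i}.ncard := by
  have h1 : R k = Submodule.span F (b '' {i | k ≤ w i}) := by
    refine le_antisymm (fun x hx => ?_) (Submodule.span_le.2 ?_)
    · rw [Basis.mem_span_image]
      intro i hi
      have := h.2 k x hx i (Finsupp.mem_support_iff.1 hi)
      rwa [min_eq_left hk] at this
    · rintro _ ⟨i, hi, rfl⟩
      exact hR hi (h.1 i)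
  rw [h1, Basis.finrank_span_image]

variable {p : ℕ} [hp : Fact p.Prime] {F L : Type*} [Field F] [LieRing L]
  [LieAlgebra F L] [RestrictedLieAlgebra p F L]

theorem finrank_dimensionQuotient_add [FiniteDimensional F L] (n : ℕ) :
    finrank F (DimensionQuotient p F L n) +
      finrank F (dimensionSubalgebra p F L (n + 1) : Submodule F L) =
      finrank F (dimensionSubalgebra p F L n : Submodule F L) := by
  have h1 := Submodule.finrank_quotient_add_finrank
    (nextDimensionIdeal p F L n : Submodule F (dimensionSubalgebra p F L n))
  have hle : (dimensionSubalgebra p F L (n + 1) : Submodule F L) ≤ dimensionSubalgebra p F L n :=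
    (isRestrictedFiltration_dimensionSubalgebra p F L).antitone n.le_succ
  have h2 := (Submodule.comapSubtypeEquivOfLe hle).finrank_eq
  rw [← h2]
  exact h1

theorem orderedMonomial_mem_augmentationIdeal_pow {I : Type*} [LinearOrder I] {N : ℕ}
    {b : Basis I F L} {w : I → ℕ}
    (hb : IsAdapted (fun n => (dimensionSubalgebra p F L n : Submodule F L)) N b w)
    (m : Multiset I) : orderedMonomial p b m ∈ augmentationIdeal p F L ^ (m.map w).sum := by
  have key : ∀ l : List I, monomial p b l ∈ augmentationIdeal p F L ^ (l.map w).sum := by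
    intro l
    induction l with
    | nil =>
      rw [List.map_nil, List.sum_nil, Submodule.pow_zero, Ideal.one_eq_top]
      exact Submodule.mem_top
    | cons i l ih =>
      rw [monomial_cons, List.map_cons, List.sum_cons]
      exact Ideal.mul_mem_pow_add (hb.1 i) ih
  have h := key (m.sort (· ≤ ·))
  rwa [← Multiset.sum_coe, ← Multiset.map_coe, Multiset.sort_eq] at h

/-- Straightening gives one inclusion. For the other, a letter of weight `w i` lies in `ω ^ (w i)`.
-/
theorem augmentationIdeal_pow_eq_weightSpan {I : Type*} [LinearOrder I] {N : ℕ} {b : Basis I F L}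
    {w : I → ℕ} (hb : IsAdapted (fun n => (dimensionSubalgebra p F L n : Submodule F L)) N b w)
    {k : ℕ} (hN : 1 ≤ N) (hk : k ≤ N) :
    (augmentationIdeal p F L ^ k).restrictScalars F = weightSpan p b w N k := by
  have hR := isRestrictedFiltration_dimensionSubalgebra p F L
  refine le_antisymm (fun u hu => ?_) (Submodule.span_le.2 ?_)
  · exact productSpan_le_weightSpan hR hb hN k (augmentationIdeal_pow_le_productSpan hR k u hu)
  · rintro _ ⟨m, -, h, rfl⟩
    rw [min_eq_left hk] at h
    have h1 : Antitone fun n => augmentationIdeal p F L ^ n :=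
      antitone_nat_of_succ_le fun n => Ideal.pow_succ_le_pow n
    exact h1 h (orderedMonomial_mem_augmentationIdeal_pow hb m)

/-- `ω ^ (n + 1)` is spanned by the PBW monomials of weight above `n`; the remaining ones are
counted by `truncatedMultisets`. -/
theorem finrank_augmentationIdeal_pow_add [CharP F p] {I : Type*} [Finite I] [LinearOrder I] {n : ℕ}
    {b : Basis I F L} {w : I → ℕ}
    (hb : IsAdapted (fun n => (dimensionSubalgebra p F L n : Submodule F L)) (n + 1) b w) :
    finrank F ((augmentationIdeal p F L ^ (n + 1)).restrictScalars F) +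
      (truncatedMultisets p w n).ncard = finrank F (RestrictedEnvelopingAlgebra p F L) := by
  have := finite_isTruncated p I
  rw [augmentationIdeal_pow_eq_weightSpan hb (by omega) le_rfl, weightSpan_eq_span_image,
    Basis.finrank_span_image, finrank_eq_nat_card_basis (pbwBasis p b),
    ← Set.ncard_add_ncard_compl {m : {m : Multiset I // IsTruncated p m} |
      min (n + 1) (n + 1) ≤ ((m : Multiset I).map w).sum}]
  congr 1
  rw [← Set.ncard_image_of_injective _ Subtype.val_injective]
  congr 1
  ext m
  constructor
  · rintro ⟨h1, h2⟩
    exact ⟨⟨m, h1⟩, by simpa [Nat.lt_succ_iff] using h2, rfl⟩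
  · rintro ⟨⟨m, h1⟩, h2, rfl⟩
    exact ⟨h1, by simpa [Nat.lt_succ_iff] using h2⟩

theorem IsAdapted.finrank_dimensionQuotient {I : Type*} [Finite I] {N : ℕ}
    {b : Basis I F L} {w : I → ℕ}
    (hb : IsAdapted (fun n => (dimensionSubalgebra p F L n : Submodule F L)) N b w)
    {k : ℕ} (hk : k + 1 ≤ N) : finrank F (DimensionQuotient p F L k) = {i | w i = k}.ncard := by
  have := Module.Basis.finiteDimensional_of_finite b
  have hR := (isRestrictedFiltration_dimensionSubalgebra p F L).antitone
  have h1 := finrank_dimensionQuotient_add (p := p) (F := F) (L := L) k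
  have h2 := IsAdapted.finrank_eq hR hb hk
  have h3 := IsAdapted.finrank_eq hR hb (k.le_succ.trans hk)
  have h4 : {i | k ≤ w i} = {i | w i = k} ∪ {i | k + 1 ≤ w i} := by
    ext i
    simp only [Set.mem_ofPred_eq, Set.mem_union]
    omega
  rw [h4, Set.ncard_union_eq (by
    rw [Set.disjoint_left]
    intro i hi hi'
    simp only [Set.mem_ofPred_eq] at hi hi'
    omega)] at h3
  omega

variable {H : Type*} [LieRing H] [LieAlgebra F H] [RestrictedLieAlgebra p F H]

/-- The dimensions of the powers of the augmentation ideal determine those of the quotients of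
successive dimension subalgebras. -/
theorem finrank_dimensionQuotient_eq [CharP F p] [FiniteDimensional F L] [FiniteDimensional F H]
    (h : ∀ n, finrank F ((augmentationIdeal p F L ^ n).restrictScalars F) =
      finrank F ((augmentationIdeal p F H ^ n).restrictScalars F)) (n : ℕ) (hn : 1 ≤ n) :
    finrank F (DimensionQuotient p F L n) = finrank F (DimensionQuotient p F H n) := by
  induction n using Nat.strong_induction_on with
  | _ n ih =>
  have hL := isRestrictedFiltration_dimensionSubalgebra p F L
  have hH := isRestrictedFiltration_dimensionSubalgebra p F H
  obtain ⟨B, b, w, hb⟩ := exists_isAdapted _ hL.antitone hL.zero (n + 1)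
  obtain ⟨B', b', w', hb'⟩ := exists_isAdapted _ hH.antitone hH.zero (n + 1)
  classical
  let _ : LinearOrder B := linearOrderOfSTO WellOrderingRel
  let _ : LinearOrder B' := linearOrderOfSTO WellOrderingRel
  have : Finite B := Module.Finite.finite_basis b
  have : Finite B' := Module.Finite.finite_basis b'
  have hw := hb.one_le hL (by omega)
  have hw' := hb'.one_le hH (by omega)
  have h1 := finrank_augmentationIdeal_pow_add hb
  have h2 := finrank_augmentationIdeal_pow_add hb'
  have h0 := h 0
  rw [Submodule.pow_zero, Submodule.pow_zero, Ideal.one_eq_top, Ideal.one_eq_top,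
    Submodule.restrictScalars_top, Submodule.restrictScalars_top, finrank_top, finrank_top] at h0
  rw [ncard_truncatedMultisets hp.out.two_le hw] at h1
  rw [ncard_truncatedMultisets hp.out.two_le hw'] at h2
  -- By induction the letters of weight below `n` match, so the two counts can differ only in the
  -- letters of weight `n`; equal dimensions of `ω ^ (n + 1)` force these to match too.
  have h3 : ∀ j < n, {i | w i = j}.ncard = {i | w' i = j}.ncard := by
    intro j hj
    rcases Nat.eq_zero_or_pos j with rfl | hj0
    · have e1 : {i | w i = 0} = ∅ := Set.eq_empty_of_forall_notMem fun i hi =>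
        (Nat.pos_iff_ne_zero.1 (hw i)) hi
      have e2 : {i | w' i = 0} = ∅ := Set.eq_empty_of_forall_notMem fun i hi =>
        (Nat.pos_iff_ne_zero.1 (hw' i)) hi
      rw [e1, e2, Set.ncard_empty, Set.ncard_empty]
    · rw [← hb.finrank_dimensionQuotient (by omega), ← hb'.finrank_dimensionQuotient (by omega)]
      exact ih j hj hj0
  have h4 := ncard_truncatedMultisets_le_of_ncard_eq hp.out.ne_zero h3
  have h5 := ncard_truncatedMultisets_le_of_ncard_eq hp.out.ne_zero fun j hj => (h3 j hj).symm
  have h6 := h (n + 1)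
  rw [hb.finrank_dimensionQuotient le_rfl, hb'.finrank_dimensionQuotient le_rfl]
  omega

end Dimensions

end

noncomputable section

open Finsupp RestrictedLieAlgebra RestrictedEnvelopingAlgebra

attribute [local instance 100] LieRing.ofAssociativeRing

/-! ### Freeness over the restricted enveloping algebra of a subalgebra -/

section LexMultisets

open PBW

variable {I J : Type*}

/-- In the lexicographic sum the letters of `I` come first, so an ordered monomial factors as one in
`I` times one in `J`. -/
theorem sort_map_inl_add_map_inr [LinearOrder I] [LinearOrder J] (m : Multiset I)
    (m' : Multiset J) : (m.map Sum.inlₗ + m'.map Sum.inrₗ).sort (· ≤ ·) =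
      (m.sort (· ≤ ·)).map Sum.inlₗ ++ (m'.sort (· ≤ ·)).map Sum.inrₗ := by
  refine List.Perm.eq_of_pairwise' (r := (· ≤ ·)) (Multiset.pairwise_sort _ _) ?_ ?_
  · rw [List.pairwise_append]
    refine ⟨?_, ?_, ?_⟩
    · rw [List.pairwise_map]
      exact (Multiset.pairwise_sort m (· ≤ ·)).imp Sum.Lex.inl_le_inl_iff.2
    · rw [List.pairwise_map]
      exact (Multiset.pairwise_sort m' (· ≤ ·)).imp Sum.Lex.inr_le_inr_iff.2
    · intro a ha b hb
      obtain ⟨i, -, rfl⟩ := List.mem_map.1 ha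
      obtain ⟨j, -, rfl⟩ := List.mem_map.1 hb
      exact Sum.Lex.inl_le_inr i j
  · rw [← Multiset.coe_eq_coe, Multiset.sort_eq, ← Multiset.coe_add, ← Multiset.map_coe,
      ← Multiset.map_coe, Multiset.sort_eq, Multiset.sort_eq]

theorem inlₗ_injective : Function.Injective (Sum.inlₗ : I → I ⊕ₗ J) :=
  toLex.injective.comp Sum.inl_injective

theorem inrₗ_injective : Function.Injective (Sum.inrₗ : J → I ⊕ₗ J) :=
  toLex.injective.comp Sum.inr_injective

theorem inlₗ_ne_inrₗ (i : I) (j : J) : (Sum.inlₗ i : I ⊕ₗ J) ≠ Sum.inrₗ j := fun h =>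
  Sum.inl_ne_inr (toLex.injective h)

theorem count_inlₗ [DecidableEq I] [DecidableEq (I ⊕ₗ J)] (m : Multiset I) (m' : Multiset J)
    (i : I) : (m.map Sum.inlₗ + m'.map Sum.inrₗ).count (Sum.inlₗ i : I ⊕ₗ J) = m.count i := by
  rw [Multiset.count_add, Multiset.count_map_eq_count' _ _ inlₗ_injective, Nat.add_eq_left,
    Multiset.count_eq_zero]
  intro h
  obtain ⟨j, -, hj⟩ := Multiset.mem_map.1 h
  exact inlₗ_ne_inrₗ i j hj.symm

theorem count_inrₗ [DecidableEq J] [DecidableEq (I ⊕ₗ J)] (m : Multiset I) (m' : Multiset J)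
    (j : J) : (m.map Sum.inlₗ + m'.map Sum.inrₗ).count (Sum.inrₗ j : I ⊕ₗ J) = m'.count j := by
  rw [Multiset.count_add, Multiset.count_map_eq_count' _ _ inrₗ_injective,
    Multiset.count_eq_zero_of_notMem, zero_add]
  intro h
  obtain ⟨i, -, hi⟩ := Multiset.mem_map.1 h
  exact inlₗ_ne_inrₗ i j hi

theorem exists_eq_map_inlₗ_add_map_inrₗ (n : Multiset (I ⊕ₗ J)) :
    ∃ (m : Multiset I) (m' : Multiset J), n = m.map Sum.inlₗ + m'.map Sum.inrₗ := by
  induction n using Multiset.induction with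
  | empty => exact ⟨0, 0, by simp⟩
  | cons a n ih =>
    obtain ⟨m, m', rfl⟩ := ih
    rcases a with i | j
    · exact ⟨i ::ₘ m, m', by rw [Multiset.map_cons, Multiset.cons_add]; rfl⟩
    · exact ⟨m, j ::ₘ m', by rw [Multiset.map_cons, Multiset.add_cons]; rfl⟩

theorem isTruncated_map_inlₗ_add_map_inrₗ_iff {p : ℕ} {m : Multiset I} {m' : Multiset J} :
    IsTruncated p (m.map Sum.inlₗ + m'.map Sum.inrₗ : Multiset (I ⊕ₗ J)) ↔
      IsTruncated p m ∧ IsTruncated p m' := by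
  classical
  simp only [isTruncated_iff_count_lt]
  constructor
  · refine fun h => ⟨fun i => ?_, fun j => ?_⟩
    · rw [← count_inlₗ (J := J) m m']
      exact h _
    · rw [← count_inrₗ (I := I) m m']
      exact h _
  · rintro ⟨h1, h2⟩ (i | j)
    · exact (count_inlₗ m m' i).trans_lt (h1 i)
    · exact (count_inrₗ m m' j).trans_lt (h2 j)

variable (p : ℕ) (I J) in
/-- A truncated multiset on a disjoint union is a pair of truncated multisets. -/
def truncatedSumEquiv : (Σ _ : {m : Multiset J // IsTruncated p m},
    {m : Multiset I // IsTruncated p m}) ≃ {m : Multiset (I ⊕ₗ J) // IsTruncated p m} :=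
  Equiv.ofBijective
    (fun x => ⟨(x.2 : Multiset I).map Sum.inlₗ + (x.1 : Multiset J).map Sum.inrₗ,
      isTruncated_map_inlₗ_add_map_inrₗ_iff.2 ⟨x.2.2, x.1.2⟩⟩) (by
    classical
    constructor
    · rintro ⟨⟨m', h'⟩, m, h⟩ ⟨⟨n', k'⟩, n, k⟩ hmn
      have h0 : m.map Sum.inlₗ + m'.map Sum.inrₗ = (n.map Sum.inlₗ + n'.map Sum.inrₗ :
        Multiset (I ⊕ₗ J)) := congrArg Subtype.val hmn
      obtain rfl : m = n := Multiset.ext.2 fun i => by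
        rw [← count_inlₗ (J := J) m m', h0, count_inlₗ]
      obtain rfl : m' = n' := Multiset.ext.2 fun i => by
        rw [← count_inrₗ (I := I) m m', h0, count_inrₗ]
      rfl
    · rintro ⟨n, hn⟩
      obtain ⟨m, m', rfl⟩ := exists_eq_map_inlₗ_add_map_inrₗ n
      obtain ⟨h1, h2⟩ := isTruncated_map_inlₗ_add_map_inrₗ_iff.1 hn
      exact ⟨⟨⟨m', h2⟩, m, h1⟩, rfl⟩)

end LexMultisets

/-! ### Maps between restricted enveloping algebras and the resulting free modules. -/

section Freeness

open PBW Module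

variable {p : ℕ} {F L K : Type*} [Field F] [LieRing L] [LieAlgebra F L]
  [RestrictedLieAlgebra p F L] [LieRing K] [LieAlgebra F K] [RestrictedLieAlgebra p F K]

/-- The homomorphism of restricted enveloping algebras induced by a homomorphism of restricted Lie
algebras. -/
def RestrictedEnvelopingAlgebra.map (f : K →ₗ⁅F⁆ L) (hf : ∀ x, f (pmap p F x) = pmap p F (f x)) :
    RestrictedEnvelopingAlgebra p F K →ₐ[F] RestrictedEnvelopingAlgebra p F L :=
  lift ((ιLie p F L).comp f) fun x => by
    rw [LieHom.comp_apply, LieHom.comp_apply, hf, ιLie_apply, ιLie_apply, ι_pmap]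

variable {f : K →ₗ⁅F⁆ L} (hf : ∀ x, f (pmap p F x) = pmap p F (f x))

theorem RestrictedEnvelopingAlgebra.map_ι (x : K) :
    RestrictedEnvelopingAlgebra.map f hf (ι p F K x) = ι p F L (f x) := by
  rw [RestrictedEnvelopingAlgebra.map, lift_ι, LieHom.comp_apply, ιLie_apply]

theorem RestrictedEnvelopingAlgebra.map_monomial {I J : Type*} {c : Basis I F K} {b : Basis J F L}
    {g : I → J} (h : ∀ i, b (g i) = f (c i)) (l : List I) :
    RestrictedEnvelopingAlgebra.map f hf (monomial p c l) = monomial p b (l.map g) := by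
  induction l with
  | nil => rw [monomial_nil, map_one, List.map_nil, monomial_nil]
  | cons i l ih => rw [List.map_cons, monomial_cons, monomial_cons, map_mul, ih, map_ι, h]

/-- The linear map `v ↦ ∑ f (v t) * y t` into `u(L)`. -/
def mulFamily {T : Type*} (y : T → RestrictedEnvelopingAlgebra p F L) :
    (T →₀ RestrictedEnvelopingAlgebra p F K) →ₗ[F] RestrictedEnvelopingAlgebra p F L :=
  Finsupp.lsum F fun t => LinearMap.mulRight F (y t) ∘ₗ
    (RestrictedEnvelopingAlgebra.map f hf).toLinearMap

theorem mulFamily_single {T : Type*} (y : T → RestrictedEnvelopingAlgebra p F L) (t : T)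
    (u : RestrictedEnvelopingAlgebra p F K) :
    mulFamily hf y (single t u) = RestrictedEnvelopingAlgebra.map f hf u * y t := by
  simp [mulFamily]

variable [hp : Fact p.Prime] [CharP F p]

/-- If the basis of `L` starts with the image of a basis of `K`, this map carries a basis to the PBW
basis of `u(L)`: `u(L)` is free over `u(K)` on the monomials in the remaining letters. -/
theorem bijective_mulFamily {I J : Type*} [LinearOrder I] [LinearOrder J] {c : Basis I F K}
    {b : Basis (I ⊕ₗ J) F L} (h : ∀ i, b (Sum.inlₗ i) = f (c i)) :
    Function.Bijective (mulFamily hf fun t : {m : Multiset J // IsTruncated p m} =>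
      monomial p b (((t : Multiset J).sort (· ≤ ·)).map Sum.inrₗ)) := by
  have h1 : mulFamily hf (fun t : {m : Multiset J // IsTruncated p m} =>
      monomial p b (((t : Multiset J).sort (· ≤ ·)).map Sum.inrₗ)) =
      ((Finsupp.basis fun _ => pbwBasis p c).equiv (pbwBasis p b)
        (truncatedSumEquiv I J p)).toLinearMap := by
    refine (Finsupp.basis fun _ => pbwBasis p c).ext ?_
    rintro ⟨t, m⟩
    rw [LinearEquiv.coe_coe, Basis.equiv_apply, Finsupp.coe_basis, mulFamily_single, pbwBasis_apply,
      pbwBasis_apply, orderedMonomial, map_monomial hf h, ← monomial_append, orderedMonomial,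
      ← sort_map_inl_add_map_inr]
    rfl
  rw [h1]
  exact LinearEquiv.bijective _

theorem exists_bijective_mulFamily [FiniteDimensional F L] (hinj : Function.Injective f) :
    ∃ (T : Type) (_ : Fintype T) (y : T → RestrictedEnvelopingAlgebra p F L),
      Function.Bijective (mulFamily hf y) := by
  obtain ⟨C, hC⟩ := Submodule.exists_isCompl (LinearMap.range (f : K →ₗ[F] L))
  have : FiniteDimensional F K := FiniteDimensional.of_injective (f : K →ₗ[F] L) hinj
  let e := LinearEquiv.ofInjective (f : K →ₗ[F] L) hinj
  let c := Module.finBasis F K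
  let b := ((((c.map e).prod (Module.finBasis F C)).map
    (Submodule.prodEquivOfIsCompl _ C hC)).reindex toLex)
  have hb : ∀ i, b (Sum.inlₗ i) = f (c i) := by
    intro i
    simp [b, Sum.inlₗ, e]
  have := finite_isTruncated p (Fin (finrank F C))
  exact ⟨_, Fintype.ofFinite _, _, bijective_mulFamily hf hb⟩

/-- For a right ideal `W` of `u(K)`, freeness makes `W u(L)` the direct sum of the `W y_t`. -/
theorem finrank_map_mul_top {T : Type} [Fintype T] {y : T → RestrictedEnvelopingAlgebra p F L}
    [FiniteDimensional F K]
    (hy : Function.Bijective (mulFamily hf y)) (W : Submodule F (RestrictedEnvelopingAlgebra p F K))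
    (hW : W * ⊤ ≤ W) : finrank F (Submodule.map (RestrictedEnvelopingAlgebra.map f hf).toLinearMap W
      * ⊤ : Submodule F (RestrictedEnvelopingAlgebra p F L)) = Fintype.card T * finrank F W := by
  have := finiteDimensional_restrictedEnvelopingAlgebra (p := p) (F := F) (L := K)
  let g : (T →₀ W) →ₗ[F] RestrictedEnvelopingAlgebra p F L :=
    mulFamily hf y ∘ₗ Finsupp.mapRange.linearMap W.subtype
  have hg : Function.Injective g :=
    hy.1.comp (Finsupp.mapRange_injective _ (map_zero _) W.subtype_injective)
  have hs : ∀ t (x : W), g (single t x) = RestrictedEnvelopingAlgebra.map f hf x * y t := by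
    intro t x
    simp only [g, LinearMap.comp_apply, Finsupp.mapRange.linearMap_apply, Finsupp.mapRange_single,
      Submodule.subtype_apply, mulFamily_single]
  have h1 : Submodule.map (RestrictedEnvelopingAlgebra.map f hf).toLinearMap W * ⊤ =
      LinearMap.range g := by
    refine le_antisymm (Submodule.mul_le.2 ?_) ?_
    · rintro _ ⟨x, hx, rfl⟩ u -
      obtain ⟨v, rfl⟩ := hy.2 u
      induction v using Finsupp.induction_linear with
      | zero =>
        rw [map_zero, mul_zero]
        exact zero_mem _
      | add v v' hv hv' =>
        rw [map_add, mul_add]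
        exact add_mem hv hv'
      | single t a =>
        refine ⟨single t ⟨x * a, hW (Submodule.mul_mem_mul hx Submodule.mem_top)⟩, ?_⟩
        rw [hs, mulFamily_single, map_mul, mul_assoc]
        rfl
    · rintro _ ⟨v, rfl⟩
      induction v using Finsupp.induction_linear with
      | zero =>
        rw [map_zero]
        exact zero_mem _
      | add v v' hv hv' =>
        rw [map_add]
        exact add_mem hv hv'
      | single t x =>
        rw [hs]
        exact Submodule.mul_mem_mul ⟨x, x.2, rfl⟩ Submodule.mem_top
  rw [h1, LinearMap.finrank_range_of_inj hg,
    (Finsupp.linearEquivFunOnFinite F W T).finrank_eq, Module.finrank_pi_fintype, Finset.sum_const,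
    Finset.card_univ, smul_eq_mul]

end Freeness

end

noncomputable section

open Finsupp RestrictedLieAlgebra RestrictedEnvelopingAlgebra

attribute [local instance 100] LieRing.ofAssociativeRing

/-! ### The commutator ideal of `u(L)` -/

section CommutatorIdeal

open Module

/-- The right ideal generated by the commutators of an algebra. -/
def commutatorIdeal (F A : Type*) [Field F] [Ring A] [Algebra F A] : Submodule F A :=
  Submodule.span F {x | ∃ u v, u * v - v * u = x} * ⊤

theorem commutator_mem_commutatorIdeal {F A : Type*} [Field F] [Ring A] [Algebra F A] (u v : A) :
    u * v - v * u ∈ commutatorIdeal F A := by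
  rw [← mul_one (u * v - v * u)]
  exact Submodule.mul_mem_mul (Submodule.subset_span ⟨u, v, rfl⟩) Submodule.mem_top

theorem mul_right_mem_commutatorIdeal {F A : Type*} [Field F] [Ring A] [Algebra F A] {u : A}
    (hu : u ∈ commutatorIdeal F A) (v : A) : u * v ∈ commutatorIdeal F A := by
  have h := Submodule.mul_mem_mul hu (Submodule.mem_top (x := v) (R := F))
  rw [commutatorIdeal, mul_assoc] at h
  exact Submodule.mul_induction_on h
    (fun a ha b _ => Submodule.mul_mem_mul ha Submodule.mem_top) (fun _ _ => Submodule.add_mem _)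

theorem map_commutatorIdeal {F A B : Type*} [Field F] [Ring A] [Algebra F A] [Ring B] [Algebra F B]
    (e : A ≃ₐ[F] B) :
    Submodule.map (e : A →ₐ[F] B).toLinearMap (commutatorIdeal F A) = commutatorIdeal F B := by
  rw [commutatorIdeal, Submodule.map_mul, Submodule.map_span, commutatorIdeal]
  congr 1
  · congr 1
    ext x
    constructor
    · rintro ⟨_, ⟨u, v, rfl⟩, rfl⟩
      exact ⟨e u, e v, by simp⟩
    · rintro ⟨u, v, rfl⟩
      exact ⟨_, ⟨e.symm u, e.symm v, rfl⟩, by simp⟩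
  · rw [Submodule.map_top, LinearMap.range_eq_top]
    exact e.surjective

variable {p : ℕ} {F L : Type*} [Field F] [LieRing L]
  [LieAlgebra F L] [RestrictedLieAlgebra p F L]

variable (p F L) in
theorem lie_mem_derivedRestricted (x y : L) : ⁅x, y⁆ ∈ derivedRestricted p F L := by
  rw [derivedRestricted, restrictedClosure, ← SetLike.mem_coe, LieSubalgebra.coe_sInf]
  simp only [Set.mem_iInter]
  exact fun K hK => hK.1 (LieSubmodule.lie_mem_lie (LieSubmodule.mem_top x) (LieSubmodule.mem_top y))

variable (p F L) in
/-- The restricted subalgebra generated by the derived subalgebra, as an ideal. -/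
def derivedRestrictedIdeal : LieIdeal F L where
  __ := (derivedRestricted p F L).toSubmodule
  -- A subspace containing all brackets is automatically an ideal.
  lie_mem := fun {x y} _ => lie_mem_derivedRestricted p F L x y

theorem incl_pmap (x : derivedRestricted p F L) : (derivedRestricted p F L).incl (pmap p F x) =
    pmap p F ((derivedRestricted p F L).incl x) := rfl

variable [hp : Fact p.Prime]

/-- The elements of `L` lying in this right ideal contain all brackets, and are closed under `[p]`
because `x ^ p = x * x ^ (p - 1)`. -/
theorem ι_mem_commutatorIdeal {x : L} (hx : x ∈ derivedRestricted p F L) :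
    ι p F L x ∈ commutatorIdeal F (RestrictedEnvelopingAlgebra p F L) := by
  let S : LieSubalgebra F L :=
    { (commutatorIdeal F (RestrictedEnvelopingAlgebra p F L)).comap (ι p F L) with
      lie_mem' := fun {x y} _ _ => by
        change ι p F L ⁅x, y⁆ ∈ commutatorIdeal F (RestrictedEnvelopingAlgebra p F L)
        rw [ι_lie]
        exact commutator_mem_commutatorIdeal _ _ }
  have hS : derivedRestricted p F L ≤ S := by
    refine sInf_le ⟨?_, fun x hx => ?_⟩
    · change LieSubmodule.toSubmodule ⁅(⊤ : LieIdeal F L), (⊤ : LieIdeal F L)⁆ ≤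
        (commutatorIdeal F (RestrictedEnvelopingAlgebra p F L)).comap (ι p F L)
      rw [LieSubmodule.lieIdeal_oper_eq_linear_span']
      refine Submodule.span_le.2 ?_
      rintro _ ⟨x, -, y, -, rfl⟩
      change ι p F L ⁅x, y⁆ ∈ commutatorIdeal F (RestrictedEnvelopingAlgebra p F L)
      rw [ι_lie]
      exact commutator_mem_commutatorIdeal _ _
    · change ι p F L (pmap p F x) ∈ commutatorIdeal F (RestrictedEnvelopingAlgebra p F L)
      rw [ι_pmap, ← mul_pow_sub_one hp.out.ne_zero]
      exact mul_right_mem_commutatorIdeal hx _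
  exact hS hx

theorem commutatorIdeal_eq_idealSpan : commutatorIdeal F (RestrictedEnvelopingAlgebra p F L) =
    idealSpan p (derivedRestrictedIdeal p F L) := by
  refine le_antisymm (Submodule.mul_le.2 fun u hu v _ => ?_) (Submodule.span_le.2 ?_)
  · refine mul_right_mem_idealSpan v ?_
    refine Submodule.span_le.2 ?_ hu
    rintro _ ⟨x, y, rfl⟩
    exact commutator_mem_idealSpan (lie_mem_derivedRestricted p F L) x y
  · rintro _ ⟨g, hg, v, rfl⟩
    exact mul_right_mem_commutatorIdeal (ι_mem_commutatorIdeal hg) v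

/-- The augmentation ideal of `u(L)`, as a subspace. -/
abbrev augmentationSubmodule (p : ℕ) [Fact p.Prime] (F L : Type*) [Field F] [LieRing L]
    [LieAlgebra F L] [RestrictedLieAlgebra p F L] :
    Submodule F (RestrictedEnvelopingAlgebra p F L) :=
  (augmentationIdeal p F L).restrictScalars F

theorem commutatorIdeal_eq_map_mul_top : commutatorIdeal F (RestrictedEnvelopingAlgebra p F L) =
    Submodule.map (RestrictedEnvelopingAlgebra.map _ (incl_pmap (p := p))).toLinearMap
      (augmentationSubmodule p F (derivedRestricted p F L)) * ⊤ := by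
  rw [commutatorIdeal_eq_idealSpan]
  refine le_antisymm (Submodule.span_le.2 ?_) (Submodule.mul_le.2 ?_)
  · rintro _ ⟨g, hg, v, rfl⟩
    refine Submodule.mul_mem_mul ⟨ι p F _ ⟨g, hg⟩, ι_mem_augmentationIdeal _, ?_⟩ Submodule.mem_top
    exact map_ι incl_pmap _
  · rintro _ ⟨u, hu, rfl⟩ v -
    refine mul_right_mem_idealSpan v ?_
    refine Submodule.mul_induction_on (mem_range_ι_mul_top hu) ?_ ?_
    · rintro _ ⟨x, rfl⟩ v -
      rw [AlgHom.toLinearMap_apply, map_mul, map_ι]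
      exact ι_mul_mem_idealSpan x.2 _
    · intro x y hx hy
      rw [map_add]
      exact add_mem hx hy

theorem top_mul_commutatorIdeal :
    ⊤ * commutatorIdeal F (RestrictedEnvelopingAlgebra p F L) =
      commutatorIdeal F (RestrictedEnvelopingAlgebra p F L) := by
  refine le_antisymm (Submodule.mul_le.2 fun u _ v hv => ?_) fun v hv => ?_
  · rw [commutatorIdeal_eq_idealSpan] at hv ⊢
    exact mul_left_mem_idealSpan u hv
  · rw [← one_mul v]
    exact Submodule.mul_mem_mul Submodule.mem_top hv

/-- The commutator ideal `ω(L'_p) u(L)` is also a left ideal, so the inner factors `u(L)` of its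
powers are absorbed. -/
theorem commutatorIdeal_pow_eq {n : ℕ} (hn : 1 ≤ n) :
    commutatorIdeal F (RestrictedEnvelopingAlgebra p F L) ^ n =
    Submodule.map (RestrictedEnvelopingAlgebra.map _ (incl_pmap (p := p))).toLinearMap
      (augmentationSubmodule p F (derivedRestricted p F L) ^ n) * ⊤ := by
  induction n, hn using Nat.le_induction with
  | base => rw [pow_one, pow_one, commutatorIdeal_eq_map_mul_top]
  | succ n _ ih =>
    rw [pow_succ, ih, mul_assoc, top_mul_commutatorIdeal, commutatorIdeal_eq_map_mul_top,
      ← mul_assoc, ← Submodule.map_mul, ← pow_succ]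

theorem exists_finrank_commutatorIdeal_pow (p : ℕ) [hp : Fact p.Prime] (F L : Type*) [Field F]
    [LieRing L] [LieAlgebra F L] [RestrictedLieAlgebra p F L] [CharP F p] [FiniteDimensional F L] :
    ∃ t : ℕ, finrank F (RestrictedEnvelopingAlgebra p F L) =
      t * finrank F (RestrictedEnvelopingAlgebra p F (derivedRestricted p F L)) ∧
      ∀ n, 1 ≤ n → finrank F (commutatorIdeal F (RestrictedEnvelopingAlgebra p F L) ^ n :
        Submodule F (RestrictedEnvelopingAlgebra p F L)) = t * finrank F
        ((augmentationIdeal p F (derivedRestricted p F L) ^ n).restrictScalars F) := by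
  obtain ⟨T, _, y, hy⟩ := exists_bijective_mulFamily (incl_pmap (p := p) (F := F) (L := L))
    Subtype.val_injective
  refine ⟨Fintype.card T, ?_, fun n hn => ?_⟩
  · have h := finrank_map_mul_top _ hy ⊤ le_top
    have h1 : Submodule.map (RestrictedEnvelopingAlgebra.map _
        (incl_pmap (p := p) (F := F) (L := L))).toLinearMap ⊤ * ⊤ = ⊤ := by
      refine eq_top_iff.2 fun u _ => ?_
      rw [← one_mul u]
      exact Submodule.mul_mem_mul ⟨1, Submodule.mem_top, map_one (RestrictedEnvelopingAlgebra.map _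
        (incl_pmap (p := p)))⟩ Submodule.mem_top
    rwa [h1, finrank_top, finrank_top] at h
  · rw [commutatorIdeal_pow_eq hn, ← Submodule.restrictScalars_pow (Nat.pos_iff_ne_zero.1 hn)]
    exact finrank_map_mul_top _ hy _
      (Submodule.mul_le.2 fun u hu v _ => Ideal.mul_mem_right v _ hu)

theorem finrank_augmentationIdeal_add_one (p : ℕ) [hp : Fact p.Prime] (F L : Type*) [Field F]
    [LieRing L] [LieAlgebra F L] [RestrictedLieAlgebra p F L] [CharP F p] [FiniteDimensional F L] :
    finrank F ((augmentationIdeal p F L ^ 1).restrictScalars F) + 1 =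
      finrank F (RestrictedEnvelopingAlgebra p F L) := by
  have := finiteDimensional_restrictedEnvelopingAlgebra (p := p) (F := F) (L := L)
  have h := LinearMap.finrank_range_add_finrank_ker (augmentation p F L).toLinearMap
  have h1 : LinearMap.range (augmentation p F L).toLinearMap = ⊤ :=
    LinearMap.range_eq_top.2 fun a => ⟨algebraMap F _ a, by simp⟩
  rw [h1, finrank_top, finrank_self, add_comm] at h
  rw [Submodule.pow_one]
  exact h

variable [CharP F p] {H : Type*} [LieRing H] [LieAlgebra F H] [RestrictedLieAlgebra p F H]

/-- The rank `t` of `u(L)` over `u(L'_p)` is the codimension of the commutator ideal, because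
`ω(L'_p)` has codimension `1` in `u(L'_p)`. So `t` is an invariant of the algebra and may be
cancelled. -/
theorem finrank_augmentationIdeal_derivedRestricted_pow_eq [FiniteDimensional F L]
    [FiniteDimensional F H]
    (e : RestrictedEnvelopingAlgebra p F L ≃ₐ[F] RestrictedEnvelopingAlgebra p F H) (n : ℕ) :
    finrank F ((augmentationIdeal p F (derivedRestricted p F L) ^ n).restrictScalars F) =
      finrank F ((augmentationIdeal p F (derivedRestricted p F H) ^ n).restrictScalars F) := by
  have := finiteDimensional_restrictedEnvelopingAlgebra (p := p) (F := F) (L := L)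
  obtain ⟨t, h1, h2⟩ := exists_finrank_commutatorIdeal_pow p F L
  obtain ⟨s, h3, h4⟩ := exists_finrank_commutatorIdeal_pow p F H
  have h5 := finrank_augmentationIdeal_add_one p F (derivedRestricted p F L)
  have h6 := finrank_augmentationIdeal_add_one p F (derivedRestricted p F H)
  have h7 := e.toLinearEquiv.finrank_eq
  have h8 : ∀ n, finrank F (commutatorIdeal F (RestrictedEnvelopingAlgebra p F L) ^ n :
      Submodule F (RestrictedEnvelopingAlgebra p F L)) =
      finrank F (commutatorIdeal F (RestrictedEnvelopingAlgebra p F H) ^ n :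
        Submodule F (RestrictedEnvelopingAlgebra p F H)) := by
    intro n
    rw [← map_commutatorIdeal e, ← Submodule.map_pow]
    exact (e.toLinearEquiv.finrank_map_eq _).symm
  have h9 : 0 < finrank F (RestrictedEnvelopingAlgebra p F L) := by
    have : Nontrivial (RestrictedEnvelopingAlgebra p F L) :=
      (augmentation p F L).toRingHom.domain_nontrivial
    exact finrank_pos
  have h10 := h8 1
  rw [h2 1 le_rfl, h4 1 le_rfl] at h10
  have hts : t = s := by
    rw [h1, h3, ← h5, ← h6, mul_add, mul_add, h10] at h7
    omega
  subst hts
  have ht : 0 < t := Nat.pos_of_ne_zero fun h => by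
    rw [h1, h, zero_mul] at h9
    exact h9.false
  rcases Nat.eq_zero_or_pos n with rfl | hn
  · rw [Submodule.pow_zero, Submodule.pow_zero, Ideal.one_eq_top, Ideal.one_eq_top,
      Submodule.restrictScalars_top, Submodule.restrictScalars_top, finrank_top, finrank_top]
    exact Nat.eq_of_mul_eq_mul_left ht (by rw [← h1, ← h3, h7])
  · exact Nat.eq_of_mul_eq_mul_left ht (by rw [← h2 n hn, ← h4 n hn, h8])

theorem nonempty_restrictedLieEquiv_dimensionQuotient_derivedRestricted [FiniteDimensional F L]
    [FiniteDimensional F H]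
    (e : RestrictedEnvelopingAlgebra p F L ≃ₐ[F] RestrictedEnvelopingAlgebra p F H) {n : ℕ}
    (hn : 1 ≤ n) : Nonempty (RestrictedLieEquiv p F
      (DimensionQuotient p F (derivedRestricted p F L) n)
      (DimensionQuotient p F (derivedRestricted p F H) n)) :=
  ⟨DimensionQuotient.restrictedLieEquiv hn (LinearEquiv.ofFinrankEq _ _
    (finrank_dimensionQuotient_eq (finrank_augmentationIdeal_derivedRestricted_pow_eq e) n hn))⟩

end CommutatorIdeal

end

/-! ### The three statements together; the bound on classes is symmetric in `L` and `H`. -/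

theorem mainTheorem9 (p : ℕ) [Fact p.Prime] (F : Type*) [Field F] [CharP F p]
    (L : Type*) [LieRing L] [LieAlgebra F L] [RestrictedLieAlgebra p F L]
    (H : Type*) [LieRing H] [LieAlgebra F H] [RestrictedLieAlgebra p F H]
    (hu : Nonempty (RestrictedEnvelopingAlgebra p F L ≃ₐ[F] RestrictedEnvelopingAlgebra p F H)) :
    (∀ i : ℕ, 1 ≤ i →
      Nonempty (RestrictedLieEquiv p F (DimensionQuotient p F L i) (DimensionQuotient p F H i))) ∧
    (FiniteDimensional F L → RestrictedLieAlgebra.IsPNilpotent p F L →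
      LieRing.IsNilpotent L ∧ LieRing.IsNilpotent H ∧
      |(LieModule.nilpotencyLength L L : ℤ) - (LieModule.nilpotencyLength H H : ℤ)| ≤ 1) ∧
    (FiniteDimensional F L → FiniteDimensional F H → ∀ n : ℕ, 1 ≤ n →
      Nonempty (RestrictedLieEquiv p F
        (DimensionQuotient p F (RestrictedLieAlgebra.derivedRestricted p F L) n)
        (DimensionQuotient p F (RestrictedLieAlgebra.derivedRestricted p F H) n))) := by
  obtain ⟨e⟩ := hu
  refine ⟨fun i hi => nonempty_restrictedLieEquiv_dimensionQuotient e hi, fun _ hL => ?_,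
    fun _ _ n hn => ?_⟩
  · have := finiteDimensional_of_algEquiv e
    have hH := IsPNilpotent.of_algEquiv hL e
    have h1 := IsPNilpotent.isNilpotent hL
    have h2 := IsPNilpotent.isNilpotent hH
    refine ⟨h1, h2, ?_⟩
    have h3 := nilpotencyLength_le_succ_of_algEquiv e
    have h4 := nilpotencyLength_le_succ_of_algEquiv e.symm
    rw [abs_le]
    omega
  · exact nonempty_restrictedLieEquiv_dimensionQuotient_derivedRestricted e hn
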